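/- **Setting.** Let $k\ge 4$ be an integer, $\mathcal N$ an odd square-free positive integer, $q$ a prime dividing $\mathcal N$, and $\chi$ a Dirichlet character modulo $\mathcal N$ with $\chi^2=1$. Write $\chi=\chi_q\,\chi_{\mathcal N/q}$ with $\chi_q$ a character modulo $q$ and $\chi_{\mathcal N/q}$ a character modulo $\mathcal N/q$. Set $\epsilon=\left(\frac{-1}{q}\right)$, $\mathbb F=\mathbb Z/q\mathbb Z$, and let $\omega\in\mathbb Z$ with $\left(\frac{\omega}{q}\right)=-1$. Let $\mathcal H_{(2)}$ be the Siegel upper half space of degree 2 (complex symmetric $2\times 2$ matrices with positive definite imaginary part), and for $L\ge1$ let $\Gamma_0(L)$ be the group of $\gamma=\begin{pmatrix}A&B\\ C&D\end{pmatrix}\in Sp_2(\mathbb Z)$ ($2\times2$ blocks, $D=D_\gamma$) with $C\equiv0\pmod L$. **Eisenstein series.** For a diagonal integral $2\times2$ matrix $M_*$ and a level $L$ divisible by $\mathcal N$, put $$\mathbb E_*(\tau)=\frac12\sum_{(M\ N)}\overline{\chi}(\det D_\gamma)\,\det(M\tau+N)^{-k}\qquad(\tau\in\mathcal H_{(2)}),$$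 where $(M\ N)$ runs over representatives of the $SL_2(\mathbb Z)$-classes in the $\Gamma_0(L)$-orbit of $SL_2(\mathbb Z)(M_*\ I)$, and for each of them $\gamma\in\Gamma_0(L)$ is such that $SL_2(\mathbb Z)(M\ N)=SL_2(\mathbb Z)(M_*\ I)\gamma$. Fix a factorization $\mathcal N/q=\mathcal N_0\mathcal N_1\mathcal N_2$. Let $M_2$, $M_{1,2,+}$, $M_{1,2,-}$ and $M_{0,2,\alpha}$ ($\alpha\in\mathbb F^\times$) be any diagonal integral matrices, each congruent to $0$, $\begin{pmatrix}1&0\\0&0\end{pmatrix}$, $I$ modulo every prime dividing $\mathcal N_0$, $\mathcal N_1$, $\mathcal N_2$ respectively, and such that $M_2\equiv I\pmod q$ and, modulo $q^2$, $$M_{1,2,+}\equiv\begin{pmatrix}1&0\\0&q\end{pmatrix},\quad M_{1,2,-}\equiv\begin{pmatrix}1&0\\0&q\omega\end{pmatrix},\quad M_{0,2,\alpha}\equiv\begin{pmatrix}q&0\\0&q\alpha\end{pmatrix}.$$ Let $\mathbb E_2$ be the series of level $L=\mathcal N$ attached to $M_2$, and let $\mathbb E_{1,2,\pm}$, $\mathbb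 E_{0,2,\alpha}$ be the series of level $L=q\mathcal N$ attached to $M_{1,2,\pm}$, $M_{0,2,\alpha}$. For $\nu=\pm1$ put $\mathbb E_{0,2,\nu}=\sum_{\alpha}\mathbb E_{0,2,\alpha}$, the sum over $\alpha\in\mathbb F^\times$ with $\left(\frac{\alpha}{q}\right)=\nu$. **Twist operator.** For a function $f$ on $\mathcal H_{(2)}$, $$f|A_2^*(q)=\sum_{Y}\left(\frac{\det Y}{q}\right)f\Big|\begin{pmatrix}I&Y/q\\0&I\end{pmatrix},$$ where $Y$ runs over the integral symmetric $2\times2$ matrices $\begin{pmatrix}y_1&y_2\\y_2&y_4\end{pmatrix}$ with $0\le y_1,y_2,y_4<q$, and $(f|\gamma)(\tau)=(\det\gamma)^{k/2}\det(C\tau+D)^{-k}f((A\tau+B)(C\tau+D)^{-1})$. **Proposition 5.33.** If $\chi_q\ne1$, then the series defining $\mathbb E_{0,2,\alpha}$, $\mathbb E_{1,2,\pm}$ and $\mathbb E_2$ converge absolutely on $\mathcal H_{(2)}$, and for $\nu=\pm1$, $$\mathbb E_{0,2,\nu}|A_2^*(q)=\epsilon q(q-2)\,\mathbb E_{0,2,\nu}+\epsilon\nu\,\chi_{\mathcal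 N/q}(q)\,q^{1-k}\,\frac{q-1}{2}\,\bigl(\mathbb E_{1,2,+}-\mathbb E_{1,2,-}\bigr)+q^{1-2k}\,\frac{(q-1)(q+\epsilon\nu)}{2}\,\mathbb E_2 .$$ -/

import Mathlib

open Matrix Finset
open scoped MatrixGroups ComplexConjugate

noncomputable section

namespace SiegelDegreeTwo

/-- Integral `2 × 2` matrices. -/
abbrev IntMat : Type := Matrix (Fin 2) (Fin 2) ℤ

/-- The Siegel upper half space of degree 2: symmetric complex `2 × 2` matrices `X + iY` with
`X`, `Y` real and `Y` positive definite. -/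
def siegelUpperHalfSpace : Set (Matrix (Fin 2) (Fin 2) ℂ) :=
  {τ | τᵀ = τ ∧ (τ.map Complex.im).PosDef}

/-- `Γ₀(L)`: the elements `(A B; C D)` of `Sp₂(ℤ)` with `C ≡ 0` modulo `L`. -/
def Gamma0 (L : ℕ) : Set (symplecticGroup (Fin 2) ℤ) :=
  {γ | ∀ i j, (L : ℤ) ∣ (γ : Matrix (Fin 2 ⊕ Fin 2) (Fin 2 ⊕ Fin 2) ℤ).toBlocks₂₁ i j}

/-- The pair `(M N) γ = (M A + N C, M B + N D)`, where `γ = (A B; C D)`. -/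
def pairMul (P : IntMat × IntMat) (γ : symplecticGroup (Fin 2) ℤ) : IntMat × IntMat :=
  let g : Matrix (Fin 2 ⊕ Fin 2) (Fin 2 ⊕ Fin 2) ℤ := γ
  (P.1 * g.toBlocks₁₁ + P.2 * g.toBlocks₂₁, P.1 * g.toBlocks₁₂ + P.2 * g.toBlocks₂₂)

/-- The pair `E (M N) = (E M, E N)` for `E ∈ SL₂(ℤ)`. -/
def leftMul (E : SL(2, ℤ)) (P : IntMat × IntMat) : IntMat × IntMat :=
  ((E : IntMat) * P.1, (E : IntMat) * P.2)

/-- The pairs `(M N)` with `SL₂(ℤ) (M N)` in the `Γ₀(L)`-orbit of `SL₂(ℤ) (M₀ I)`. -/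
def orbit (L : ℕ) (M₀ : IntMat) : Set (IntMat × IntMat) :=
  {P | ∃ γ : symplecticGroup (Fin 2) ℤ, γ ∈ Gamma0 L ∧
    ∃ E : SL(2, ℤ), P = leftMul E (pairMul (M₀, 1) γ)}

/-- `SL₂(ℤ)`-equivalence of the pairs in an orbit. -/
def orbitSetoid (L : ℕ) (M₀ : IntMat) : Setoid (orbit L M₀) where
  r P Q := ∃ E : SL(2, ℤ), (Q : IntMat × IntMat) = leftMul E P
  iseqv :=
    { refl := fun P => ⟨1, by simp [leftMul]⟩
      symm := by
        rintro P Q ⟨E, h⟩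
        refine ⟨E⁻¹, ?_⟩
        have hE : ((E⁻¹ : SL(2, ℤ)) : IntMat) * (E : IntMat) = 1 := by
          have h1 := congrArg Subtype.val (inv_mul_cancel E)
          exact h1
        rw [h]
        simp only [leftMul, ← Matrix.mul_assoc, hE, Matrix.one_mul]
      trans := by
        rintro P Q R ⟨E, h⟩ ⟨F, h'⟩
        refine ⟨F * E, ?_⟩
        rw [h', h]
        simp [leftMul, Matrix.mul_assoc] }

/-- The set of `SL₂(ℤ)`-equivalence classes of pairs in an orbit. -/
abbrev OrbitClasses (L : ℕ) (M₀ : IntMat) : Type := Quotient (orbitSetoid L M₀)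

/-- The number `χ(det D_γ)`, where `γ ∈ Γ₀(L)` is such that
`SL₂(ℤ) (M N) = SL₂(ℤ) (M₀ I) γ` (for the matrices `M₀` below it depends only on the class of
`(M N)`, not on the choice of `γ`). -/
def orbitCharacter {𝒩 : ℕ} (χ : DirichletCharacter ℂ 𝒩) (L : ℕ) (M₀ : IntMat)
    (P : orbit L M₀) : ℂ :=
  let γ : Matrix (Fin 2 ⊕ Fin 2) (Fin 2 ⊕ Fin 2) ℤ := (P.2.choose : symplecticGroup (Fin 2) ℤ)
  χ ((γ.toBlocks₂₂.det : ℤ) : ZMod 𝒩)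

/-- The term `χ̄(det D_γ) det(M τ + N)⁻ᵏ` attached to a class of pairs `(M N)`. -/
def eisensteinTerm (k : ℕ) {𝒩 : ℕ} (χ : DirichletCharacter ℂ 𝒩) (L : ℕ) (M₀ : IntMat)
    (τ : Matrix (Fin 2) (Fin 2) ℂ) (c : OrbitClasses L M₀) : ℂ :=
  conj (orbitCharacter χ L M₀ c.out) *
    ((((c.out : IntMat × IntMat).1.map (Int.cast : ℤ → ℂ)) * τ +
      ((c.out : IntMat × IntMat).2.map (Int.cast : ℤ → ℂ))).det) ^ (-(k : ℤ))

/-- The Eisenstein series `𝔼` of weight `k`, level `L` and character `χ` attached to `M₀`: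
`2 𝔼(τ) = ∑ χ̄(det D_γ) det(M τ + N)⁻ᵏ`, where `(M N)` runs over representatives of the
`SL₂(ℤ)`-classes in the `Γ₀(L)`-orbit of `SL₂(ℤ) (M₀ I)`. -/
def eisenstein (k : ℕ) {𝒩 : ℕ} (χ : DirichletCharacter ℂ 𝒩) (L : ℕ) (M₀ : IntMat)
    (τ : Matrix (Fin 2) (Fin 2) ℂ) : ℂ :=
  (1 / 2) * ∑' c : OrbitClasses L M₀, eisensteinTerm k χ L M₀ τ c

/-- Entrywise congruence of integral matrices modulo `n`. -/
def MatCong (n : ℕ) (A B : IntMat) : Prop := ∀ i j, A i j ≡ B i j [ZMOD (n : ℤ)]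

/-- `M` is an admissible choice of the matrix `M_σ` of the multiplicative partition
`σ = (N₀, N₁, N₂)`: it is diagonal and congruent to `0`, `diag(1, 0)`, `I` modulo the primes
dividing `N₀`, `N₁`, `N₂` respectively. -/
def IsPartitionMatrix (N₀ N₁ N₂ : ℕ) (M : IntMat) : Prop :=
  M.IsDiag ∧
  (∀ p : ℕ, p.Prime → p ∣ N₀ → MatCong p M 0) ∧
  (∀ p : ℕ, p.Prime → p ∣ N₁ → MatCong p M (diagonal ![1, 0])) ∧
  (∀ p : ℕ, p.Prime → p ∣ N₂ → MatCong p M 1)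

/-- The action `f | γ (τ) = (det γ)^(k/2) det(C τ + D)⁻ᵏ f((A τ + B) (C τ + D)⁻¹)` for a rational
matrix `γ = (A B; C D)`. -/
def slash (k : ℕ) (f : Matrix (Fin 2) (Fin 2) ℂ → ℂ)
    (γ : Matrix (Fin 2 ⊕ Fin 2) (Fin 2 ⊕ Fin 2) ℚ) (τ : Matrix (Fin 2) (Fin 2) ℂ) : ℂ :=
  let g : Matrix (Fin 2 ⊕ Fin 2) (Fin 2 ⊕ Fin 2) ℂ := γ.map (Rat.cast : ℚ → ℂ)
  g.det ^ ((k : ℂ) / 2) * (g.toBlocks₂₁ * τ + g.toBlocks₂₂).det ^ (-(k : ℤ)) *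
    f ((g.toBlocks₁₁ * τ + g.toBlocks₁₂) * (g.toBlocks₂₁ * τ + g.toBlocks₂₂)⁻¹)

/-- The twist operator `A₂*(q)`:
`f | A₂*(q) = ∑_Y (det Y / q) f | (I Y/q; 0 I)`, where `Y = (y₁ y₂; y₂ y₄)` runs over the
integral symmetric matrices modulo `q`. -/
def twistA2 (k q : ℕ) [Fact q.Prime] (f : Matrix (Fin 2) (Fin 2) ℂ → ℂ)
    (τ : Matrix (Fin 2) (Fin 2) ℂ) : ℂ :=
  ∑ y₁ ∈ range q, ∑ y₂ ∈ range q, ∑ y₄ ∈ range q,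
    let Y : IntMat := !![(y₁ : ℤ), (y₂ : ℤ); (y₂ : ℤ), (y₄ : ℤ)]
    (legendreSym q Y.det : ℂ) *
      slash k f (fromBlocks 1 ((q : ℚ)⁻¹ • Y.map (Int.cast : ℤ → ℚ)) 0 1) τ

/-- `𝔼_{0,2,ν} = ∑ 𝔼_{0,2,α}`, the sum over the `α ∈ (ℤ/q)ˣ` with `(α/q) = ν`; here
`𝔼_{0,2,α}` is the level `q𝒩` Eisenstein series attached to `M₀₂ α`. -/
def eisenstein02 (k q : ℕ) [Fact q.Prime] {𝒩 : ℕ} (χ : DirichletCharacter ℂ 𝒩)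
    (M₀₂ : (ZMod q)ˣ → IntMat) (ν : ℤˣ) (τ : Matrix (Fin 2) (Fin 2) ℂ) : ℂ :=
  ∑ α : (ZMod q)ˣ with (quadraticChar (ZMod q)) α.val = (ν : ℤ),
    eisenstein k χ (q * 𝒩) (M₀₂ α) τ

end SiegelDegreeTwo

end

/-!
The Eisenstein series are rewritten as sums over integral vectors, on which the twist operator acts
through a finite character sum.

An `SL₂(ℤ)`-class of coprime symmetric pairs `(M N)` is determined by its Plücker vector
`v = (m, b₁, b₂, b₃, n) ∈ ℤ⁵`, where `m = det M`, `n = det N` and the `bᵢ` are the mixed minors.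
These vectors are exactly the primitive ones on the quadric `m n = b₁ b₃ - b₂²`
(`exists_pair_of_isPrimitive`, `exists_mul_eq_of_plucker_eq`), and `det (M τ + N)` is the value
`ell τ v` of a linear form. Since `SL₂(ℤ) → SL₂(ℤ/L)` is surjective, the `Γ₀(L)`-orbit of `(M₀ I)`
is cut out by congruence conditions on `v` modulo `L` (`exists_mem_orbit_of_isLocalOrbit`), and
`χ̄(det D_γ)` is a function of `v` modulo `L`. So each series is `1/2 ∑ C(v) ell τ v ^ (-k)` for an
explicit coefficient function `C`, the product of a factor `awayCoeff` at the primes other than `q`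
and of a factor at `q` given by Legendre symbols (`isCoefficient_coeff₂`, `isCoefficient_coeff₁₂`,
`isCoefficient_coeff₀₂`).

Absolute convergence holds for `k ≥ 4`: by compactness `‖ell τ v‖` is bounded below by a multiple of
the size of `v` on the real quadric, and the divisor bound controls the number of integral vectors of
given size on the quadric (`summable_mul_ell_zpow`).

The series `𝔼_{0,2,ν}` is supported on the vectors `(q² m, q b, n)`, and on them the translation
`τ ↦ τ + Y/q` becomes the integral translation by `Y` of `(m, b, n)`. Collecting terms, the
coefficient of the twisted series at `(q² m, q b, n)` is a Legendre symbol times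
`∑_Z (det Z / q) [(det (X - Z) / q) = ν]`, where `Z` runs over the symmetric matrices over `ℤ/q` and
`X = b/m` (`sum_legendreSym_mul_dilatedCoeff`). This sum depends only on the rank of `X`, and on the
class of `det X` if it is nonzero (`twistSum_charInd_of_det_ne_zero`,
`two_mul_twistSum_charInd_of_det_eq_zero`, `two_mul_twistSum_charInd_zero`). The vectors with `X` of
rank two give back `𝔼_{0,2,ν}`; those of rank one are `q (q m, b, n/q)` and give
`𝔼_{1,2,+} - 𝔼_{1,2,-}`; those with `X = 0` are `q² (m, b/q, n/q²)` and give `𝔼₂`.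
-/

noncomputable section

namespace SiegelDegreeTwo

/-! ### Plücker vectors of symmetric pairs -/

/-- A vector `(m, b₁, b₂, b₃, n)` of the five-dimensional space that contains the Plücker
coordinates of the symmetric pairs `(M N)`: `m = det M`, `n = det N`, and `b₁, b₂, b₃` are the
mixed minors, so that `det (M τ + N) = m det τ + b₁ τ₁₁ + 2 b₂ τ₁₂ + b₃ τ₂₂ + n`. -/
@[ext]
structure PluckerVec (R : Type*) where
  /-- the minor `det M` -/
  m : R
  /-- the coefficient of `τ₁₁` -/
  b₁ : R
  /-- half the coefficient of `τ₁₂` -/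
  b₂ : R
  /-- the coefficient of `τ₂₂` -/
  b₃ : R
  /-- the minor `det N` -/
  n : R

namespace PluckerVec

variable {R S : Type*} [CommRing R] [CommRing S]

/-- The image of a vector under a ring homomorphism. -/
def map (f : R →+* S) (v : PluckerVec R) : PluckerVec S :=
  ⟨f v.m, f v.b₁, f v.b₂, f v.b₃, f v.n⟩

/-- The vectors on the quadric `m n = b₁ b₃ - b₂ ^ 2`, which is the Plücker relation. -/
def IsIsotropic (v : PluckerVec R) : Prop := v.m * v.n = v.b₁ * v.b₃ - v.b₂ ^ 2

/-- The vectors whose coordinates generate the unit ideal. -/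
def IsPrimitive (v : PluckerVec R) : Prop :=
  ∃ c₀ c₁ c₂ c₃ c₄ : R, c₀ * v.m + c₁ * v.b₁ + c₂ * v.b₂ + c₃ * v.b₃ + c₄ * v.n = 1

/-- The effect on Plücker vectors of `(M N) ↦ (M, M T + N)`, where `T = (t₁ t₂; t₂ t₃)`. -/
def translate (t₁ t₂ t₃ : R) (v : PluckerVec R) : PluckerVec R :=
  ⟨v.m, v.b₁ + v.m * t₃, v.b₂ - v.m * t₂, v.b₃ + v.m * t₁,
    v.n + v.b₁ * t₁ + 2 * v.b₂ * t₂ + v.b₃ * t₃ + v.m * (t₁ * t₃ - t₂ ^ 2)⟩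

theorem IsPrimitive.map {v : PluckerVec R} (hv : v.IsPrimitive) (f : R →+* S) :
    (v.map f).IsPrimitive := by
  obtain ⟨c₀, c₁, c₂, c₃, c₄, h⟩ := hv
  exact ⟨f c₀, f c₁, f c₂, f c₃, f c₄, by simpa [PluckerVec.map] using congrArg f h⟩

end PluckerVec

section Pairs

variable {R S : Type*} [CommRing R] [CommRing S]

/-- The Plücker vector of a pair `(M N)` with `M Nᵀ` symmetric. -/
def plucker (M N : Matrix (Fin 2) (Fin 2) R) : PluckerVec R :=
  ⟨M.det, M 0 0 * N 1 1 - M 1 0 * N 0 1, M 0 1 * N 1 1 - M 1 1 * N 0 1,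
    N 0 0 * M 1 1 - N 1 0 * M 0 1, N.det⟩

theorem plucker_map (f : R →+* S) (M N : Matrix (Fin 2) (Fin 2) R) :
    plucker (M.map f) (N.map f) = (plucker M N).map f := by
  simp [plucker, PluckerVec.map, Matrix.det_fin_two]

theorem plucker_mul_left (E M N : Matrix (Fin 2) (Fin 2) R)  :
    plucker (E * M) (E * N) = ⟨E.det * (plucker M N).m, E.det * (plucker M N).b₁,
      E.det * (plucker M N).b₂, E.det * (plucker M N).b₃, E.det * (plucker M N).n⟩ := by
  ext <;> simp [plucker, Matrix.det_fin_two, Matrix.mul_apply, Fin.sum_univ_two] <;> ring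

theorem plucker_mul_left_of_det {E : Matrix (Fin 2) (Fin 2) R} (hE : E.det = 1)
    (M N : Matrix (Fin 2) (Fin 2) R) : plucker (E * M) (E * N) = plucker M N := by
  rw [plucker_mul_left, hE]; simp

/-- `M Nᵀ = N Mᵀ`, written out. -/
theorem mul_transpose_comm_iff (M N : Matrix (Fin 2) (Fin 2) R) :
    M * Nᵀ = N * Mᵀ ↔
      M 0 0 * N 1 0 + M 0 1 * N 1 1 = M 1 0 * N 0 0 + M 1 1 * N 0 1 := by
  constructor
  · intro h
    have := congrFun (congrFun h 0) 1
    simp only [Matrix.mul_apply, Fin.sum_univ_two, transpose_apply] at this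
    linear_combination this
  · intro h
    ext i j
    fin_cases i <;> fin_cases j <;>
      simp only [Matrix.mul_apply, Fin.sum_univ_two, transpose_apply, Fin.zero_eta, Fin.mk_one,
        Fin.isValue]
    · ring
    · linear_combination h
    · linear_combination -h
    · ring

theorem plucker_isIsotropic {M N : Matrix (Fin 2) (Fin 2) R} (h : M * Nᵀ = N * Mᵀ) :
    (plucker M N).IsIsotropic := by
  rw [mul_transpose_comm_iff] at h
  simp only [PluckerVec.IsIsotropic, plucker, Matrix.det_fin_two]
  linear_combination (M 0 1 * N 1 1 - M 1 1 * N 0 1) * h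

/-- If two planes have equal Plücker coordinates, normalised by `φ = ∑ cₖₗ pₖₗ = 1`, then contracting
`x' ∧ x ∧ y = 0` with `φ` expresses a vector `x'` of the second plane through `x` and `y`. -/
theorem eq_combination_of_wedge_eq {x y x' y' : Fin 4 → R} (c₀ c₁ c₂ c₃ c₄ : R)
    (h : ∀ k l, x k * y l - x l * y k = x' k * y' l - x' l * y' k)
    (hc : c₀ * (x 0 * y 1 - x 1 * y 0) + c₁ * (x 0 * y 3 - x 3 * y 0)
      + c₂ * (x 1 * y 3 - x 3 * y 1) + c₃ * (x 2 * y 1 - x 1 * y 2)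
      + c₄ * (x 2 * y 3 - x 3 * y 2) = 1) (j : Fin 4) :
    x' j =
      (c₀ * (x' 0 * y 1 - x' 1 * y 0) + c₁ * (x' 0 * y 3 - x' 3 * y 0)
        + c₂ * (x' 1 * y 3 - x' 3 * y 1) + c₃ * (x' 2 * y 1 - x' 1 * y 2)
        + c₄ * (x' 2 * y 3 - x' 3 * y 2)) * x j +
      (c₀ * (x 0 * x' 1 - x 1 * x' 0) + c₁ * (x 0 * x' 3 - x 3 * x' 0)
        + c₂ * (x 1 * x' 3 - x 3 * x' 1) + c₃ * (x 2 * x' 1 - x 1 * x' 2)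
        + c₄ * (x 2 * x' 3 - x 3 * x' 2)) * y j := by
  have t : ∀ k l, x' j * (x k * y l - x l * y k) - x' k * (x j * y l - x l * y j)
      + x' l * (x j * y k - x k * y j) = 0 := fun k l => by
    linear_combination x' j * h k l - x' k * h j l + x' l * h j k
  linear_combination (-x' j) * hc + c₀ * t 0 1 + c₁ * t 0 3 + c₂ * t 1 3 + c₃ * t 2 1 + c₄ * t 2 3

theorem wedge_eq_of_plucker_eq {M N M' N' : Matrix (Fin 2) (Fin 2) R}
    (h : M * Nᵀ = N * Mᵀ) (h' : M' * N'ᵀ = N' * M'ᵀ) (he : plucker M N = plucker M' N')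
    (k l : Fin 4) :
    ![M 0 0, M 0 1, N 0 0, N 0 1] k * ![M 1 0, M 1 1, N 1 0, N 1 1] l
      - ![M 0 0, M 0 1, N 0 0, N 0 1] l * ![M 1 0, M 1 1, N 1 0, N 1 1] k =
    ![M' 0 0, M' 0 1, N' 0 0, N' 0 1] k * ![M' 1 0, M' 1 1, N' 1 0, N' 1 1] l
      - ![M' 0 0, M' 0 1, N' 0 0, N' 0 1] l * ![M' 1 0, M' 1 1, N' 1 0, N' 1 1] k := by
  rw [mul_transpose_comm_iff] at h h'
  simp only [plucker, Matrix.det_fin_two, PluckerVec.mk.injEq] at he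
  obtain ⟨h0, h1, h2, h3, h4⟩ := he
  fin_cases k <;> fin_cases l <;> simp
  · linear_combination h0
  · linear_combination h - h' - h2
  · linear_combination h1
  · linear_combination -h0
  · linear_combination -h3
  · linear_combination h2
  · linear_combination h' - h + h2
  · linear_combination h3
  · linear_combination h4
  · linear_combination -h1
  · linear_combination -h2
  · linear_combination -h4

/-- Two symmetric pairs with the same primitive Plücker vector differ by a matrix of
determinant one. -/
theorem exists_mul_eq_of_plucker_eq {M N M' N' : Matrix (Fin 2) (Fin 2) R}
    (h : M * Nᵀ = N * Mᵀ) (h' : M' * N'ᵀ = N' * M'ᵀ) (he : plucker M N = plucker M' N')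
    (hp : (plucker M N).IsPrimitive) :
    ∃ E : Matrix (Fin 2) (Fin 2) R, E.det = 1 ∧ M' = E * M ∧ N' = E * N := by
  obtain ⟨c₀, c₁, c₂, c₃, c₄, hc⟩ := hp
  set x := ![M 0 0, M 0 1, N 0 0, N 0 1] with hx
  set y := ![M 1 0, M 1 1, N 1 0, N 1 1] with hy
  set x' := ![M' 0 0, M' 0 1, N' 0 0, N' 0 1] with hx'
  set y' := ![M' 1 0, M' 1 1, N' 1 0, N' 1 1] with hy'
  have w : ∀ k l, x k * y l - x l * y k = x' k * y' l - x' l * y' k :=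
    wedge_eq_of_plucker_eq h h' he
  have w2 : ∀ k l, x k * y l - x l * y k = y' k * (-x' l) - y' l * (-x' k) := fun k l => by
    rw [w]; ring
  have hc' : c₀ * (x 0 * y 1 - x 1 * y 0) + c₁ * (x 0 * y 3 - x 3 * y 0)
      + c₂ * (x 1 * y 3 - x 3 * y 1) + c₃ * (x 2 * y 1 - x 1 * y 2)
      + c₄ * (x 2 * y 3 - x 3 * y 2) = 1 := by
    simp only [plucker, Matrix.det_fin_two] at hc
    simp only [hx, hy, Matrix.cons_val]
    linear_combination hc
  have e1 := eq_combination_of_wedge_eq c₀ c₁ c₂ c₃ c₄ w hc'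
  have e2 := eq_combination_of_wedge_eq (y' := fun i => -x' i) c₀ c₁ c₂ c₃ c₄ w2 hc'
  generalize (c₀ * (x' 0 * y 1 - x' 1 * y 0) + c₁ * (x' 0 * y 3 - x' 3 * y 0)
        + c₂ * (x' 1 * y 3 - x' 3 * y 1) + c₃ * (x' 2 * y 1 - x' 1 * y 2)
        + c₄ * (x' 2 * y 3 - x' 3 * y 2)) = p at e1
  generalize (c₀ * (x 0 * x' 1 - x 1 * x' 0) + c₁ * (x 0 * x' 3 - x 3 * x' 0)
        + c₂ * (x 1 * x' 3 - x 3 * x' 1) + c₃ * (x 2 * x' 1 - x 1 * x' 2)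
        + c₄ * (x 2 * x' 3 - x 3 * x' 2)) = r at e1
  generalize (c₀ * (y' 0 * y 1 - y' 1 * y 0) + c₁ * (y' 0 * y 3 - y' 3 * y 0)
        + c₂ * (y' 1 * y 3 - y' 3 * y 1) + c₃ * (y' 2 * y 1 - y' 1 * y 2)
        + c₄ * (y' 2 * y 3 - y' 3 * y 2)) = s at e2
  generalize (c₀ * (x 0 * y' 1 - x 1 * y' 0) + c₁ * (x 0 * y' 3 - x 3 * y' 0)
        + c₂ * (x 1 * y' 3 - x 3 * y' 1) + c₃ * (x 2 * y' 1 - x 1 * y' 2)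
        + c₄ * (x 2 * y' 3 - x 3 * y' 2)) = t at e2
  have hM : M' = !![p, r; s, t] * M := by
    ext i j
    fin_cases i <;> fin_cases j <;> simp [Matrix.mul_apply, Fin.sum_univ_two]
    · exact e1 0
    · exact e1 1
    · exact e2 0
    · exact e2 1
  have hN : N' = !![p, r; s, t] * N := by
    ext i j
    fin_cases i <;> fin_cases j <;> simp [Matrix.mul_apply, Fin.sum_univ_two]
    · exact e1 2
    · exact e1 3
    · exact e2 2
    · exact e2 3
  refine ⟨!![p, r; s, t], ?_, hM, hN⟩
  have hd : plucker M N = plucker (!![p, r; s, t] * M) (!![p, r; s, t] * N) := by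
    rw [← hM, ← hN]; exact he
  rw [plucker_mul_left] at hd
  obtain ⟨h0, h1, h2, h3, h4⟩ := PluckerVec.ext_iff.1 hd
  simp only at h0 h1 h2 h3 h4
  linear_combination (1 - (!![p, r; s, t]).det) * hc - c₀ * h0 - c₁ * h1 - c₂ * h2 - c₃ * h3
    - c₄ * h4

/-- A symmetric pair with primitive Plücker vector is the lower half of a symplectic matrix. The
upper half is first chosen as a one-sided inverse, assembled from the adjugates of the minors, and
then corrected by a multiple of the second row of the pair. -/
theorem exists_symplectic_completion {M N : Matrix (Fin 2) (Fin 2) R} (h : M * Nᵀ = N * Mᵀ)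
    (hp : (plucker M N).IsPrimitive) :
    ∃ A B : Matrix (Fin 2) (Fin 2) R, A * Bᵀ = B * Aᵀ ∧ A * Nᵀ - B * Mᵀ = 1 := by
  rw [mul_transpose_comm_iff] at h
  obtain ⟨c₀, c₁, c₂, c₃, c₄, hc⟩ := hp
  simp only [plucker, Matrix.det_fin_two] at hc
  obtain ⟨a00, ha00⟩ : ∃ t, t = c₃ * M 1 1 + c₄ * N 1 1 := ⟨_, rfl⟩
  obtain ⟨a10, ha10⟩ : ∃ t, t = -c₃ * M 0 1 - c₄ * N 0 1 := ⟨_, rfl⟩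
  obtain ⟨a01, ha01⟩ : ∃ t, t = -c₁ * M 1 0 - c₂ * M 1 1 - c₄ * N 1 0 := ⟨_, rfl⟩
  obtain ⟨a11, ha11⟩ : ∃ t, t = c₁ * M 0 0 + c₂ * M 0 1 + c₄ * N 0 0 := ⟨_, rfl⟩
  obtain ⟨b00, hb00⟩ : ∃ t, t = -(c₀ * M 1 1 + c₁ * N 1 1) := ⟨_, rfl⟩
  obtain ⟨b10, hb10⟩ : ∃ t, t = c₀ * M 0 1 + c₁ * N 0 1 := ⟨_, rfl⟩
  obtain ⟨b01, hb01⟩ : ∃ t, t = c₀ * M 1 0 - c₂ * N 1 1 + c₃ * N 1 0 := ⟨_, rfl⟩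
  obtain ⟨b11, hb11⟩ : ∃ t, t = -c₀ * M 0 0 + c₂ * N 0 1 - c₃ * N 0 0 := ⟨_, rfl⟩
  obtain ⟨k, hk⟩ : ∃ t, t = a00 * b10 + a01 * b11 - b00 * a10 - b01 * a11 := ⟨_, rfl⟩
  have e00 : a00 * N 0 0 + a01 * N 0 1 - b00 * M 0 0 - b01 * M 0 1 = 1 := by
    rw [ha00, ha01, hb00, hb01]; linear_combination hc
  have e01 : a00 * N 1 0 + a01 * N 1 1 - b00 * M 1 0 - b01 * M 1 1 = 0 := by
    rw [ha00, ha01, hb00, hb01]; ring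
  have e10 : a10 * N 0 0 + a11 * N 0 1 - b10 * M 0 0 - b11 * M 0 1 = 0 := by
    rw [ha10, ha11, hb10, hb11]; ring
  have e11 : a10 * N 1 0 + a11 * N 1 1 - b10 * M 1 0 - b11 * M 1 1 = 1 := by
    rw [ha10, ha11, hb10, hb11]; linear_combination hc
  refine ⟨!![a00 + k * M 1 0, a01 + k * M 1 1; a10, a11],
    !![b00 + k * N 1 0, b01 + k * N 1 1; b10, b11], ?_, ?_⟩
  · rw [mul_transpose_comm_iff]
    simp only [of_apply, cons_val', cons_val_zero, cons_val_one, cons_val_fin_one]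
    linear_combination -hk - k * e11
  · ext i j
    fin_cases i <;> fin_cases j <;>
      simp only [Matrix.sub_apply, Matrix.mul_apply, Fin.sum_univ_two, transpose_apply, of_apply,
        cons_val', cons_val_zero, cons_val_one, cons_val_fin_one, Fin.zero_eta, Fin.mk_one,
        Fin.isValue, one_apply_eq, ne_eq, zero_ne_one, one_ne_zero, not_false_eq_true,
        one_apply_ne]
    · linear_combination e00 - k * h
    · linear_combination e01
    · linear_combination e10
    · linear_combination e11

theorem plucker_isPrimitive {A B M N : Matrix (Fin 2) (Fin 2) R} (h : M * Nᵀ = N * Mᵀ)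
    (hAB : A * Nᵀ - B * Mᵀ = 1) : (plucker M N).IsPrimitive := by
  rw [mul_transpose_comm_iff] at h
  have e (i j) := congrFun (congrFun hAB i) j
  have e00 := e 0 0
  have e01 := e 0 1
  have e10 := e 1 0
  have e11 := e 1 1
  simp [Matrix.mul_apply, Fin.sum_univ_two] at e00 e01 e10 e11
  -- Cauchy-Binet for `A Nᵀ - B Mᵀ = 1`
  refine ⟨B 0 0 * B 1 1 - B 0 1 * B 1 0, -(B 0 0 * A 1 1 - A 0 1 * B 1 0),
    (B 0 0 * A 1 0 - A 0 0 * B 1 0) - (B 0 1 * A 1 1 - A 0 1 * B 1 1),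
    -(A 0 0 * B 1 1 - B 0 1 * A 1 0), A 0 0 * A 1 1 - A 0 1 * A 1 0, ?_⟩
  simp only [plucker, Matrix.det_fin_two]
  have hdet : (A 0 0 * N 0 0 + A 0 1 * N 0 1 - (B 0 0 * M 0 0 + B 0 1 * M 0 1)) *
      (A 1 0 * N 1 0 + A 1 1 * N 1 1 - (B 1 0 * M 1 0 + B 1 1 * M 1 1)) -
      (A 0 0 * N 1 0 + A 0 1 * N 1 1 - (B 0 0 * M 1 0 + B 0 1 * M 1 1)) *
      (A 1 0 * N 0 0 + A 1 1 * N 0 1 - (B 1 0 * M 0 0 + B 1 1 * M 0 1)) = 1 := by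
    rw [e00, e01, e10, e11]; ring
  linear_combination hdet + (B 0 0 * A 1 0 - A 0 0 * B 1 0) * h

end Pairs

/-! ### Primitive isotropic vectors over the integers -/

theorem exists_gcd_of_ne_zero {ι : Type*} [Fintype ι] (x : ι → ℤ) (hx : x ≠ 0) :
    ∃ g : ℤ, g ≠ 0 ∧ ∃ x₀ f : ι → ℤ, (∀ i, x i = g * x₀ i) ∧ ∑ i, f i * x₀ i = 1 := by
  obtain ⟨g, hg⟩ := (IsPrincipalIdealRing.principal (Ideal.span (Set.range x))).principal
  have h1 : ∀ i, g ∣ x i := fun i => by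
    rw [← Ideal.mem_span_singleton]
    have : x i ∈ Ideal.span (Set.range x) := Ideal.subset_span ⟨i, rfl⟩
    rw [hg] at this
    exact this
  have hg' : g ∈ Ideal.span (Set.range x) := by
    rw [hg]; exact Submodule.mem_span_singleton_self g
  obtain ⟨f, hf⟩ := Ideal.mem_span_range_iff_exists_fun.1 hg'
  choose x₀ hx₀ using h1
  have hg0 : g ≠ 0 := by
    rintro rfl
    exact hx (funext fun i => by simp [hx₀ i])
  refine ⟨g, hg0, x₀, f, hx₀, ?_⟩
  apply mul_left_cancel₀ hg0
  rw [mul_one, Finset.mul_sum]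
  conv_rhs => rw [← hf]
  refine Finset.sum_congr rfl fun i _ => ?_
  rw [hx₀ i]; ring

theorem PluckerVec.isPrimitive_iff_not_prime_dvd (v : PluckerVec ℤ) :
    v.IsPrimitive ↔ ∀ p : ℕ, p.Prime →
      ¬ ((p : ℤ) ∣ v.m ∧ (p : ℤ) ∣ v.b₁ ∧ (p : ℤ) ∣ v.b₂ ∧ (p : ℤ) ∣ v.b₃ ∧ (p : ℤ) ∣ v.n) := by
  constructor
  · rintro ⟨c₀, c₁, c₂, c₃, c₄, h⟩ p hp ⟨h0, h1, h2, h3, h4⟩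
    have : (p : ℤ) ∣ 1 := by
      rw [← h]
      exact dvd_add (dvd_add (dvd_add (dvd_add (h0.mul_left _) (h1.mul_left _)) (h2.mul_left _))
        (h3.mul_left _)) (h4.mul_left _)
    exact hp.one_lt.ne' (by exact_mod_cast Int.eq_one_of_dvd_one (by positivity) this)
  · intro h
    set x : Fin 5 → ℤ := ![v.m, v.b₁, v.b₂, v.b₃, v.n] with hx
    by_cases h0 : x = 0
    · exfalso
      refine h 2 Nat.prime_two ?_
      have e (i) := congrFun h0 i
      have e0 := e 0
      have e1 := e 1
      have e2 := e 2
      have e3 := e 3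
      have e4 := e 4
      simp [hx] at e0 e1 e2 e3 e4
      simp [e0, e1, e2, e3, e4]
    obtain ⟨g, hg0, x₀, f, hxe, hf⟩ := exists_gcd_of_ne_zero x h0
    have e0 := hxe 0
    have e1 := hxe 1
    have e2 := hxe 2
    have e3 := hxe 3
    have e4 := hxe 4
    simp only [hx, Matrix.cons_val] at e0 e1 e2 e3 e4
    have hg1 : g.natAbs = 1 := by
      by_contra hne
      obtain ⟨p, hp, hpg⟩ := Nat.exists_prime_and_dvd hne
      have hpg' : (p : ℤ) ∣ g := Int.natCast_dvd.2 hpg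
      refine h p hp ⟨?_, ?_, ?_, ?_, ?_⟩
      · rw [e0]; exact hpg'.mul_right _
      · rw [e1]; exact hpg'.mul_right _
      · rw [e2]; exact hpg'.mul_right _
      · rw [e3]; exact hpg'.mul_right _
      · rw [e4]; exact hpg'.mul_right _
    have hgg : g * g = 1 := by
      rcases Int.natAbs_eq g with h | h <;> rw [h, hg1] <;> norm_num
    refine ⟨g * f 0, g * f 1, g * f 2, g * f 3, g * f 4, ?_⟩
    rw [e0, e1, e2, e3, e4]
    rw [Fin.sum_univ_five] at hf
    linear_combination g * g * hf + hgg

/-- Every primitive isotropic integral vector comes from a symmetric pair. A contraction of the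
bivector, divided by its content, is a primitive vector `x` of the plane; contracting with a
functional `f` such that `f x = 1` gives a vector that completes `x`. -/
theorem exists_pair_of_isPrimitive {v : PluckerVec ℤ} (hi : v.IsIsotropic) (hv : v.IsPrimitive) :
    ∃ M N : IntMat, M * Nᵀ = N * Mᵀ ∧ plucker M N = v := by
  obtain ⟨m, b₁, b₂, b₃, n⟩ := v
  simp only [PluckerVec.IsIsotropic] at hi
  set P : Fin 4 → Fin 4 → ℤ := ![![0, m, -b₂, b₁], ![-m, 0, -b₃, b₂], ![b₂, b₃, 0, n],
    ![-b₁, -b₂, -n, 0]] with hP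
  have hwedge : ∀ a i j k, P a i * P j k - P a j * P i k + P a k * P i j = 0 := by
    intro a i j k
    fin_cases a <;> fin_cases i <;> fin_cases j <;> fin_cases k <;> simp [hP] <;>
      first
      | ring1
      | linear_combination hi
      | linear_combination -hi
  obtain ⟨a, ha⟩ : ∃ a, P a ≠ 0 := by
    by_contra! hall
    obtain ⟨c₀, c₁, c₂, c₃, c₄, hc⟩ := hv
    have e0 := congrFun (hall 0) 1
    have e1 := congrFun (hall 0) 3
    have e2 := congrFun (hall 1) 3
    have e3 := congrFun (hall 2) 1
    have e4 := congrFun (hall 2) 3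
    simp [hP] at e0 e1 e2 e3 e4
    simp [e0, e1, e2, e3, e4] at hc
  obtain ⟨g, hg0, x, f, hx, hf⟩ := exists_gcd_of_ne_zero (P a) ha
  have hxw : ∀ i j k, x i * P j k - x j * P i k + x k * P i j = 0 := by
    intro i j k
    apply mul_left_cancel₀ hg0
    have := hwedge a i j k
    rw [hx, hx, hx] at this
    linear_combination this
  set y : Fin 4 → ℤ := fun j => ∑ i, f i * P i j with hy
  have hxy : ∀ j k, x j * y k - x k * y j = P j k := by
    intro j k
    have : x j * y k - x k * y j = ∑ i, f i * (x j * P i k - x k * P i j) := by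
      simp only [hy, Finset.mul_sum, ← Finset.sum_sub_distrib]
      exact Finset.sum_congr rfl fun i _ => by ring
    rw [this]
    calc ∑ i, f i * (x j * P i k - x k * P i j) = ∑ i, (f i * x i) * P j k :=
          Finset.sum_congr rfl fun i _ => by linear_combination (-f i) * hxw i j k
      _ = P j k := by rw [← Finset.sum_mul, hf, one_mul]
  have p01 := hxy 0 1
  have p02 := hxy 0 2
  have p03 := hxy 0 3
  have p13 := hxy 1 3
  have p21 := hxy 2 1
  have p23 := hxy 2 3
  simp [hP] at p01 p02 p03 p13 p21 p23
  refine ⟨!![x 0, x 1; y 0, y 1], !![x 2, x 3; y 2, y 3], ?_, ?_⟩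
  · rw [mul_transpose_comm_iff]
    simp
    linear_combination p02 + p13
  · simp only [plucker, Matrix.det_fin_two, PluckerVec.mk.injEq, of_apply, cons_val', cons_val_zero,
      cons_val_one, cons_val_fin_one]
    refine ⟨?_, ?_, ?_, ?_, ?_⟩
    · linear_combination p01
    · linear_combination p03
    · linear_combination p13
    · linear_combination p21
    · linear_combination p23

/-! ### Symplectic block matrices and the orbits of `Γ₀(L)` -/

theorem fromBlocks_mem_symplecticGroup_iff {R : Type*} [CommRing R]
    {A B C D : Matrix (Fin 2) (Fin 2) R} :
    fromBlocks A B C D ∈ symplecticGroup (Fin 2) R ↔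
      A * Bᵀ = B * Aᵀ ∧ C * Dᵀ = D * Cᵀ ∧ A * Dᵀ - B * Cᵀ = 1 := by
  rw [SymplecticGroup.mem_iff, J, fromBlocks_transpose, fromBlocks_multiply, fromBlocks_multiply,
    fromBlocks_inj]
  simp only [Matrix.mul_zero, Matrix.mul_one, zero_add, add_zero, Matrix.mul_neg, Matrix.neg_mul]
  constructor
  · rintro ⟨h1, h2, h3, h4⟩
    refine ⟨?_, ?_, ?_⟩
    · rw [← sub_eq_zero, ← neg_eq_zero, ← h1]; abel
    · rw [← sub_eq_zero, ← neg_eq_zero, ← h4]; abel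
    · rw [← neg_inj, ← h2]; abel
  · rintro ⟨h1, h2, h3⟩
    refine ⟨by rw [h1]; abel, ?_, ?_, by rw [h2]; abel⟩
    · rw [← h3]; abel
    · have := congrArg transpose h3
      simp only [transpose_sub, transpose_mul, transpose_transpose, transpose_one] at this
      rw [← this]; abel

theorem toBlocks_of_mem_symplecticGroup {R : Type*} [CommRing R]
    {g : Matrix (Fin 2 ⊕ Fin 2) (Fin 2 ⊕ Fin 2) R} (hg : g ∈ symplecticGroup (Fin 2) R) :
    g.toBlocks₁₁ * g.toBlocks₁₂ᵀ = g.toBlocks₁₂ * g.toBlocks₁₁ᵀ ∧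
      g.toBlocks₂₁ * g.toBlocks₂₂ᵀ = g.toBlocks₂₂ * g.toBlocks₂₁ᵀ ∧
      g.toBlocks₁₁ * g.toBlocks₂₂ᵀ - g.toBlocks₁₂ * g.toBlocks₂₁ᵀ = 1 := by
  rw [← fromBlocks_mem_symplecticGroup_iff, fromBlocks_toBlocks]
  exact hg

/-- Reduction `SL₂(ℤ) → SL₂(ℤ/L)` is surjective. -/
theorem exists_specialLinearGroup_map_eq {L : ℕ} (hL : 0 < L)
    (E : Matrix (Fin 2) (Fin 2) (ZMod L)) (hE : E.det = 1) :
    ∃ F : SL(2, ℤ), (F : IntMat).map (Int.cast : ℤ → ZMod L) = E := by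
  obtain ⟨a, ha⟩ := ZMod.intCast_surjective (E 0 0)
  obtain ⟨b, hb⟩ := ZMod.intCast_surjective (E 0 1)
  obtain ⟨c, hc⟩ := ZMod.intCast_surjective (E 1 0)
  obtain ⟨d, hd, hd0⟩ : ∃ d : ℤ, (d : ZMod L) = E 1 1 ∧ d ≠ 0 := by
    obtain ⟨d, hd⟩ := ZMod.intCast_surjective (E 1 1)
    by_cases h : d = 0
    · refine ⟨L, ?_, by exact_mod_cast hL.ne'⟩
      rw [← hd, h]; simp
    · exact ⟨d, hd, h⟩
  have hdet : (L : ℤ) ∣ a * d - b * c - 1 := by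
    rw [← ZMod.intCast_zmod_eq_zero_iff_dvd]
    rw [Matrix.det_fin_two, ← ha, ← hb, ← hc, ← hd] at hE
    push_cast
    rw [hE, sub_self]
  -- move `c` within its class modulo `L` so that it becomes prime to `d`
  obtain ⟨c', hc', hcd⟩ : ∃ c' : ℤ, (L : ℤ) ∣ c' - c ∧ IsCoprime c' d := by
    set g := Int.gcd c L with hg
    have hg0 : 0 < g := Int.gcd_pos_of_ne_zero_right _ (by exact_mod_cast hL.ne')
    obtain ⟨c0, hc0⟩ : (g : ℤ) ∣ c := Int.gcd_dvd_left ..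
    obtain ⟨L0, hL0⟩ : g ∣ L := by
      have : (g : ℤ) ∣ L := Int.gcd_dvd_right ..
      exact_mod_cast this
    have hL0pos : 0 < L0 := Nat.pos_of_ne_zero fun h => by simp [h] at hL0; omega
    have hcop : IsCoprime c0 (L0 : ℤ) := by
      rw [Int.isCoprime_iff_gcd_eq_one]
      have hL0' : (L : ℤ) = g * L0 := by exact_mod_cast hL0
      have : g = Int.gcd (g * c0) (g * L0) := by rw [← hc0, ← hL0']
      rw [Int.gcd_mul_left] at this
      have h2 : g * 1 = g * Int.gcd c0 L0 := by simpa using this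
      exact (Nat.eq_of_mul_eq_mul_left hg0 h2).symm
    have hNZ : NeZero (L0 * d.natAbs) := ⟨by positivity⟩
    obtain ⟨u, hu⟩ := ZMod.unitsMap_surjective (Dvd.intro d.natAbs rfl : L0 ∣ L0 * d.natAbs)
      (ZMod.unitOfIsCoprime c0 hcop)
    obtain ⟨w, hw⟩ := ZMod.intCast_surjective (u : ZMod (L0 * d.natAbs))
    have hwc : IsCoprime w ((L0 * d.natAbs : ℕ) : ℤ) := by
      refine ((ZMod.coe_int_isUnit_iff_isCoprime _ _).1 ?_).symm
      rw [hw]; exact u.isUnit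
    have hw0 : (L0 : ℤ) ∣ w - c0 := by
      rw [← ZMod.intCast_zmod_eq_zero_iff_dvd]
      have := congrArg Units.val hu
      rw [ZMod.unitsMap_val, ← hw, ZMod.cast_intCast (Dvd.intro _ rfl)] at this
      push_cast
      rw [this]; simp
    refine ⟨g * w, ?_, ?_⟩
    · rw [hc0, hL0, ← mul_sub]; push_cast
      exact mul_dvd_mul_left _ hw0
    · apply IsCoprime.mul_left
      · obtain ⟨t, ht⟩ := hdet
        refine ⟨-(b * c0 + L0 * t), a, ?_⟩
        rw [hL0] at ht
        push_cast at ht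
        rw [hc0] at ht
        linear_combination ht
      · have : IsCoprime w (d.natAbs : ℤ) := by
          push_cast at hwc ⊢
          exact hwc.of_mul_right_right
        exact IsCoprime.of_isCoprime_of_dvd_right this (by simp)
  obtain ⟨y, x, hxy⟩ := hcd
  obtain ⟨k, hk⟩ : (L : ℤ) ∣ a * d - b * c' - 1 := by
    have : a * d - b * c' - 1 = (a * d - b * c - 1) - b * (c' - c) := by ring
    rw [this]; exact dvd_sub hdet (hc'.mul_left _)
  refine ⟨⟨!![a - L * k * x, b + L * k * y; c', d], ?_⟩, ?_⟩
  · rw [Matrix.det_fin_two_of]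
    linear_combination hk - L * k * hxy
  · have hcc : (c' : ZMod L) = c := by
      have := (ZMod.intCast_zmod_eq_zero_iff_dvd (c' - c) L).2 hc'
      push_cast at this
      exact sub_eq_zero.1 this
    ext i j
    fin_cases i <;> fin_cases j <;> simp [ha, hb, hd, hcc, hc]

/-- A vector is attained modulo a ring `R` by the pairs `(s A, s B + D)` with `(A B; 0 D)`
symplectic: the local form of the `Γ₀`-orbit of `(s I)`. -/
def IsLocalOrbit {R : Type*} [CommRing R] (s : Matrix (Fin 2) (Fin 2) R) (v : PluckerVec R) :
    Prop :=
  ∃ A B D : Matrix (Fin 2) (Fin 2) R, A * Dᵀ = 1 ∧ A * Bᵀ = B * Aᵀ ∧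
    plucker (s * A) (s * B + D) = v

theorem IsLocalOrbit.symm_pair {R : Type*} [CommRing R] {s A B D : Matrix (Fin 2) (Fin 2) R}
    (hs : sᵀ = s) (h1 : A * Dᵀ = 1) (h2 : A * Bᵀ = B * Aᵀ) :
    (s * A) * (s * B + D)ᵀ = (s * B + D) * (s * A)ᵀ := by
  have h3 : D * Aᵀ = 1 := by
    have := congrArg transpose h1
    simpa [transpose_mul] using this
  simp only [transpose_add, transpose_mul, hs, Matrix.mul_add, Matrix.add_mul]
  rw [show s * A * (Bᵀ * s) = s * (A * Bᵀ) * s by simp only [Matrix.mul_assoc], h2,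
    Matrix.mul_assoc s A, h1, ← Matrix.mul_assoc D, h3]
  simp only [Matrix.mul_assoc, Matrix.mul_one, Matrix.one_mul]

theorem map_intCast_mul {R : Type*} [CommRing R] (X Y : IntMat) :
    (X * Y).map (Int.cast : ℤ → R) = X.map Int.cast * Y.map Int.cast :=
  Matrix.map_mul (f := Int.castRingHom R)

theorem map_intCast_add {R : Type*} [CommRing R] (X Y : IntMat) :
    (X + Y).map (Int.cast : ℤ → R) = X.map Int.cast + Y.map Int.cast :=
  Matrix.map_add _ (by simp) _ _

/-- Two symplectic completions of a pair differ by a symmetric unipotent matrix. -/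
theorem eq_add_mul_of_completions {R : Type*} [CommRing R] {A B a b M N : Matrix (Fin 2) (Fin 2) R}
    (hAB : A * Bᵀ = B * Aᵀ) (h : A * Nᵀ - B * Mᵀ = 1)
    (r1 : aᵀ * M = Mᵀ * a) (r2 : bᵀ * N = Nᵀ * b) (r3 : aᵀ * N - Mᵀ * b = 1) :
    A = a + (B * aᵀ - A * bᵀ) * M ∧ B = b + (B * aᵀ - A * bᵀ) * N ∧
      (B * aᵀ - A * bᵀ)ᵀ = B * aᵀ - A * bᵀ := by
  have r4 : Nᵀ * a - bᵀ * M = 1 := by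
    have := congrArg transpose r3
    simpa only [transpose_sub, transpose_mul, transpose_transpose, transpose_one] using this
  have h' : N * Aᵀ - M * Bᵀ = 1 := by
    have := congrArg transpose h
    simpa only [transpose_sub, transpose_mul, transpose_transpose, transpose_one] using this
  have eM : (B * aᵀ - A * bᵀ) * M = A - a := by
    have e : (B * aᵀ - A * bᵀ) * M = B * (aᵀ * M) - A * (bᵀ * M) := by
      simp only [Matrix.sub_mul, Matrix.mul_assoc]
    rw [e, r1, show bᵀ * M = Nᵀ * a - 1 by rw [← r4]; abel, Matrix.mul_sub, Matrix.mul_one,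
      ← Matrix.mul_assoc, ← Matrix.mul_assoc]
    calc B * Mᵀ * a - (A * Nᵀ * a - A) = A - (A * Nᵀ - B * Mᵀ) * a := by
          rw [Matrix.sub_mul]; abel
      _ = A - a := by rw [h, Matrix.one_mul]
  have eN : (B * aᵀ - A * bᵀ) * N = B - b := by
    have e : (B * aᵀ - A * bᵀ) * N = B * (aᵀ * N) - A * (bᵀ * N) := by
      simp only [Matrix.sub_mul, Matrix.mul_assoc]
    rw [e, r2, show aᵀ * N = 1 + Mᵀ * b by rw [← r3]; abel, Matrix.mul_add, Matrix.mul_one,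
      ← Matrix.mul_assoc, ← Matrix.mul_assoc]
    calc B + B * Mᵀ * b - A * Nᵀ * b = B - (A * Nᵀ - B * Mᵀ) * b := by
          rw [Matrix.sub_mul]; abel
      _ = B - b := by rw [h, Matrix.one_mul]
  refine ⟨by rw [eM]; abel, by rw [eN]; abel, ?_⟩
  have ea : a = A - (B * aᵀ - A * bᵀ) * M := by rw [eM]; abel
  have eb : b = B - (B * aᵀ - A * bᵀ) * N := by rw [eN]; abel
  rw [transpose_sub, transpose_mul, transpose_mul, transpose_transpose, transpose_transpose]
  generalize B * aᵀ - A * bᵀ = T at ea eb ⊢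
  calc a * Bᵀ - b * Aᵀ = (A * Bᵀ - B * Aᵀ) + T * (N * Aᵀ - M * Bᵀ) := by
        rw [ea, eb]; simp only [Matrix.sub_mul, Matrix.mul_sub, Matrix.mul_assoc]; abel
    _ = T := by rw [hAB, h', Matrix.mul_one, sub_self, zero_add]

/-- Strong approximation for the orbits: an integral primitive isotropic vector that lies in the
orbit of `(M₀ I)` modulo `L` is the Plücker vector of a pair in the `Γ₀(L)`-orbit. Lift the
`SL₂`-matrix that matches the pairs modulo `L`, complete the pair to a symplectic matrix `δ`, and
correct the upper half of `δ` by a unipotent matrix. -/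
theorem exists_mem_orbit_of_isLocalOrbit {L : ℕ} (hL : 0 < L) {M₀ : IntMat} (hM₀ : M₀ᵀ = M₀)
    {v : PluckerVec ℤ} (hi : v.IsIsotropic) (hp : v.IsPrimitive)
    (hloc : IsLocalOrbit (M₀.map (Int.cast : ℤ → ZMod L)) (v.map (Int.castRingHom (ZMod L)))) :
    ∃ P ∈ orbit L M₀, plucker P.1 P.2 = v := by
  obtain ⟨M, N, hMN, hv⟩ := exists_pair_of_isPrimitive hi hp
  obtain ⟨A, B, D, hAD, hAB, hpl⟩ := hloc
  set s := M₀.map (Int.cast : ℤ → ZMod L) with hs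
  have hst : sᵀ = s := by rw [hs, ← Matrix.transpose_map, hM₀]
  have hsym2 := IsLocalOrbit.symm_pair hst hAD hAB
  have hsym1 : M.map (Int.cast : ℤ → ZMod L) * (N.map (Int.cast : ℤ → ZMod L))ᵀ =
      N.map (Int.cast : ℤ → ZMod L) * (M.map (Int.cast : ℤ → ZMod L))ᵀ := by
    rw [← Matrix.transpose_map, ← map_intCast_mul, hMN, map_intCast_mul, Matrix.transpose_map]
  have hpl1 : plucker (M.map (Int.cast : ℤ → ZMod L)) (N.map (Int.cast : ℤ → ZMod L)) =
      v.map (Int.castRingHom (ZMod L)) := by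
    rw [← hv]; exact plucker_map (Int.castRingHom (ZMod L)) M N
  obtain ⟨E, hE, hEM, hEN⟩ := exists_mul_eq_of_plucker_eq hsym1 hsym2 (hpl1.trans hpl.symm)
    (by rw [hpl1]; exact hp.map _)
  obtain ⟨F, hF⟩ := exists_specialLinearGroup_map_eq hL E hE
  obtain ⟨M₁, hM₁⟩ : ∃ X : IntMat, X = (F : IntMat) * M := ⟨_, rfl⟩
  obtain ⟨N₁, hN₁⟩ : ∃ X : IntMat, X = (F : IntMat) * N := ⟨_, rfl⟩
  have hM1 : M₁.map (Int.cast : ℤ → ZMod L) = s * A := by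
    rw [hM₁, map_intCast_mul, hF, hEM]
  have hN1 : N₁.map (Int.cast : ℤ → ZMod L) = s * B + D := by
    rw [hN₁, map_intCast_mul, hF, hEN]
  have hsym : M₁ * N₁ᵀ = N₁ * M₁ᵀ := by
    rw [hM₁, hN₁, transpose_mul, transpose_mul, Matrix.mul_assoc, ← Matrix.mul_assoc M, hMN]
    simp only [Matrix.mul_assoc]
  have hv1 : plucker M₁ N₁ = v := by
    rw [hM₁, hN₁, plucker_mul_left_of_det F.2, hv]
  obtain ⟨a, b, hab, h1⟩ := exists_symplectic_completion hsym (by rw [hv1]; exact hp)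
  have hδ : fromBlocks a b M₁ N₁ ∈ symplecticGroup (Fin 2) ℤ :=
    fromBlocks_mem_symplecticGroup_iff.2 ⟨hab, hsym, h1⟩
  -- the relations `δᵀ J δ = J`
  have hδ' : fromBlocks aᵀ M₁ᵀ bᵀ N₁ᵀ ∈ symplecticGroup (Fin 2) ℤ := by
    have := SymplecticGroup.transpose_mem hδ
    rwa [fromBlocks_transpose] at this
  rw [fromBlocks_mem_symplecticGroup_iff] at hδ'
  simp only [transpose_transpose] at hδ'
  obtain ⟨r1, r2, r3⟩ := hδ'
  have cast_eq : ∀ X Y Z W : IntMat, X * Y - Z * W = 1 →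
      X.map (Int.cast : ℤ → ZMod L) * Y.map (Int.cast : ℤ → ZMod L) -
        Z.map (Int.cast : ℤ → ZMod L) * W.map (Int.cast : ℤ → ZMod L) = 1 := by
    intro X Y Z W h
    have h' := congrArg (fun X : IntMat => X.map (Int.castRingHom (ZMod L))) h
    simp only [Matrix.map_sub _ (map_sub (Int.castRingHom (ZMod L)))] at h'
    rw [Matrix.map_one _ (map_zero _) (map_one _)] at h'
    rw [← map_intCast_mul, ← map_intCast_mul]
    exact h'
  have cast_comm : ∀ X Y Z W : IntMat, X * Y = Z * W →
      X.map (Int.cast : ℤ → ZMod L) * Y.map (Int.cast : ℤ → ZMod L) =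
        Z.map (Int.cast : ℤ → ZMod L) * W.map (Int.cast : ℤ → ZMod L) := by
    intro X Y Z W h
    rw [← map_intCast_mul, h, map_intCast_mul]
  have hsA : A * (s * B + D)ᵀ - B * (s * A)ᵀ = 1 := by
    simp only [transpose_add, transpose_mul, hst, Matrix.mul_add, ← Matrix.mul_assoc]
    rw [hAB, hAD]; abel
  have q1 := cast_comm _ _ _ _ r1
  have q2 := cast_comm _ _ _ _ r2
  have q3 := cast_eq _ _ _ _ r3
  simp only [Matrix.transpose_map, hM1, hN1] at q1 q2 q3
  obtain ⟨eA, eB, eT⟩ := eq_add_mul_of_completions hAB hsA q1 q2 q3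
  set T' := B * (a.map (Int.cast : ℤ → ZMod L))ᵀ - A * (b.map (Int.cast : ℤ → ZMod L))ᵀ with hT'
  -- a symmetric integral lift of the unipotent part
  obtain ⟨T, hTsym, hT⟩ : ∃ T : IntMat, Tᵀ = T ∧ T.map (Int.cast : ℤ → ZMod L) = T' := by
    obtain ⟨t1, ht1⟩ := ZMod.intCast_surjective (T' 0 0)
    obtain ⟨t2, ht2⟩ := ZMod.intCast_surjective (T' 0 1)
    obtain ⟨t3, ht3⟩ := ZMod.intCast_surjective (T' 1 1)
    have h10 : T' 1 0 = T' 0 1 := congrFun (congrFun eT 0) 1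
    refine ⟨!![t1, t2; t2, t3], ?_, ?_⟩
    · ext i j; fin_cases i <;> fin_cases j <;> rfl
    · ext i j; fin_cases i <;> fin_cases j <;> simp [ht1, ht2, ht3, h10]
  have hpT : fromBlocks 1 T 0 1 ∈ symplecticGroup (Fin 2) ℤ := by
    rw [fromBlocks_mem_symplecticGroup_iff]; simp [hTsym]
  have hpM : fromBlocks 1 0 (-M₀) 1 ∈ symplecticGroup (Fin 2) ℤ := by
    rw [fromBlocks_mem_symplecticGroup_iff]; simp [hM₀]
  have hγ := mul_mem hpM (mul_mem hpT hδ)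
  rw [fromBlocks_multiply, fromBlocks_multiply] at hγ
  simp only [Matrix.one_mul, Matrix.zero_mul, add_zero, zero_add, Matrix.neg_mul] at hγ
  refine ⟨(M₁, N₁), ⟨⟨_, hγ⟩, ?_, 1, ?_⟩, hv1⟩
  · intro i j
    rw [← ZMod.intCast_zmod_eq_zero_iff_dvd]
    have : (-(M₀ * (a + T * M₁)) + M₁).map (Int.cast : ℤ → ZMod L) = 0 := by
      have e1 : (a + T * M₁).map (Int.cast : ℤ → ZMod L) = A := by
        rw [map_intCast_add, map_intCast_mul, hT, hM1]; exact eA.symm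
      rw [neg_add_eq_sub, Matrix.map_sub _ (by simp), map_intCast_mul, e1, hM1, sub_self]
    exact congrFun (congrFun this i) j
  · simp [leftMul, pairMul]

/-! ### Eisenstein series as sums over Plücker vectors -/

/-- The linear form `v ↦ m det τ + b₁ τ₁₁ + 2 b₂ τ₁₂ + b₃ τ₂₂ + n`, whose value at the Plücker vector
of `(M N)` is `det (M τ + N)`. -/
def ell (τ : Matrix (Fin 2) (Fin 2) ℂ) (v : PluckerVec ℤ) : ℂ :=
  v.m * τ.det + v.b₁ * τ 0 0 + 2 * v.b₂ * τ 0 1 + v.b₃ * τ 1 1 + v.n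

theorem det_eq_ell {τ : Matrix (Fin 2) (Fin 2) ℂ} (hτ : τᵀ = τ) {M N : IntMat}
    (h : M * Nᵀ = N * Mᵀ) :
    (M.map (Int.cast : ℤ → ℂ) * τ + N.map (Int.cast : ℤ → ℂ)).det = ell τ (plucker M N) := by
  have h10 : τ 1 0 = τ 0 1 := congrFun (congrFun hτ 0) 1
  rw [mul_transpose_comm_iff] at h
  have h' : (M 0 0 : ℂ) * N 1 0 + M 0 1 * N 1 1 = M 1 0 * N 0 0 + M 1 1 * N 0 1 := by
    exact_mod_cast h
  simp only [ell, plucker, Matrix.det_fin_two, Matrix.add_apply, Matrix.mul_apply,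
    Fin.sum_univ_two, Matrix.map_apply, h10]
  push_cast
  linear_combination (-τ 0 1) * h'

theorem pairMul_symm_and_isPrimitive {M₀ : IntMat} (hM₀ : M₀ᵀ = M₀)
    (γ : symplecticGroup (Fin 2) ℤ) :
    (pairMul (M₀, 1) γ).1 * (pairMul (M₀, 1) γ).2ᵀ = (pairMul (M₀, 1) γ).2 * (pairMul (M₀, 1) γ).1ᵀ ∧
    (plucker (pairMul (M₀, 1) γ).1 (pairMul (M₀, 1) γ).2).IsPrimitive := by
  have hpM : fromBlocks 1 0 M₀ 1 ∈ symplecticGroup (Fin 2) ℤ := by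
    rw [fromBlocks_mem_symplecticGroup_iff]; simp [hM₀]
  have h := mul_mem hpM γ.2
  rw [← fromBlocks_toBlocks (γ : Matrix (Fin 2 ⊕ Fin 2) (Fin 2 ⊕ Fin 2) ℤ), fromBlocks_multiply,
    fromBlocks_mem_symplecticGroup_iff] at h
  exact ⟨h.2.1, plucker_isPrimitive h.2.1 h.2.2⟩

theorem symm_and_isPrimitive_of_mem_orbit {L : ℕ} {M₀ : IntMat} (hM₀ : M₀ᵀ = M₀)
    {P : IntMat × IntMat} (hP : P ∈ orbit L M₀) :
    P.1 * P.2ᵀ = P.2 * P.1ᵀ ∧ (plucker P.1 P.2).IsPrimitive := by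
  obtain ⟨γ, -, E, rfl⟩ := hP
  obtain ⟨h1, h2⟩ := pairMul_symm_and_isPrimitive hM₀ γ
  constructor
  · simp only [leftMul, transpose_mul]
    rw [Matrix.mul_assoc, ← Matrix.mul_assoc _ _ ((E : IntMat)ᵀ), h1]
    simp only [Matrix.mul_assoc]
  · rw [leftMul, plucker_mul_left_of_det E.2]; exact h2

/-- The Plücker vector of a class of pairs. -/
def classVec {L : ℕ} {M₀ : IntMat} (c : OrbitClasses L M₀) : PluckerVec ℤ :=
  plucker (c.out : IntMat × IntMat).1 (c.out : IntMat × IntMat).2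

theorem classVec_mk {L : ℕ} {M₀ : IntMat} (P : orbit L M₀) :
    classVec (Quotient.mk (orbitSetoid L M₀) P) =
      plucker (P : IntMat × IntMat).1 (P : IntMat × IntMat).2 := by
  obtain ⟨E, hE⟩ : (orbitSetoid L M₀).r (Quotient.mk (orbitSetoid L M₀) P).out P :=
    Quotient.mk_out (s := orbitSetoid L M₀) P
  rw [hE, leftMul, plucker_mul_left_of_det E.2]; rfl

theorem classVec_injective {L : ℕ} {M₀ : IntMat} (hM₀ : M₀ᵀ = M₀) :
    Function.Injective (classVec : OrbitClasses L M₀ → PluckerVec ℤ) := by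
  intro c d h
  obtain ⟨h1, h2⟩ := symm_and_isPrimitive_of_mem_orbit hM₀ c.out.2
  obtain ⟨h3, -⟩ := symm_and_isPrimitive_of_mem_orbit hM₀ d.out.2
  obtain ⟨E, hE, hM, hN⟩ := exists_mul_eq_of_plucker_eq h1 h3 h h2
  rw [← Quotient.out_eq c, ← Quotient.out_eq d]
  exact Quotient.sound (s := orbitSetoid L M₀) ⟨⟨E, hE⟩, Prod.ext hM hN⟩

/-- `C` is the coefficient function of the Eisenstein series attached to `M₀`: it takes the value
`χ̄(det D_γ)` at the Plücker vector of `(M₀ I) γ`, and vanishes off the orbit. -/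
structure IsCoefficient {𝒩 : ℕ} (χ : DirichletCharacter ℂ 𝒩) (L : ℕ) (M₀ : IntMat)
    (C : PluckerVec ℤ → ℂ) : Prop where
  apply_pairMul : ∀ γ ∈ Gamma0 L, C (plucker (pairMul (M₀, 1) γ).1 (pairMul (M₀, 1) γ).2) =
    conj (χ (((γ : Matrix (Fin 2 ⊕ Fin 2) (Fin 2 ⊕ Fin 2) ℤ).toBlocks₂₂.det : ℤ) : ZMod 𝒩))
  isIsotropic : ∀ v, C v ≠ 0 → v.IsIsotropic
  isPrimitive : ∀ v, C v ≠ 0 → v.IsPrimitive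
  isLocalOrbit : ∀ v, C v ≠ 0 →
    IsLocalOrbit (M₀.map (Int.cast : ℤ → ZMod L)) (v.map (Int.castRingHom (ZMod L)))

namespace IsCoefficient

variable {𝒩 : ℕ} {χ : DirichletCharacter ℂ 𝒩} {L : ℕ} {M₀ : IntMat} {C : PluckerVec ℤ → ℂ}

theorem eisensteinTerm_eq (hC : IsCoefficient χ L M₀ C) (hM₀ : M₀ᵀ = M₀) (k : ℕ)
    {τ : Matrix (Fin 2) (Fin 2) ℂ} (hτ : τᵀ = τ) (c : OrbitClasses L M₀) :
    eisensteinTerm k χ L M₀ τ c = C (classVec c) * ell τ (classVec c) ^ (-(k : ℤ)) := by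
  obtain ⟨h1, -⟩ := symm_and_isPrimitive_of_mem_orbit hM₀ c.out.2
  have hspec := c.out.2.choose_spec
  obtain ⟨E, hE⟩ := hspec.2
  rw [eisensteinTerm, det_eq_ell hτ h1, classVec]
  congr 1
  rw [orbitCharacter]
  have h2 : plucker (c.out : IntMat × IntMat).1 (c.out : IntMat × IntMat).2 =
      plucker (pairMul (M₀, 1) c.out.2.choose).1 (pairMul (M₀, 1) c.out.2.choose).2 := by
    conv_lhs => rw [hE]
    exact plucker_mul_left_of_det E.2 _ _
  rw [h2, hC.apply_pairMul _ hspec.1]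

theorem support_subset (hC : IsCoefficient χ L M₀ C) (hM₀ : M₀ᵀ = M₀) (hL : 0 < L) (k : ℕ)
    (τ : Matrix (Fin 2) (Fin 2) ℂ) :
    Function.support (fun v => C v * ell τ v ^ (-(k : ℤ))) ⊆
      Set.range (classVec : OrbitClasses L M₀ → PluckerVec ℤ) := by
  intro v hv
  have hv' : C v ≠ 0 := left_ne_zero_of_mul hv
  obtain ⟨P, hP, h⟩ := exists_mem_orbit_of_isLocalOrbit hL hM₀ (hC.isIsotropic v hv')
    (hC.isPrimitive v hv') (hC.isLocalOrbit v hv')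
  exact ⟨Quotient.mk (orbitSetoid L M₀) ⟨P, hP⟩, by rw [classVec_mk, h]⟩

theorem summable_eisensteinTerm (hC : IsCoefficient χ L M₀ C) (hM₀ : M₀ᵀ = M₀) {k : ℕ}
    {τ : Matrix (Fin 2) (Fin 2) ℂ} (hτ : τᵀ = τ)
    (hs : Summable fun v => C v * ell τ v ^ (-(k : ℤ))) :
    Summable (eisensteinTerm k χ L M₀ τ) := by
  have := hs.comp_injective (classVec_injective (L := L) hM₀)
  exact this.congr fun c => (hC.eisensteinTerm_eq hM₀ k hτ c).symm

theorem eisenstein_eq_tsum (hC : IsCoefficient χ L M₀ C) (hM₀ : M₀ᵀ = M₀) (hL : 0 < L) (k : ℕ)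
    {τ : Matrix (Fin 2) (Fin 2) ℂ} (hτ : τᵀ = τ) :
    eisenstein k χ L M₀ τ = (1 / 2) * ∑' v, C v * ell τ v ^ (-(k : ℤ)) := by
  rw [eisenstein, ← (classVec_injective (L := L) hM₀).tsum_eq (hC.support_subset hM₀ hL k τ)]
  congr 1
  exact tsum_congr fun c => hC.eisensteinTerm_eq hM₀ k hτ c

end IsCoefficient

/-! ### A divisor bound -/

theorem succ_pow_three_le (e : ℕ) : (e + 1) ^ 3 ≤ 8 * 2 ^ e := by
  induction e with
  | zero => norm_num
  | succ e ih =>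
    rcases lt_or_ge e 3 with h | h
    · interval_cases e <;> norm_num
    · have h1 : (e + 1 + 1) ^ 3 ≤ 2 * (e + 1) ^ 3 := by nlinarith [Nat.mul_le_mul h h]
      calc (e + 1 + 1) ^ 3 ≤ 2 * (e + 1) ^ 3 := h1
        _ ≤ 2 * (8 * 2 ^ e) := Nat.mul_le_mul_left _ ih
        _ = 8 * 2 ^ (e + 1) := by ring

/-- The divisor function is `O(n ^ (1/3))`: each prime power contributes `(e + 1) ^ 3 ≤ p ^ e`, with
finitely many exceptional primes `p < 8`, where a factor `8` is lost. -/
theorem card_divisors_pow_three_le (n : ℕ) (hn : n ≠ 0) :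
    (Nat.divisors n).card ^ 3 ≤ 8 ^ 8 * n := by
  rw [Nat.card_divisors hn, ← Finset.prod_pow]
  have h1 : ∏ p ∈ n.primeFactors, (n.factorization p + 1) ^ 3 ≤
      ∏ p ∈ n.primeFactors, (if p < 8 then 8 else 1) * p ^ n.factorization p := by
    refine Finset.prod_le_prod' fun p hp => ?_
    have hp2 := (Nat.prime_of_mem_primeFactors hp).two_le
    split_ifs with h
    · exact (succ_pow_three_le _).trans (Nat.mul_le_mul_left _ (Nat.pow_le_pow_left hp2 _))
    · rw [one_mul]
      calc (n.factorization p + 1) ^ 3 ≤ (2 ^ n.factorization p) ^ 3 :=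
            Nat.pow_le_pow_left Nat.lt_two_pow_self _
        _ = 8 ^ n.factorization p := by rw [← pow_mul, mul_comm, pow_mul]; norm_num
        _ ≤ p ^ n.factorization p := Nat.pow_le_pow_left (not_lt.1 h) _
  refine h1.trans ?_
  rw [Finset.prod_mul_distrib]
  refine Nat.mul_le_mul ?_ (le_of_eq ?_)
  · rw [Finset.prod_ite, Finset.prod_const, Finset.prod_const_one, mul_one]
    refine Nat.pow_le_pow_right (by norm_num) ?_
    calc _ ≤ (Finset.range 8).card := Finset.card_le_card fun p hp => by
            simp only [Finset.mem_filter] at hp; simpa using hp.2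
      _ = 8 := by simp
  · exact Nat.prod_factorization_pow_eq_self hn

theorem exists_finset_of_dvd (D : ℤ) (hD : D ≠ 0) :
    ∃ s : Finset ℤ, (∀ y, y ∣ D → y ∈ s) ∧ ((s.card : ℝ)) ≤ 1024 * |(D : ℝ)| ^ (1 / 3 : ℝ) := by
  have hD' : D.natAbs ≠ 0 := Int.natAbs_ne_zero.2 hD
  refine ⟨(D.natAbs.divisors.image fun d : ℕ => (d : ℤ)) ∪
    D.natAbs.divisors.image fun d : ℕ => (-(d : ℤ)), ?_, ?_⟩
  · intro y hy
    have : y.natAbs ∈ D.natAbs.divisors := Nat.mem_divisors.2 ⟨Int.natAbs_dvd_natAbs.2 hy, hD'⟩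
    simp only [Finset.mem_union, Finset.mem_image]
    rcases Int.natAbs_eq y with h | h
    · exact Or.inl ⟨_, this, h.symm⟩
    · exact Or.inr ⟨_, this, h.symm⟩
  · have h1 : ((D.natAbs.divisors.image fun d : ℕ => (d : ℤ)) ∪
        D.natAbs.divisors.image fun d : ℕ => (-(d : ℤ))).card ≤ 2 * D.natAbs.divisors.card := by
      refine (Finset.card_union_le _ _).trans ?_
      rw [two_mul]
      exact Nat.add_le_add Finset.card_image_le Finset.card_image_le
    have h2 : (D.natAbs.divisors.card : ℝ) ^ 3 ≤ 8 ^ 8 * |(D : ℝ)| := by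
      have := card_divisors_pow_three_le _ hD'
      have h3 : ((D.natAbs : ℕ) : ℝ) = |(D : ℝ)| := by
        rw [Nat.cast_natAbs]; push_cast; rfl
      rw [← h3]
      exact_mod_cast this
    have h3 : (D.natAbs.divisors.card : ℝ) ≤ 512 * |(D : ℝ)| ^ (1 / 3 : ℝ) := by
      refine le_of_pow_le_pow_left₀ (n := 3) (by norm_num) (by positivity) (h2.trans ?_)
      rw [mul_pow, ← Real.rpow_natCast (|(D : ℝ)| ^ (1 / 3 : ℝ)), ← Real.rpow_mul (abs_nonneg _)]
      norm_num
      nlinarith [abs_nonneg (D : ℝ)]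
    calc _ ≤ ((2 * D.natAbs.divisors.card : ℕ) : ℝ) := by exact_mod_cast h1
      _ ≤ _ := by push_cast; linarith

/-! ### Summation over the isotropic cone -/

theorem summable_max_one_abs_rpow {r : ℝ} (hr : r < -1) :
    Summable fun z : ℤ => (max 1 |(z : ℝ)|) ^ r := by
  have h := Real.summable_abs_int_rpow (b := -r) (by linarith)
  refine Summable.of_norm_bounded_eventually (g := fun z : ℤ => |(z : ℝ)| ^ r) (by simpa using h) ?_
  have : ({0} : Set ℤ)ᶜ ∈ Filter.cofinite := (Set.finite_singleton 0).compl_mem_cofinite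
  filter_upwards [this] with z hz
  have hz1 : 1 ≤ |(z : ℝ)| := by
    have : 1 ≤ |z| := Int.one_le_abs hz
    exact_mod_cast this
  rw [max_eq_right hz1, Real.norm_of_nonneg (by positivity)]

theorem summable_norm_rpow_int_prod {r : ℝ} (hr : r < -2) :
    Summable fun x : ℤ × ℤ => ‖x‖ ^ r := by
  have h := summable_max_one_abs_rpow (r := r / 2) (by linarith)
  have h2 := h.mul_of_nonneg h (fun _ => by positivity) (fun _ => by positivity)
  refine Summable.of_norm_bounded_eventually h2 ?_
  have : ({0} : Set (ℤ × ℤ))ᶜ ∈ Filter.cofinite := (Set.finite_singleton 0).compl_mem_cofinite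
  filter_upwards [this] with x hx
  have h1 : ∀ t : ℝ, 1 ≤ ‖x‖ → t ≤ ‖x‖ → ‖x‖ ^ (r / 2) ≤ (max 1 t) ^ (r / 2) := fun t ht1 ht =>
    Real.rpow_le_rpow_of_nonpos (by positivity) (max_le ht1 ht) (by linarith)
  have hx1 : 1 ≤ ‖x‖ := by
    rw [Prod.norm_def]
    by_contra! hlt
    apply hx
    rw [max_lt_iff, Int.norm_eq_abs, Int.norm_eq_abs] at hlt
    have e1 : |x.1| < 1 := by exact_mod_cast hlt.1
    have e2 : |x.2| < 1 := by exact_mod_cast hlt.2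
    exact Prod.ext (Int.abs_lt_one_iff.1 e1) (Int.abs_lt_one_iff.1 e2)
  rw [Real.norm_of_nonneg (by positivity)]
  calc ‖x‖ ^ r = ‖x‖ ^ (r / 2) * ‖x‖ ^ (r / 2) := by
        rw [← Real.rpow_add (by linarith)]; congr 1; ring
    _ ≤ _ := mul_le_mul (h1 _ hx1 (by rw [← Int.norm_eq_abs]; exact norm_fst_le x))
        (h1 _ hx1 (by rw [← Int.norm_eq_abs]; exact norm_snd_le x)) (by positivity) (by positivity)

theorem summable_norm_rpow_int_prod_prod {r : ℝ} (hr : r < -3) :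
    Summable fun x : ℤ × ℤ × ℤ => ‖x‖ ^ r := by
  have h := summable_max_one_abs_rpow (r := r / 3) (by linarith)
  have h2 := h.mul_of_nonneg (h.mul_of_nonneg h (fun _ => by positivity) (fun _ => by positivity))
    (fun _ => by positivity) (fun _ => by positivity)
  refine Summable.of_norm_bounded_eventually h2 ?_
  have : ({0} : Set (ℤ × ℤ × ℤ))ᶜ ∈ Filter.cofinite := (Set.finite_singleton 0).compl_mem_cofinite
  filter_upwards [this] with x hx
  have h1 : ∀ t : ℝ, 1 ≤ ‖x‖ → t ≤ ‖x‖ → ‖x‖ ^ (r / 3) ≤ (max 1 t) ^ (r / 3) := fun t ht1 ht =>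
    Real.rpow_le_rpow_of_nonpos (by positivity) (max_le ht1 ht) (by linarith)
  have hx1 : 1 ≤ ‖x‖ := by
    rw [Prod.norm_def, Prod.norm_def]
    by_contra! hlt
    apply hx
    rw [max_lt_iff, max_lt_iff, Int.norm_eq_abs, Int.norm_eq_abs, Int.norm_eq_abs] at hlt
    have e1 : |x.1| < 1 := by exact_mod_cast hlt.1
    have e2 : |x.2.1| < 1 := by exact_mod_cast hlt.2.1
    have e3 : |x.2.2| < 1 := by exact_mod_cast hlt.2.2
    exact Prod.ext (Int.abs_lt_one_iff.1 e1)
      (Prod.ext (Int.abs_lt_one_iff.1 e2) (Int.abs_lt_one_iff.1 e3))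
  rw [Real.norm_of_nonneg (by positivity)]
  calc ‖x‖ ^ r = ‖x‖ ^ (r / 3) * (‖x‖ ^ (r / 3) * ‖x‖ ^ (r / 3)) := by
        rw [← Real.rpow_add (by linarith), ← Real.rpow_add (by linarith)]; congr 1; ring
    _ ≤ _ := by
      refine mul_le_mul (h1 _ hx1 (by rw [← Int.norm_eq_abs]; exact norm_fst_le x))
        (mul_le_mul (h1 _ hx1 ?_) (h1 _ hx1 ?_) (by positivity) (by positivity)) (by positivity)
        (by positivity)
      · rw [← Int.norm_eq_abs]; exact (norm_fst_le x.2).trans (norm_snd_le x)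
      · rw [← Int.norm_eq_abs]; exact (norm_snd_le x.2).trans (norm_snd_le x)

open Classical in
/-- The pairs `(x, y)` with `y ∣ D x`, where `D` grows at most quadratically, contribute a factor
`O(‖x‖ ^ (2/3))` to a sum over `x`. -/
theorem summable_of_dvd {ι : Type*} [NormedAddCommGroup ι]
    (hι : Summable fun x : ι => ‖x‖ ^ (-(10 / 3) : ℝ)) (D : ι → ℤ)
    (hD : ∀ x, |(D x : ℝ)| ≤ 2 * ‖x‖ ^ 2) :
    Summable fun p : ι × ℤ => if p.1 ≠ 0 ∧ D p.1 ≠ 0 ∧ p.2 ∣ D p.1 then ‖p.1‖ ^ (-4 : ℝ) else 0 := by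
  rw [summable_prod_of_nonneg (fun p => by dsimp only; split_ifs <;> positivity)]
  have key : ∀ x : ι, ∃ s : Finset ℤ, (∀ y, (x ≠ 0 ∧ D x ≠ 0 ∧ y ∣ D x) → y ∈ s) ∧
      (s.card : ℝ) * ‖x‖ ^ (-4 : ℝ) ≤ 2048 * ‖x‖ ^ (-(10 / 3) : ℝ) := by
    intro x
    by_cases h : x ≠ 0 ∧ D x ≠ 0
    · obtain ⟨s, hs, hc⟩ := exists_finset_of_dvd (D x) h.2
      refine ⟨s, fun y hy => hs y hy.2.2, ?_⟩
      have hx : 0 < ‖x‖ := norm_pos_iff.2 h.1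
      have h1 : |(D x : ℝ)| ^ (1 / 3 : ℝ) ≤ 2 * ‖x‖ ^ (2 / 3 : ℝ) := by
        calc |(D x : ℝ)| ^ (1 / 3 : ℝ) ≤ (2 * ‖x‖ ^ 2) ^ (1 / 3 : ℝ) :=
              Real.rpow_le_rpow (abs_nonneg _) (hD x) (by norm_num)
          _ = 2 ^ (1 / 3 : ℝ) * ‖x‖ ^ (2 / 3 : ℝ) := by
              rw [Real.mul_rpow (by norm_num) (by positivity), ← Real.rpow_natCast ‖x‖ 2,
                ← Real.rpow_mul hx.le]; norm_num
          _ ≤ 2 * ‖x‖ ^ (2 / 3 : ℝ) := by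
              refine mul_le_mul_of_nonneg_right ?_ (by positivity)
              exact (Real.rpow_le_rpow_of_exponent_le (by norm_num)
                (by norm_num : (1 / 3 : ℝ) ≤ 1)).trans (by simp)
      calc (s.card : ℝ) * ‖x‖ ^ (-4 : ℝ) ≤ (1024 * (2 * ‖x‖ ^ (2 / 3 : ℝ))) * ‖x‖ ^ (-4 : ℝ) :=
            mul_le_mul_of_nonneg_right (hc.trans (by linarith)) (by positivity)
        _ = 2048 * (‖x‖ ^ (2 / 3 : ℝ) * ‖x‖ ^ (-4 : ℝ)) := by ring
        _ = 2048 * ‖x‖ ^ (-(10 / 3) : ℝ) := by rw [← Real.rpow_add hx]; norm_num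
    · exact ⟨∅, fun y hy => absurd ⟨hy.1, hy.2.1⟩ h, by simp; positivity⟩
  have hsupp : ∀ x : ι, ∀ s : Finset ℤ, (∀ y, (x ≠ 0 ∧ D x ≠ 0 ∧ y ∣ D x) → y ∈ s) →
      ∀ y ∉ s, (if x ≠ 0 ∧ D x ≠ 0 ∧ y ∣ D x then ‖x‖ ^ (-4 : ℝ) else 0) = 0 :=
    fun x s hs y hy => if_neg fun h => hy (hs y h)
  constructor
  · intro x
    obtain ⟨s, hs, -⟩ := key x
    exact summable_of_ne_finset_zero (hsupp x s hs)
  · refine Summable.of_nonneg_of_le (fun x => tsum_nonneg fun y => by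
      dsimp only; split_ifs <;> positivity) (fun x => ?_) (hι.mul_left 2048)
    obtain ⟨s, hs, hc⟩ := key x
    refine le_trans ?_ hc
    rw [tsum_eq_sum (hsupp x s hs)]
    refine (Finset.sum_le_card_nsmul s _ (‖x‖ ^ (-4 : ℝ)) fun y _ => ?_).trans ?_
    · split_ifs
      · exact le_rfl
      · positivity
    · rw [nsmul_eq_mul]

/-- The sup norm of an integral vector. -/
def PluckerVec.size (v : PluckerVec ℤ) : ℝ := ‖(v.m, v.b₁, v.b₂, v.b₃, v.n)‖

open Classical in
theorem summable_size_of_injOn {ι : Type*} [NormedAddCommGroup ι]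
    (hι : Summable fun x : ι => ‖x‖ ^ (-(10 / 3) : ℝ)) (D : ι → ℤ)
    (hD : ∀ x, |(D x : ℝ)| ≤ 2 * ‖x‖ ^ 2) (S : Set (PluckerVec ℤ)) (x : PluckerVec ℤ → ι)
    (y : PluckerVec ℤ → ℤ) (hinj : Set.InjOn (fun v => (x v, y v)) S)
    (h : ∀ v ∈ S, x v ≠ 0 ∧ D (x v) ≠ 0 ∧ y v ∣ D (x v)) (hle : ∀ v ∈ S, ‖x v‖ ≤ v.size) :
    Summable (S.indicator fun v => v.size ^ (-4 : ℝ)) := by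
  rw [← summable_subtype_iff_indicator]
  have hs := (summable_of_dvd hι D hD).comp_injective hinj.injective
  refine Summable.of_nonneg_of_le (fun v => Real.rpow_nonneg (norm_nonneg _) _) (fun v => ?_) hs
  exact (Real.rpow_le_rpow_of_nonpos (norm_pos_iff.2 (h v v.2).1) (hle v v.2)
    (show (-4 : ℝ) ≤ 0 by norm_num)).trans_eq (if_pos (h v v.2)).symm

theorem summable_indicator_union {α : Type*} {f : α → ℝ} (hf : 0 ≤ f) {S T : Set α}
    (hS : Summable (S.indicator f)) (hT : Summable (T.indicator f)) :
    Summable ((S ∪ T).indicator f) := by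
  refine Summable.of_nonneg_of_le (fun a => Set.indicator_nonneg (fun a _ => hf a) a) (fun a => ?_)
    (hS.add hT)
  have h1 := Set.indicator_nonneg (s := S) (fun a _ => hf a) a
  have h2 := Set.indicator_nonneg (s := T) (fun a _ => hf a) a
  by_cases h : a ∈ S ∪ T
  · rw [Set.indicator_of_mem h]
    rcases h with h | h
    · rw [Set.indicator_of_mem h]; linarith
    · rw [Set.indicator_of_mem h]; linarith
  · rw [Set.indicator_of_notMem h]; linarith

theorem abs_quadratic_le {a b : ℤ} {t : ℝ} (ha : ‖a‖ ≤ t) (hb : ‖b‖ ≤ t) :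
    |((a ^ 2 + b ^ 2 : ℤ) : ℝ)| ≤ 2 * t ^ 2 := by
  rw [Int.norm_eq_abs] at ha hb
  push_cast
  rw [abs_of_nonneg (by positivity), ← sq_abs (a : ℝ), ← sq_abs (b : ℝ)]
  nlinarith [abs_nonneg (a : ℝ), abs_nonneg (b : ℝ)]

theorem isotropic_cases {v : PluckerVec ℤ} (hv : v.IsIsotropic) (hv0 : v ≠ ⟨0, 0, 0, 0, 0⟩) :
    (v.IsIsotropic ∧ v.b₁ * v.b₃ - v.b₂ ^ 2 ≠ 0) ∨
    (v.b₁ * v.b₃ = v.b₂ ^ 2 ∧ v.n = 0 ∧ v.b₂ ≠ 0) ∨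
    (v.b₁ * v.b₃ = v.b₂ ^ 2 ∧ v.m = 0 ∧ v.b₂ ≠ 0) ∨
    (v ≠ ⟨0, 0, 0, 0, 0⟩ ∧ v.n = 0 ∧ v.b₂ = 0 ∧ v.b₃ = 0) ∨
    (v ≠ ⟨0, 0, 0, 0, 0⟩ ∧ v.n = 0 ∧ v.b₂ = 0 ∧ v.b₁ = 0) ∨
    (v ≠ ⟨0, 0, 0, 0, 0⟩ ∧ v.m = 0 ∧ v.b₂ = 0 ∧ v.b₃ = 0) ∨
    (v ≠ ⟨0, 0, 0, 0, 0⟩ ∧ v.m = 0 ∧ v.b₂ = 0 ∧ v.b₁ = 0) := by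
  by_cases hΔ : v.b₁ * v.b₃ - v.b₂ ^ 2 = 0
  · have hmn : v.m * v.n = 0 := by rw [hv, hΔ]
    have hb : v.b₁ * v.b₃ = v.b₂ ^ 2 := sub_eq_zero.1 hΔ
    rcases mul_eq_zero.1 hmn with h | h
    · by_cases hb2 : v.b₂ = 0
      · have : v.b₁ * v.b₃ = 0 := by rw [hb, hb2]; ring
        rcases mul_eq_zero.1 this with h' | h' <;> tauto
      · tauto
    · by_cases hb2 : v.b₂ = 0
      · have : v.b₁ * v.b₃ = 0 := by rw [hb, hb2]; ring
        rcases mul_eq_zero.1 this with h' | h' <;> tauto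
      · tauto
  · exact Or.inl ⟨hv, hΔ⟩

/-- The sum of `size ^ (-4)` over the nonzero integral vectors on the cone `m n = b₁ b₃ - b₂ ^ 2`
converges. If `b₁ b₃ ≠ b₂ ^ 2`, then `m` is one of the few divisors of `b₁ b₃ - b₂ ^ 2`; otherwise
`m = 0` or `n = 0`, and `b₁` divides `b₂ ^ 2`. -/
theorem summable_size : Summable
    ({v : PluckerVec ℤ | v.IsIsotropic ∧ v ≠ ⟨0, 0, 0, 0, 0⟩}.indicator
      fun v => v.size ^ (-4 : ℝ)) := by
  have h2 := summable_norm_rpow_int_prod (r := -(10 / 3)) (by norm_num)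
  have h3 := summable_norm_rpow_int_prod_prod (r := -(10 / 3)) (by norm_num)
  have hsize : ∀ v : PluckerVec ℤ, ‖v.m‖ ≤ v.size ∧ ‖v.b₁‖ ≤ v.size ∧ ‖v.b₂‖ ≤ v.size ∧
      ‖v.b₃‖ ≤ v.size ∧ ‖v.n‖ ≤ v.size := by
    intro v
    simp [PluckerVec.size, Prod.norm_def]
  have hn2 : ∀ a b : ℤ, ‖a‖ ≤ ‖(a, b)‖ ∧ ‖b‖ ≤ ‖(a, b)‖ := fun a b =>
    ⟨norm_fst_le (a, b), norm_snd_le (a, b)⟩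
  have hD2 : ∀ x : ℤ × ℤ, |((x.1 ^ 2 + x.2 ^ 2 : ℤ) : ℝ)| ≤ 2 * ‖x‖ ^ 2 := fun x =>
    abs_quadratic_le (norm_fst_le x) (norm_snd_le x)
  have hD2' : ∀ x : ℤ × ℤ, |((x.2 ^ 2 : ℤ) : ℝ)| ≤ 2 * ‖x‖ ^ 2 := fun x => by
    have := abs_quadratic_le (a := 0) (t := ‖x‖) (by simp) (norm_snd_le x)
    simpa using this
  have hD3 : ∀ x : ℤ × ℤ × ℤ, |((x.1 * x.2.2 - x.2.1 ^ 2 : ℤ) : ℝ)| ≤ 2 * ‖x‖ ^ 2 := fun x => by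
    have e1 : |(x.1 : ℝ)| ≤ ‖x‖ := by rw [← Int.norm_eq_abs]; exact norm_fst_le x
    have e2 : |(x.2.1 : ℝ)| ≤ ‖x‖ := by
      rw [← Int.norm_eq_abs]; exact (norm_fst_le x.2).trans (norm_snd_le x)
    have e3 : |(x.2.2 : ℝ)| ≤ ‖x‖ := by
      rw [← Int.norm_eq_abs]; exact (norm_snd_le x.2).trans (norm_snd_le x)
    push_cast
    refine (abs_sub _ _).trans ?_
    rw [abs_mul, abs_pow]
    have := mul_le_mul e1 e3 (abs_nonneg _) (norm_nonneg x)
    have := pow_le_pow_left₀ (abs_nonneg _) e2 2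
    nlinarith
  have A1 := summable_size_of_injOn h3 (fun x => x.1 * x.2.2 - x.2.1 ^ 2) hD3
    {v | v.IsIsotropic ∧ v.b₁ * v.b₃ - v.b₂ ^ 2 ≠ 0} (fun v => (v.b₁, v.b₂, v.b₃)) (fun v => v.m)
    (by
      rintro v ⟨hv, hv0⟩ w ⟨hw, -⟩ h
      simp only [Prod.mk.injEq] at h
      obtain ⟨⟨e1, e2, e3⟩, e0⟩ := h
      have hm : v.m ≠ 0 := fun h => hv0 (by rw [← hv, h, zero_mul])
      refine PluckerVec.ext e0 e1 e2 e3 (mul_left_cancel₀ hm ?_)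
      rw [hv]; conv_rhs => rw [e0]
      rw [hw, e1, e2, e3])
    (by
      rintro v ⟨hv, hv0⟩
      refine ⟨fun h => hv0 ?_, hv0, ⟨v.n, hv.symm⟩⟩
      simp only [Prod.mk_eq_zero] at h
      simp [h.1, h.2.1])
    (by
      intro v _
      have := hsize v
      simp [Prod.norm_def, this])
  have A2 := summable_size_of_injOn h2 (fun x => x.2 ^ 2) hD2'
    {v | v.b₁ * v.b₃ = v.b₂ ^ 2 ∧ v.n = 0 ∧ v.b₂ ≠ 0} (fun v => (v.m, v.b₂)) (fun v => v.b₁)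
    (by
      rintro v ⟨hv, hv0, hv1⟩ w ⟨hw, hw0, -⟩ h
      simp only [Prod.mk.injEq] at h
      obtain ⟨⟨e0, e2⟩, e1⟩ := h
      have hb : v.b₁ ≠ 0 := fun h => hv1 (by simpa [h] using hv.symm)
      refine PluckerVec.ext e0 e1 e2 (mul_left_cancel₀ hb ?_) (by rw [hv0, hw0])
      rw [hv]; conv_rhs => rw [e1]
      rw [hw, e2])
    (by
      rintro v ⟨hv, hv0, hv1⟩
      refine ⟨fun h => hv1 ?_, pow_ne_zero 2 hv1, ⟨v.b₃, hv.symm⟩⟩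
      simp only [Prod.mk_eq_zero] at h
      exact h.2)
    (by
      intro v _
      have := hsize v
      simp [Prod.norm_def, this])
  have A3 := summable_size_of_injOn h2 (fun x => x.2 ^ 2) hD2'
    {v | v.b₁ * v.b₃ = v.b₂ ^ 2 ∧ v.m = 0 ∧ v.b₂ ≠ 0} (fun v => (v.n, v.b₂)) (fun v => v.b₁)
    (by
      rintro v ⟨hv, hv0, hv1⟩ w ⟨hw, hw0, -⟩ h
      simp only [Prod.mk.injEq] at h
      obtain ⟨⟨e0, e2⟩, e1⟩ := h
      have hb : v.b₁ ≠ 0 := fun h => hv1 (by simpa [h] using hv.symm)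
      refine PluckerVec.ext (by rw [hv0, hw0]) e1 e2 (mul_left_cancel₀ hb ?_) e0
      rw [hv]; conv_rhs => rw [e1]
      rw [hw, e2])
    (by
      rintro v ⟨hv, hv0, hv1⟩
      refine ⟨fun h => hv1 ?_, pow_ne_zero 2 hv1, ⟨v.b₃, hv.symm⟩⟩
      simp only [Prod.mk_eq_zero] at h
      exact h.2)
    (by
      intro v _
      have := hsize v
      simp [Prod.norm_def, this])
  -- the remaining vectors have at most two nonzero coordinates `f v` and `g v`
  have A4 : ∀ (S : Set (PluckerVec ℤ)) (f g : PluckerVec ℤ → ℤ),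
      (∀ v ∈ S, ∀ w ∈ S, f v = f w → g v = g w → v = w) → (∀ v ∈ S, f v ≠ 0 ∨ g v ≠ 0) →
      (∀ v, ‖f v‖ ≤ v.size ∧ ‖g v‖ ≤ v.size) →
      Summable (S.indicator fun v => v.size ^ (-4 : ℝ)) := by
    intro S f g hi h0 hfg
    refine summable_size_of_injOn h2 (fun x => x.1 ^ 2 + x.2 ^ 2) hD2 S (fun v => (f v, g v))
      (fun _ => 1) ?_ ?_ ?_
    · intro v hv w hw h
      simp only [Prod.mk.injEq] at h
      exact hi v hv w hw h.1.1 h.1.2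
    · intro v hv
      have : f v ^ 2 + g v ^ 2 ≠ 0 := by
        rcases h0 v hv with h | h
        · have := sq_nonneg (g v); have : 0 < f v ^ 2 := by positivity
          omega
        · have := sq_nonneg (f v); have : 0 < g v ^ 2 := by positivity
          omega
      refine ⟨fun h => ?_, this, one_dvd _⟩
      simp only [Prod.mk_eq_zero] at h
      rw [h.1, h.2] at this
      simp at this
    · intro v _
      rw [Prod.norm_def]
      exact max_le (hfg v).1 (hfg v).2
  have B1 := A4 {v | v ≠ ⟨0, 0, 0, 0, 0⟩ ∧ v.n = 0 ∧ v.b₂ = 0 ∧ v.b₃ = 0}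
    (fun v => v.m) (fun v => v.b₁)
    (fun v hv w hw h1 h2 => PluckerVec.ext h1 h2 (by rw [hv.2.2.1, hw.2.2.1])
      (by rw [hv.2.2.2, hw.2.2.2]) (by rw [hv.2.1, hw.2.1]))
    (fun v hv => by
      by_contra! h
      exact hv.1 (PluckerVec.ext h.1 h.2 hv.2.2.1 hv.2.2.2 hv.2.1))
    (fun v => ⟨(hsize v).1, (hsize v).2.1⟩)
  have B2 := A4 {v | v ≠ ⟨0, 0, 0, 0, 0⟩ ∧ v.n = 0 ∧ v.b₂ = 0 ∧ v.b₁ = 0}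
    (fun v => v.m) (fun v => v.b₃)
    (fun v hv w hw h1 h2 => PluckerVec.ext h1 (by rw [hv.2.2.2, hw.2.2.2])
      (by rw [hv.2.2.1, hw.2.2.1]) h2 (by rw [hv.2.1, hw.2.1]))
    (fun v hv => by
      by_contra! h
      exact hv.1 (PluckerVec.ext h.1 hv.2.2.2 hv.2.2.1 h.2 hv.2.1))
    (fun v => ⟨(hsize v).1, (hsize v).2.2.2.1⟩)
  have B3 := A4 {v | v ≠ ⟨0, 0, 0, 0, 0⟩ ∧ v.m = 0 ∧ v.b₂ = 0 ∧ v.b₃ = 0}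
    (fun v => v.n) (fun v => v.b₁)
    (fun v hv w hw h1 h2 => PluckerVec.ext (by rw [hv.2.1, hw.2.1]) h2 (by rw [hv.2.2.1, hw.2.2.1])
      (by rw [hv.2.2.2, hw.2.2.2]) h1)
    (fun v hv => by
      by_contra! h
      exact hv.1 (PluckerVec.ext hv.2.1 h.2 hv.2.2.1 hv.2.2.2 h.1))
    (fun v => ⟨(hsize v).2.2.2.2, (hsize v).2.1⟩)
  have B4 := A4 {v | v ≠ ⟨0, 0, 0, 0, 0⟩ ∧ v.m = 0 ∧ v.b₂ = 0 ∧ v.b₁ = 0}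
    (fun v => v.n) (fun v => v.b₃)
    (fun v hv w hw h1 h2 => PluckerVec.ext (by rw [hv.2.1, hw.2.1]) (by rw [hv.2.2.2, hw.2.2.2])
      (by rw [hv.2.2.1, hw.2.2.1]) h2 h1)
    (fun v hv => by
      by_contra! h
      exact hv.1 (PluckerVec.ext hv.2.1 hv.2.2.2 hv.2.2.1 h.2 h.1))
    (fun v => ⟨(hsize v).2.2.2.2, (hsize v).2.2.2.1⟩)
  have hnn : (0 : PluckerVec ℤ → ℝ) ≤ fun v => v.size ^ (-4 : ℝ) := fun v =>
    Real.rpow_nonneg (norm_nonneg _) _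
  have hall := summable_indicator_union hnn A1 (summable_indicator_union hnn A2
    (summable_indicator_union hnn A3 (summable_indicator_union hnn B1 (summable_indicator_union hnn
    B2 (summable_indicator_union hnn B3 B4)))))
  refine Summable.of_nonneg_of_le (fun v => Set.indicator_nonneg (fun a _ => hnn a) v)
    (fun v => Set.indicator_le_indicator_of_subset ?_ hnn v) hall
  rintro v ⟨hv, hv0⟩
  exact isotropic_cases hv hv0

/-- A linear form `v ↦ m det τ + b₁ τ₁₁ + 2 b₂ τ₁₂ + b₃ τ₂₂ + n` with `τ` in the Siegel upper half
space does not vanish at a nonzero real isotropic vector. -/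
theorem eq_zero_of_linear_form_eq_zero {τ : Matrix (Fin 2) (Fin 2) ℂ}
    (hτ : τ ∈ siegelUpperHalfSpace) {m b₁ b₂ b₃ n : ℝ} (hi : m * n = b₁ * b₃ - b₂ ^ 2)
    (h : (m : ℂ) * τ.det + b₁ * τ 0 0 + 2 * b₂ * τ 0 1 + b₃ * τ 1 1 + n = 0) :
    m = 0 ∧ b₁ = 0 ∧ b₂ = 0 ∧ b₃ = 0 ∧ n = 0 := by
  obtain ⟨hs, hpos⟩ := hτ
  have h10 : τ 1 0 = τ 0 1 := congrFun (congrFun hs 0) 1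
  have hy1 := hpos.diag_pos (i := 0)
  have hy3 := hpos.diag_pos (i := 1)
  have hdet := hpos.det_pos
  rw [Matrix.det_fin_two] at hdet
  simp only [Matrix.map_apply, h10] at hy1 hy3 hdet
  rw [Matrix.det_fin_two, h10] at h
  have hre := congrArg Complex.re h
  have him := congrArg Complex.im h
  simp at hre him
  set x1 := (τ 0 0).re
  set y1 := (τ 0 0).im
  set x2 := (τ 0 1).re
  set y2 := (τ 0 1).im
  set x3 := (τ 1 1).re
  set y3 := (τ 1 1).im
  by_cases hm : m = 0
  · subst hm
    have e1 : b₁ * y1 + b₃ * y3 = -2 * b₂ * y2 := by linarith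
    have e2 : b₁ * b₃ = b₂ ^ 2 := by linarith
    have hle : b₂ ^ 2 * (y1 * y3 - y2 * y2) ≤ 0 := by
      have h1 : (b₁ * y1 + b₃ * y3) ^ 2 = 4 * b₂ ^ 2 * y2 ^ 2 := by rw [e1]; ring
      have h2 : (b₁ * y1 + b₃ * y3) ^ 2 - 4 * (b₁ * b₃) * (y1 * y3) = (b₁ * y1 - b₃ * y3) ^ 2 := by
        ring
      rw [e2] at h2
      nlinarith [sq_nonneg (b₁ * y1 - b₃ * y3)]
    have hb2 : b₂ = 0 := by
      by_contra hne
      have : 0 < b₂ ^ 2 := by positivity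
      nlinarith [mul_pos this hdet]
    subst hb2
    have e3 : b₁ * b₃ = 0 := by rw [e2]; ring
    rcases mul_eq_zero.1 e3 with hb | hb
    · subst hb
      have : b₃ = 0 := by
        have : b₃ * y3 = 0 := by linarith
        exact (mul_eq_zero.1 this).resolve_right hy3.ne'
      subst this
      refine ⟨rfl, rfl, rfl, rfl, by linarith⟩
    · subst hb
      have : b₁ = 0 := by
        have : b₁ * y1 = 0 := by linarith
        exact (mul_eq_zero.1 this).resolve_right hy1.ne'
      subst this
      refine ⟨rfl, rfl, rfl, rfl, by linarith⟩
  · exfalso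
    -- `m` times the form is the determinant of `m τ + S`, whose imaginary part is definite
    obtain ⟨r1, hr1⟩ : ∃ r, r = m * x1 + b₃ := ⟨_, rfl⟩
    obtain ⟨r2, hr2⟩ : ∃ r, r = m * x2 - b₂ := ⟨_, rfl⟩
    obtain ⟨r3, hr3⟩ : ∃ r, r = m * x3 + b₁ := ⟨_, rfl⟩
    have E1 : r1 * r3 - r2 ^ 2 = m ^ 2 * (y1 * y3 - y2 * y2) := by
      rw [hr1, hr2, hr3]; linear_combination m * hre - hi
    have E2 : m * (r1 * y3 + r3 * y1) = m * (2 * r2 * y2) := by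
      rw [hr1, hr2, hr3]; linear_combination m * him
    have E3 := mul_left_cancel₀ hm E2
    have hm2 : 0 < m ^ 2 := by positivity
    have hp : 0 < m ^ 2 * (y1 * y3 - y2 * y2) := mul_pos hm2 hdet
    have h1 : (r1 * y3 + r3 * y1) ^ 2 = 4 * r2 ^ 2 * y2 ^ 2 := by rw [E3]; ring
    have h2 : (r1 * y3 + r3 * y1) ^ 2 - 4 * (r1 * r3) * (y1 * y3) = (r1 * y3 - r3 * y1) ^ 2 := by
      ring
    have h3 : r1 * r3 * (y1 * y3) ≤ r2 ^ 2 * y2 ^ 2 := by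
      nlinarith [sq_nonneg (r1 * y3 - r3 * y1)]
    have h4 : r2 ^ 2 * y2 ^ 2 < r1 * r3 * (y1 * y3) := by
      have a1 : r2 ^ 2 < r1 * r3 := by linarith
      have a2 : y2 ^ 2 < y1 * y3 := by nlinarith
      nlinarith [mul_pos (sub_pos.2 a1) (sub_pos.2 a2), sq_nonneg r2, sq_nonneg y2,
        mul_nonneg (sq_nonneg r2) (sub_pos.2 a2).le, mul_nonneg (sq_nonneg y2) (sub_pos.2 a1).le]
    linarith

theorem exists_mul_size_le_norm_ell {τ : Matrix (Fin 2) (Fin 2) ℂ}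
    (hτ : τ ∈ siegelUpperHalfSpace) :
    ∃ c > 0, ∀ v : PluckerVec ℤ, v.IsIsotropic → c * v.size ≤ ‖ell τ v‖ := by
  set F : ℝ × ℝ × ℝ × ℝ × ℝ → ℂ := fun x =>
    (x.1 : ℂ) * τ.det + x.2.1 * τ 0 0 + 2 * x.2.2.1 * τ 0 1 + x.2.2.2.1 * τ 1 1 + x.2.2.2.2 with hF
  set K : Set (ℝ × ℝ × ℝ × ℝ × ℝ) := Metric.sphere 0 1 ∩
    {x | x.1 * x.2.2.2.2 = x.2.1 * x.2.2.2.1 - x.2.2.1 ^ 2} with hK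
  have hKc : IsCompact K := by
    refine (isCompact_sphere _ _).inter_right (isClosed_eq ?_ ?_) <;> fun_prop
  have hFc : Continuous fun x => ‖F x‖ := by simp only [hF]; fun_prop
  obtain ⟨c, hc, hmin⟩ := hKc.exists_forall_le' (a := 0) hFc.continuousOn (by
    rintro x ⟨hx1, hx2⟩
    rw [norm_pos_iff]
    intro h0
    obtain ⟨e0, e1, e2, e3, e4⟩ := eq_zero_of_linear_form_eq_zero hτ hx2 h0
    have : x = 0 := Prod.ext e0 (Prod.ext e1 (Prod.ext e2 (Prod.ext e3 e4)))
    rw [this] at hx1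
    simp at hx1)
  refine ⟨c, hc, fun v hv => ?_⟩
  set x : ℝ × ℝ × ℝ × ℝ × ℝ := (v.m, v.b₁, v.b₂, v.b₃, v.n) with hx
  have hsz : v.size = ‖x‖ := by simp [PluckerVec.size, hx, Prod.norm_def, Int.norm_eq_abs]
  have hell : ell τ v = F x := by simp [ell, hF, hx]
  rw [hsz, hell]
  by_cases h0 : x = 0
  · rw [h0]; simp
  have hxp : 0 < ‖x‖ := norm_pos_iff.2 h0
  have hmem : ‖x‖⁻¹ • x ∈ K := by
    refine ⟨by simp [norm_smul, hxp.ne'], ?_⟩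
    have hv' : (v.m : ℝ) * v.n = v.b₁ * v.b₃ - v.b₂ ^ 2 := by exact_mod_cast hv
    simp only [Set.mem_ofPred_eq, Prod.smul_fst, Prod.smul_snd, smul_eq_mul, hx]
    linear_combination (‖((v.m : ℝ), (v.b₁ : ℝ), (v.b₂ : ℝ), (v.b₃ : ℝ), (v.n : ℝ))‖⁻¹) ^ 2 * hv'
  have hsc : F (‖x‖⁻¹ • x) = (‖x‖⁻¹ : ℝ) * F x := by
    simp only [hF, Prod.smul_fst, Prod.smul_snd, smul_eq_mul]
    push_cast
    ring
  have := hmin _ hmem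
  rw [hsc, norm_mul, Complex.norm_real, Real.norm_of_nonneg (by positivity)] at this
  rw [inv_mul_eq_div, le_div_iff₀ hxp] at this
  exact this

theorem summable_mul_ell_zpow {τ : Matrix (Fin 2) (Fin 2) ℂ} (hτ : τ ∈ siegelUpperHalfSpace)
    {k : ℕ} (hk : 4 ≤ k) {C : PluckerVec ℤ → ℂ} (hC : ∀ v, ‖C v‖ ≤ 1)
    (hi : ∀ v, C v ≠ 0 → v.IsIsotropic) (hp : ∀ v, C v ≠ 0 → v.IsPrimitive) :
    Summable fun v => C v * ell τ v ^ (-(k : ℤ)) := by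
  obtain ⟨c, hc, hle⟩ := exists_mul_size_le_norm_ell hτ
  refine Summable.of_norm_bounded (summable_size.mul_left (c ^ (-(k : ℤ)))) fun v => ?_
  by_cases h : C v = 0
  · rw [h, zero_mul, norm_zero]
    exact mul_nonneg (by positivity)
      (Set.indicator_nonneg (fun a _ => Real.rpow_nonneg (norm_nonneg _) _) v)
  have hv0 : v ≠ ⟨0, 0, 0, 0, 0⟩ := by
    rintro rfl
    obtain ⟨c₀, c₁, c₂, c₃, c₄, h1⟩ := hp _ h
    simp at h1
  rw [Set.indicator_of_mem (show v ∈ {v : PluckerVec ℤ | v.IsIsotropic ∧ v ≠ ⟨0, 0, 0, 0, 0⟩} from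
    ⟨hi v h, hv0⟩)]
  have hs1 : 1 ≤ v.size := by
    by_contra! hlt
    simp only [PluckerVec.size, Prod.norm_def, max_lt_iff, Int.norm_eq_abs] at hlt
    obtain ⟨e0, e1, e2, e3, e4⟩ := hlt
    exact hv0 (PluckerVec.ext (Int.abs_lt_one_iff.1 (by exact_mod_cast e0))
      (Int.abs_lt_one_iff.1 (by exact_mod_cast e1)) (Int.abs_lt_one_iff.1 (by exact_mod_cast e2))
      (Int.abs_lt_one_iff.1 (by exact_mod_cast e3)) (Int.abs_lt_one_iff.1 (by exact_mod_cast e4)))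
  have hs0 : 0 < v.size := by linarith
  rw [norm_mul, norm_zpow, _root_.zpow_neg, zpow_natCast]
  calc ‖C v‖ * (‖ell τ v‖ ^ k)⁻¹ ≤ 1 * ((c * v.size) ^ k)⁻¹ := by
        refine mul_le_mul (hC v) ?_ (by positivity) zero_le_one
        exact inv_anti₀ (by positivity) (pow_le_pow_left₀ (by positivity) (hle v (hi v h)) k)
    _ = c ^ (-(k : ℤ)) * (v.size ^ k)⁻¹ := by
        rw [one_mul, mul_pow, mul_inv, _root_.zpow_neg, zpow_natCast]
    _ ≤ c ^ (-(k : ℤ)) * v.size ^ (-4 : ℝ) := by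
        refine mul_le_mul_of_nonneg_left ?_ (by positivity)
        rw [Real.rpow_neg hs0.le]
        refine inv_anti₀ (by positivity) ?_
        rw [show (4 : ℝ) = ((4 : ℕ) : ℝ) by norm_num, Real.rpow_natCast]
        exact pow_le_pow_right₀ hs1 hk

/-! ### Character sums over symmetric matrices -/

section CharacterSums

variable {F : Type*} [Field F] [Fintype F] [DecidableEq F]

local notation "ψ" => quadraticChar F

theorem sum_quadraticChar_sq_add (hF : ringChar F ≠ 2) {c : F} (hc : c ≠ 0) :
    ∑ x : F, ψ (x ^ 2 + c) = -1 := by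
  have h2 : (2 : F) ≠ 0 := Ring.two_ne_zero hF
  have h1 : ∀ x : F, ψ (x ^ 2 + c) = ∑ y : F, (if y ^ 2 = x ^ 2 + c then (1 : ℤ) else 0) - 1 := by
    intro x
    have := quadraticChar_card_sqrts hF (x ^ 2 + c)
    rw [Finset.sum_boole]
    rw [eq_sub_iff_add_eq, ← this]
    congr 2
    ext y; simp
  -- count `(y - x) (y + x) = c` in the coordinates `u = y - x`, `v = y + x`
  have h3 : ∑ x : F, ∑ y : F, (if y ^ 2 = x ^ 2 + c then (1 : ℤ) else 0) =
      ∑ u : F, ∑ v : F, if u * v = c then (1 : ℤ) else 0 := by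
    rw [← Fintype.sum_prod_type', ← Fintype.sum_prod_type']
    refine Fintype.sum_equiv ⟨fun p => (p.2 - p.1, p.2 + p.1),
      fun p => ((p.2 - p.1) / 2, (p.2 + p.1) / 2), fun p => ?_, fun p => ?_⟩ _ _ fun p => ?_
    · ext <;> simp <;> field_simp <;> ring
    · ext <;> simp <;> field_simp <;> ring
    · have : (p.2 - p.1) * (p.2 + p.1) = c ↔ p.2 ^ 2 = p.1 ^ 2 + c := by
        constructor <;> intro h <;> linear_combination h
      simp only [Equiv.coe_fn_mk, this]
  have h4 : ∀ u : F, ∑ v : F, (if u * v = c then (1 : ℤ) else 0) = if u = 0 then 0 else 1 := by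
    intro u
    by_cases hu : u = 0
    · simp [hu, hc.symm]
    · rw [if_neg hu, Finset.sum_eq_single (c / u)]
      · rw [if_pos (by field_simp)]
      · intro v _ hv
        rw [if_neg]
        intro h; apply hv; rw [← h]; field_simp
      · simp
  rw [Finset.sum_congr rfl fun x _ => h1 x, Finset.sum_sub_distrib, h3,
    Finset.sum_congr rfl fun u _ => h4 u]
  have : ∀ u : F, (if u = 0 then (0 : ℤ) else 1) = 1 - if u = 0 then 1 else 0 := fun u => by
    split_ifs <;> simp
  simp only [this, Finset.sum_sub_distrib, Finset.sum_ite_eq', Finset.mem_univ, if_true]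
  simp

theorem sum_quadraticChar_sq (F : Type*) [Field F] [Fintype F] [DecidableEq F] :
    ∑ x : F, (quadraticChar F x) ^ 2 = (Fintype.card F : ℤ) - 1 := by
  have : ∀ x : F, quadraticChar F x ^ 2 = 1 - if x = 0 then 1 else 0 := by
    intro x
    split_ifs with h
    · simp [h]
    · rw [quadraticChar_sq_one h]; simp
  simp only [this, Finset.sum_sub_distrib, Finset.sum_ite_eq', Finset.mem_univ, if_true]
  simp

/-- The number of solutions of `β x ^ 2 + y ^ 2 = c` depends only on whether `c = 0`. -/
theorem sum_conic (hF : ringChar F ≠ 2) {β : F} (hβ : β ≠ 0) (f : F → ℤ) :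
    ∑ x : F, ∑ y : F, f (β * x ^ 2 + y ^ 2) =
      ((Fintype.card F : ℤ) - ψ (-β)) * ∑ c : F, f c + Fintype.card F * ψ (-β) * f 0 := by
  have hN : ∀ c : F, ∑ x : F, ∑ y : F, (if β * x ^ 2 + y ^ 2 = c then (1 : ℤ) else 0) =
      (Fintype.card F : ℤ) - ψ (-β) + if c = 0 then Fintype.card F * ψ (-β) else 0 := by
    intro c
    have h1 : ∀ x : F, ∑ y : F, (if β * x ^ 2 + y ^ 2 = c then (1 : ℤ) else 0) =
        ψ (-β) * ψ (x ^ 2 + -c / β) + 1 := by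
      intro x
      have := quadraticChar_card_sqrts hF (c - β * x ^ 2)
      rw [← map_mul, show -β * (x ^ 2 + -c / β) = c - β * x ^ 2 by field_simp; ring, ← this,
        Finset.sum_boole]
      congr 2
      ext y
      simp only [mem_filter, mem_univ, true_and, Set.mem_toFinset, Set.mem_ofPred_eq]
      constructor <;> intro h <;> linear_combination h
    rw [Finset.sum_congr rfl fun x _ => h1 x, Finset.sum_add_distrib, ← Finset.mul_sum]
    by_cases hc : c = 0
    · simp only [hc, neg_zero, zero_div, add_zero, map_pow, sum_quadraticChar_sq, if_true]
      simp; ring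
    · rw [sum_quadraticChar_sq_add hF (div_ne_zero (neg_ne_zero.2 hc) hβ), if_neg hc]
      simp; ring
  have h2 : ∀ x y : F, f (β * x ^ 2 + y ^ 2) =
      ∑ c : F, f c * if β * x ^ 2 + y ^ 2 = c then (1 : ℤ) else 0 := by
    intro x y; simp
  simp only [h2]
  have h3 : ∀ x : F, ∑ y : F, ∑ c : F, f c * (if β * x ^ 2 + y ^ 2 = c then (1 : ℤ) else 0) =
      ∑ c : F, ∑ y : F, f c * (if β * x ^ 2 + y ^ 2 = c then (1 : ℤ) else 0) :=
    fun x => Finset.sum_comm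
  rw [Finset.sum_congr rfl fun x _ => h3 x, Finset.sum_comm]
  simp only [← Finset.mul_sum, hN, mul_add, Finset.sum_add_distrib]
  rw [← Finset.sum_mul]
  simp
  ring

/-- The sum `∑_Z (det Z) f (det (X - Z))` over the symmetric `2 × 2` matrices `Z` over a finite
field, where `(·)` is the quadratic character and `X = (x₁ x₂; x₂ x₃)`. -/
def twistSum (f : F → ℤ) (x₁ x₂ x₃ : F) : ℤ :=
  ∑ z : F × F × F, ψ (z.1 * z.2.2 - z.2.1 ^ 2) *
    f ((x₁ - z.1) * (x₃ - z.2.2) - (x₂ - z.2.1) ^ 2)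

theorem twistSum_swap (f : F → ℤ) (x₁ x₂ x₃ : F) : twistSum f x₁ x₂ x₃ = twistSum f x₃ x₂ x₁ := by
  refine Fintype.sum_equiv ⟨fun p => (p.2.2, p.2.1, p.1), fun p => (p.2.2, p.2.1, p.1),
    fun _ => rfl, fun _ => rfl⟩ _ _ fun p => ?_
  simp only [Equiv.coe_fn_mk, mul_comm]

theorem twistSum_shear (f : F → ℤ) (s x₁ x₂ x₃ : F) :
    twistSum f x₁ x₂ x₃ = twistSum f x₁ (x₂ + s * x₁) (x₃ + 2 * s * x₂ + s ^ 2 * x₁) := by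
  refine Fintype.sum_equiv ⟨fun p => (p.1, p.2.1 + s * p.1, p.2.2 + 2 * s * p.2.1 + s ^ 2 * p.1),
    fun p => (p.1, p.2.1 - s * p.1, p.2.2 - 2 * s * p.2.1 + s ^ 2 * p.1),
    fun p => ?_, fun p => ?_⟩ _ _ fun p => ?_
  · ext <;> simp; ring
  · ext <;> simp; ring
  · simp only [Equiv.coe_fn_mk]
    congr 2 <;> ring

/-- A twist sum at `diag(u, w)`, with the coordinate `z` replaced by `t = u z + w x`. -/
theorem twistSum_diag (f : F → ℤ) {u : F} (hu : u ≠ 0) (w : F) :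
    twistSum f u 0 w = ∑ t : F, ∑ x : F, ∑ y : F, ψ (x * (t - w * x) / u - y ^ 2) *
      f (x * (t - w * x) / u - y ^ 2 - t + u * w) := by
  have : ∀ t : F, ∑ x : F, ∑ y : F, ψ (x * (t - w * x) / u - y ^ 2) *
      f (x * (t - w * x) / u - y ^ 2 - t + u * w) = ∑ p : F × F,
      ψ (p.1 * (t - w * p.1) / u - p.2 ^ 2) *
      f (p.1 * (t - w * p.1) / u - p.2 ^ 2 - t + u * w) := fun t => by
    rw [Fintype.sum_prod_type]
  rw [Finset.sum_congr rfl fun t _ => this t, ← Fintype.sum_prod_type']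
  refine Fintype.sum_equiv ⟨fun p => (u * p.2.2 + w * p.1, p.1, p.2.1),
    fun p => (p.2.1, p.2.2, (p.1 - w * p.2.1) / u), fun p => ?_, fun p => ?_⟩ _ _ fun p => ?_
  · ext <;> simp; field_simp
  · ext <;> simp; field_simp; ring
  · have e : p.1 * (u * p.2.2 + w * p.1 - w * p.1) / u - p.2.1 ^ 2 =
        p.1 * p.2.2 - p.2.1 ^ 2 := by field_simp; ring
    simp only [Equiv.coe_fn_mk, e]
    congr 2; ring

variable (ν : ℤˣ)

/-- The indicator function of `(c) = ν`. -/
def charInd (c : F) : ℤ := if ψ c = (ν : ℤ) then 1 else 0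

theorem two_mul_charInd {c : F} (hc : c ≠ 0) : 2 * charInd ν c = 1 + ν * ψ c := by
  rw [charInd]
  rcases Int.units_eq_one_or ν with rfl | rfl <;>
    rcases quadraticChar_dichotomy hc with h | h <;> simp [h]

theorem charInd_zero : charInd ν (0 : F) = 0 := by
  rw [charInd, if_neg]; simpa using ν.ne_zero.symm

theorem two_mul_quadraticChar_mul_charInd (c : F) :
    2 * (ψ c * charInd ν c) = ψ c + ν * ψ c ^ 2 := by
  by_cases hc : c = 0
  · simp [hc]
  · linear_combination ψ c * two_mul_charInd ν hc

theorem two_mul_sum_quadraticChar_mul_charInd (hF : ringChar F ≠ 2) :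
    2 * ∑ c : F, ψ c * charInd ν c = ν * ((Fintype.card F : ℤ) - 1) := by
  rw [Finset.mul_sum, Finset.sum_congr rfl fun c _ => two_mul_quadraticChar_mul_charInd ν c,
    Finset.sum_add_distrib, quadraticChar_sum_zero hF, ← Finset.mul_sum, sum_quadraticChar_sq,
    zero_add]

theorem sum_quadraticChar_mul_sum_charInd (hF : ringChar F ≠ 2) (f : F → ℤ) (e : F) :
    ∑ t : F, ∑ c : F, ψ c * f (c - t + e) = 0 := by
  rw [Finset.sum_comm]
  have : ∀ c : F, ∑ t : F, ψ c * f (c - t + e) = ψ c * ∑ t : F, f t := by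
    intro c
    rw [← Finset.mul_sum]
    congr 1
    exact Fintype.sum_equiv (Equiv.subLeft (c + e)) _ _ fun t => by
      simp only [Equiv.subLeft_apply]; congr 1; ring
  rw [Finset.sum_congr rfl fun c _ => this c, ← Finset.sum_mul, quadraticChar_sum_zero hF, zero_mul]

theorem twistSum_charInd_diag (hF : ringChar F ≠ 2) {u w : F} (hu : u ≠ 0) (hw : w ≠ 0) :
    twistSum (charInd ν) u 0 w =
      ψ (-1) * Fintype.card F * (Fintype.card F - 2) * charInd ν (u * w) := by
  have h2 : (2 : F) ≠ 0 := Ring.two_ne_zero hF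
  rw [twistSum_diag _ hu]
  have hβ : w / u ≠ 0 := div_ne_zero hw hu
  -- complete the square in `x`, and count points on the conics that result
  have h1 : ∀ t : F, ∑ x : F, ∑ y : F, ψ (x * (t - w * x) / u - y ^ 2) *
      charInd ν (x * (t - w * x) / u - y ^ 2 - t + u * w) =
      ((Fintype.card F : ℤ) - ψ (-(w / u))) * ∑ c : F, ψ c * charInd ν (c - t + u * w) +
      Fintype.card F * ψ (-(w / u)) * (ψ (t ^ 2 / (4 * (u * w))) *
        charInd ν ((t - 2 * (u * w)) ^ 2 / (4 * (u * w)))) := by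
    intro t
    have hc := sum_conic hF hβ (fun c => ψ (t ^ 2 / (4 * (u * w)) - c) *
      charInd ν (t ^ 2 / (4 * (u * w)) - c - t + u * w))
    have e1 : ∑ c : F, ψ (t ^ 2 / (4 * (u * w)) - c) *
        charInd ν (t ^ 2 / (4 * (u * w)) - c - t + u * w) =
        ∑ c : F, ψ c * charInd ν (c - t + u * w) :=
      Fintype.sum_equiv (Equiv.subLeft (t ^ 2 / (4 * (u * w)))) _ _ fun c => by simp
    have e2 : t ^ 2 / (4 * (u * w)) - 0 - t + u * w =
        (t - 2 * (u * w)) ^ 2 / (4 * (u * w)) := by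
      have h4 : (4 : F) ≠ 0 := by
        have : (4 : F) = 2 * 2 := by norm_num
        rw [this]; exact mul_ne_zero h2 h2
      field_simp; ring
    rw [e1, e2, sub_zero] at hc
    rw [← hc]
    refine Fintype.sum_equiv (Equiv.subRight (t / (2 * w))) _ _ fun x => ?_
    refine Finset.sum_congr rfl fun y _ => ?_
    have e3 : x * (t - w * x) / u - y ^ 2 =
        t ^ 2 / (4 * (u * w)) - (w / u * (x - t / (2 * w)) ^ 2 + y ^ 2) := by
      have h4 : (4 : F) ≠ 0 := by
        have : (4 : F) = 2 * 2 := by norm_num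
        rw [this]; exact mul_ne_zero h2 h2
      field_simp; ring
    simp only [Equiv.subRight_apply, e3]
  have huw : u * w ≠ 0 := mul_ne_zero hu hw
  have h3 : ∀ a : F, ψ (a ^ 2 / (4 * (u * w))) = if a = 0 then 0 else ψ (u * w) := by
    intro a
    split_ifs with ha
    · simp [ha]
    · have h4 : (4 : F) ≠ 0 := by
        have : (4 : F) = 2 * 2 := by norm_num
        rw [this]; exact mul_ne_zero h2 h2
      have : a ^ 2 / (4 * (u * w)) = (a / (2 * (u * w))) ^ 2 * (u * w) := by field_simp; norm_num
      rw [this, map_mul, quadraticChar_sq_one' (div_ne_zero ha (mul_ne_zero h2 huw)), one_mul]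
  have h5 : ∀ a : F, charInd ν (a ^ 2 / (4 * (u * w))) =
      if a = 0 then 0 else charInd ν (u * w) := by
    intro a
    split_ifs with ha
    · rw [ha]; simp [charInd_zero]
    · rw [charInd, h3, if_neg ha, charInd]
  rw [Finset.sum_congr rfl fun t _ => h1 t, Finset.sum_add_distrib, ← Finset.mul_sum,
    sum_quadraticChar_mul_sum_charInd hF, mul_zero, zero_add, ← Finset.mul_sum]
  have h6 : ∀ t : F, ψ (t ^ 2 / (4 * (u * w))) *
        charInd ν ((t - 2 * (u * w)) ^ 2 / (4 * (u * w))) =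
      (ψ (u * w) * charInd ν (u * w)) *
        (1 - (if t = 0 then 1 else 0) - (if t = 2 * (u * w) then 1 else 0)) := by
    intro t
    rw [h3, h5]
    have h7 : t - 2 * (u * w) = 0 ↔ t = 2 * (u * w) := sub_eq_zero
    by_cases ht : t = 0
    · have : ¬ (0 : F) = 2 * (u * w) := (mul_ne_zero h2 huw).symm
      simp [ht, this]
    · by_cases ht2 : t = 2 * (u * w)
      · simp [ht2, mul_ne_zero h2 huw]
      · simp [ht, h7, ht2]
  rw [Finset.sum_congr rfl fun t _ => h6 t, ← Finset.mul_sum]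
  simp only [Finset.sum_sub_distrib, Finset.sum_ite_eq', Finset.mem_univ, if_true]
  have h8 : ψ (-(w / u)) * ψ (u * w) = ψ (-1) := by
    rw [← map_mul, show -(w / u) * (u * w) = -1 * w ^ 2 by field_simp, map_mul,
      quadraticChar_sq_one' hw, mul_one]
  simp only [Finset.sum_const, Finset.card_univ, nsmul_eq_mul, mul_one]
  linear_combination (Fintype.card F * charInd ν (u * w) * (Fintype.card F - 1 - 1) : ℤ) * h8

theorem two_mul_sum_neg_sq : 2 * ∑ y : F, ψ (-y ^ 2) * charInd ν (-y ^ 2) =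
      (ψ (-1) + ν) * ((Fintype.card F : ℤ) - 1) := by
  rw [Finset.mul_sum, ← sum_quadraticChar_sq F, Finset.mul_sum]
  refine Finset.sum_congr rfl fun y _ => ?_
  rw [two_mul_quadraticChar_mul_charInd, show -y ^ 2 = -1 * y ^ 2 by ring, map_mul, map_pow]
  by_cases hy : y = 0
  · simp [hy]
  · have h1 := quadraticChar_sq_one hy
    have h2 := quadraticChar_sq_one (F := F) (a := -1) (by simp)
    rw [h1]; linear_combination (ν : ℤ) * h2

theorem two_mul_twistSum_charInd_rank_one (hF : ringChar F ≠ 2) {u : F} (hu : u ≠ 0) :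
    2 * twistSum (charInd ν) u 0 0 = ψ (-1) * Fintype.card F * (Fintype.card F - 1) := by
  rw [twistSum_diag _ hu]
  have h1 : ∀ t : F, ∑ x : F, ∑ y : F, ψ (x * (t - 0 * x) / u - y ^ 2) *
      charInd ν (x * (t - 0 * x) / u - y ^ 2 - t + u * 0) =
      Fintype.card F * ∑ c : F, ψ c * charInd ν (c - t + 0) +
      if t = 0 then Fintype.card F * (∑ y : F, ψ (-y ^ 2) * charInd ν (-y ^ 2) -
        ∑ c : F, ψ c * charInd ν c) else 0 := by
    intro t
    split_ifs with ht
    · subst ht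
      simp [mul_sub]
    · rw [Finset.sum_comm, add_zero]
      have : ∀ y : F, ∑ x : F, ψ (x * (t - 0 * x) / u - y ^ 2) *
          charInd ν (x * (t - 0 * x) / u - y ^ 2 - t + u * 0) =
          ∑ c : F, ψ c * charInd ν (c - t + 0) := by
        intro y
        refine Fintype.sum_equiv ((Equiv.mulRight₀ (t / u) (div_ne_zero ht hu)).trans
          (Equiv.subRight (y ^ 2))) _ _ fun x => ?_
        have e : x * (t - 0 * x) / u - y ^ 2 = x * (t / u) - y ^ 2 := by ring
        simp only [Equiv.trans_apply, Equiv.mulRight₀_apply, Equiv.subRight_apply, e, mul_zero,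
          add_zero]
      rw [Finset.sum_congr rfl fun y _ => this y]
      simp
  rw [Finset.sum_congr rfl fun t _ => h1 t, Finset.sum_add_distrib, ← Finset.mul_sum,
    sum_quadraticChar_mul_sum_charInd hF, mul_zero, zero_add, Finset.sum_ite_eq']
  simp only [Finset.mem_univ, if_true]
  linear_combination (Fintype.card F : ℤ) * two_mul_sum_neg_sq (F := F) ν -
    (Fintype.card F : ℤ) * two_mul_sum_quadraticChar_mul_charInd ν hF

theorem two_mul_twistSum_charInd_zero (hF : ringChar F ≠ 2) :
    2 * twistSum (charInd ν) (0 : F) 0 0 =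
      Fintype.card F * (Fintype.card F - 1) * (ν * Fintype.card F + ψ (-1)) := by
  have h0 : twistSum (charInd ν) (0 : F) 0 0 = ∑ z : F, ∑ x : F, ∑ y : F,
      ψ (x * z - y ^ 2) * charInd ν (x * z - y ^ 2) := by
    have : ∀ t : F, ∑ x : F, ∑ y : F, ψ (x * t - y ^ 2) * charInd ν (x * t - y ^ 2) =
        ∑ p : F × F, ψ (p.1 * t - p.2 ^ 2) * charInd ν (p.1 * t - p.2 ^ 2) := fun t => by
      rw [Fintype.sum_prod_type]
    rw [Finset.sum_congr rfl fun t _ => this t, ← Fintype.sum_prod_type']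
    refine Fintype.sum_equiv ⟨fun p => (p.2.2, p.1, p.2.1), fun p => (p.2.1, p.2.2, p.1),
      fun _ => rfl, fun _ => rfl⟩ _ _ fun p => ?_
    simp
  have h1 : ∀ t : F, ∑ x : F, ∑ y : F, ψ (x * t - y ^ 2) * charInd ν (x * t - y ^ 2) =
      Fintype.card F * ∑ c : F, ψ c * charInd ν c +
      if t = 0 then Fintype.card F * (∑ y : F, ψ (-y ^ 2) * charInd ν (-y ^ 2) -
        ∑ c : F, ψ c * charInd ν c) else 0 := by
    intro t
    split_ifs with ht
    · subst ht
      simp [mul_sub]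
    · rw [Finset.sum_comm, add_zero]
      have : ∀ y : F, ∑ x : F, ψ (x * t - y ^ 2) * charInd ν (x * t - y ^ 2) =
          ∑ c : F, ψ c * charInd ν c := by
        intro y
        exact Fintype.sum_equiv ((Equiv.mulRight₀ t ht).trans (Equiv.subRight (y ^ 2))) _ _
          fun x => by simp
      rw [Finset.sum_congr rfl fun y _ => this y]
      simp
  rw [h0, Finset.sum_congr rfl fun t _ => h1 t, Finset.sum_add_distrib, Finset.sum_ite_eq']
  simp only [Finset.mem_univ, if_true, Finset.sum_const, Finset.card_univ, nsmul_eq_mul]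
  linear_combination (Fintype.card F : ℤ) * two_mul_sum_neg_sq (F := F) ν +
    (Fintype.card F * (Fintype.card F - 1) : ℤ) * two_mul_sum_quadraticChar_mul_charInd ν hF

/-- Symmetric matrices over a field of odd characteristic are congruent to diagonal ones. -/
theorem exists_twistSum_eq_diag (hF : ringChar F ≠ 2) (f : F → ℤ) {x₁ x₂ x₃ : F}
    (h : ¬ (x₁ = 0 ∧ x₂ = 0 ∧ x₃ = 0)) :
    ∃ u w : F, u ≠ 0 ∧ u * w = x₁ * x₃ - x₂ ^ 2 ∧ twistSum f x₁ x₂ x₃ = twistSum f u 0 w := by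
  have main : ∀ x₁ x₂ x₃ : F, x₁ ≠ 0 →
      ∃ u w : F, u ≠ 0 ∧ u * w = x₁ * x₃ - x₂ ^ 2 ∧ twistSum f x₁ x₂ x₃ = twistSum f u 0 w := by
    intro x₁ x₂ x₃ h1
    refine ⟨x₁, x₃ - x₂ ^ 2 / x₁, h1, by field_simp, ?_⟩
    rw [twistSum_shear f (-x₂ / x₁)]
    congr 1 <;> field_simp <;> ring
  by_cases h1 : x₁ = 0
  · by_cases h3 : x₃ = 0
    · have h2 : x₂ ≠ 0 := fun h2 => h ⟨h1, h2, h3⟩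
      obtain ⟨u, w, hu, huw, e⟩ := main (x₁ + 2 * x₂) x₂ 0
        (by rw [h1, zero_add]; exact mul_ne_zero (Ring.two_ne_zero hF) h2)
      refine ⟨u, w, hu, by rw [huw, h1, h3]; ring, ?_⟩
      rw [← e, twistSum_swap, twistSum_shear f 1, twistSum_swap, h3]
      congr 1 <;> ring
    · obtain ⟨u, w, hu, huw, e⟩ := main x₃ x₂ x₁ h3
      exact ⟨u, w, hu, by rw [huw]; ring, by rw [twistSum_swap, e]⟩
  · exact main x₁ x₂ x₃ h1

theorem twistSum_charInd_of_det_ne_zero (hF : ringChar F ≠ 2) {x₁ x₂ x₃ : F}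
    (h : x₁ * x₃ - x₂ ^ 2 ≠ 0) :
    twistSum (charInd ν) x₁ x₂ x₃ =
      ψ (-1) * Fintype.card F * (Fintype.card F - 2) * charInd ν (x₁ * x₃ - x₂ ^ 2) := by
  obtain ⟨u, w, hu, huw, e⟩ := exists_twistSum_eq_diag hF (charInd ν) (x₁ := x₁) (x₂ := x₂)
    (x₃ := x₃) (by rintro ⟨rfl, rfl, rfl⟩; simp at h)
  have hw : w ≠ 0 := by rintro rfl; rw [← huw] at h; simp at h
  rw [e, twistSum_charInd_diag ν hF hu hw, huw]

theorem two_mul_twistSum_charInd_of_det_eq_zero (hF : ringChar F ≠ 2) {x₁ x₂ x₃ : F}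
    (h0 : ¬ (x₁ = 0 ∧ x₂ = 0 ∧ x₃ = 0)) (h : x₁ * x₃ - x₂ ^ 2 = 0) :
    2 * twistSum (charInd ν) x₁ x₂ x₃ = ψ (-1) * Fintype.card F * (Fintype.card F - 1) := by
  obtain ⟨u, w, hu, huw, e⟩ := exists_twistSum_eq_diag hF (charInd ν) h0
  have hw : w = 0 := by
    rw [h] at huw
    exact (mul_eq_zero.1 huw).resolve_left hu
  rw [e, hw, two_mul_twistSum_charInd_rank_one ν hF hu]

end CharacterSums

/-! ### Local orbits -/

section LocalOrbits

variable {R : Type*} [CommRing R]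

/-- Explicit form of the inverse transpose. -/
theorem entries_of_mul_transpose_eq_one {A D : Matrix (Fin 2) (Fin 2) R} (h : A * Dᵀ = 1) :
    A.det * D.det = 1 ∧ D 0 0 = D.det * A 1 1 ∧ D 0 1 = -D.det * A 1 0 ∧
      D 1 0 = -D.det * A 0 1 ∧ D 1 1 = D.det * A 0 0 := by
  have hdet : A.det * D.det = 1 := by
    rw [← Matrix.det_transpose D, ← Matrix.det_mul, h, Matrix.det_one]
  have hD : Dᵀ = D.det • A.adjugate := by
    calc Dᵀ = (D.det * A.det) • Dᵀ := by rw [mul_comm, hdet, one_smul]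
      _ = D.det • (A.adjugate * A * Dᵀ) := by
          rw [Matrix.adjugate_mul, Matrix.smul_mul, Matrix.one_mul, smul_smul]
      _ = D.det • A.adjugate := by rw [Matrix.mul_assoc, h, Matrix.mul_one]
  have e (i j) := congrFun (congrFun hD i) j
  have e00 := e 0 0
  have e01 := e 0 1
  have e10 := e 1 0
  have e11 := e 1 1
  simp [Matrix.adjugate_fin_two] at e00 e01 e10 e11
  exact ⟨hdet, e00, by rw [e10]; ring, by rw [e01]; ring, e11⟩

theorem mul_transpose_eq_one_of_entries {A D : Matrix (Fin 2) (Fin 2) R} {d : R}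
    (h : d * A.det = 1) (hD : D = !![d * A 1 1, -d * A 1 0; -d * A 0 1, d * A 0 0]) :
    A * Dᵀ = 1 := by
  rw [Matrix.det_fin_two] at h
  subst hD
  ext i j
  fin_cases i <;> fin_cases j <;> simp [Matrix.mul_apply, Fin.sum_univ_two]
  · linear_combination h
  · ring
  · ring
  · linear_combination h

/-- The vectors with `m = b = 0` and `n` a unit are in the orbit of `(0 I)`. -/
theorem isLocalOrbit_zero {n n' : R} (h : n * n' = 1) :
    IsLocalOrbit 0 (⟨0, 0, 0, 0, n⟩ : PluckerVec R) := by
  refine ⟨!![1, 0; 0, n'], 0, !![1, 0; 0, n], ?_, by simp, ?_⟩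
  · ext i j
    fin_cases i <;> fin_cases j <;> simp [Matrix.mul_apply, Fin.sum_univ_two]
    rw [mul_comm]; exact h
  · ext <;> simp [plucker, Matrix.det_fin_two]

/-- The vectors with `m = 0` and `b = d r rᵀ`, where `d` is a unit and `r` is unimodular, are in the
orbit of `(diag(1, 0) I)`. -/
theorem isLocalOrbit_rank_one {r₁ r₂ x y d d' n : R} (hr : x * r₁ + y * r₂ = 1) (hd : d * d' = 1) :
    IsLocalOrbit (diagonal ![1, 0])
      (⟨0, d * r₁ ^ 2, d * (r₁ * r₂), d * r₂ ^ 2, n⟩ : PluckerVec R) := by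
  refine ⟨!![r₁, r₂; -y * d', x * d'], !![(n * d' - 1) * x, (n * d' - 1) * y; 0, 0],
    !![x, y; -d * r₂, d * r₁], ?_, ?_, ?_⟩
  · refine mul_transpose_eq_one_of_entries (d := d) ?_ ?_
    · simp [Matrix.det_fin_two]
      linear_combination hr + (x * r₁ + y * r₂) * hd
    · ext i j
      fin_cases i <;> fin_cases j <;> simp
      · linear_combination -x * hd
      · linear_combination -y * hd
  · rw [mul_transpose_comm_iff]
    simp
    ring
  · ext <;> simp [plucker, Matrix.det_fin_two, Matrix.mul_apply, Fin.sum_univ_two]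
    · ring
    · ring
    · ring
    · linear_combination (n * d' * d) * hr + n * hd

/-- The isotropic vectors with `m` a unit are in the orbit of `(I I)`. -/
theorem isLocalOrbit_one {v : PluckerVec R} (hi : v.IsIsotropic) {m' : R} (h : v.m * m' = 1) :
    IsLocalOrbit 1 v := by
  rw [PluckerVec.IsIsotropic] at hi
  refine ⟨!![1, 0; 0, v.m], !![m' * v.b₃ - 1, -m' * v.b₂; -v.b₂, v.b₁ - m'],
    !![1, 0; 0, m'], ?_, ?_, ?_⟩
  · ext i j
    fin_cases i <;> fin_cases j <;> simp [Matrix.mul_apply, Fin.sum_univ_two, h]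
  · rw [mul_transpose_comm_iff]
    simp
    linear_combination -v.b₂ * h
  · ext <;> simp [plucker, Matrix.det_fin_two]
    · linear_combination v.b₂ * h
    · linear_combination v.b₃ * h
    · linear_combination v.n * h - m' * hi

/-- Multiplying `M` and `N` on the right by `(0 1; -1 0)` exchanges `b₁` and `b₃` and changes the sign
of `b₂`. -/
theorem IsLocalOrbit.of_swap {s : Matrix (Fin 2) (Fin 2) R} {v : PluckerVec R}
    (h : IsLocalOrbit s ⟨v.m, v.b₃, -v.b₂, v.b₁, v.n⟩) (hs : sᵀ = s) : IsLocalOrbit s v := by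
  obtain ⟨A, B, D, h1, h2, h3⟩ := h
  have hsym := IsLocalOrbit.symm_pair hs h1 h2
  set W : Matrix (Fin 2) (Fin 2) R := !![0, 1; -1, 0] with hW
  have hWW : W * Wᵀ = 1 := by
    ext i j
    fin_cases i <;> fin_cases j <;> simp [hW, Matrix.mul_apply, Fin.sum_univ_two]
  refine ⟨A * W, B * W, D * W, ?_, ?_, ?_⟩
  · rw [transpose_mul, Matrix.mul_assoc, ← Matrix.mul_assoc W, hWW, Matrix.one_mul, h1]
  · rw [transpose_mul, transpose_mul, Matrix.mul_assoc, ← Matrix.mul_assoc W, hWW, Matrix.one_mul,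
      Matrix.mul_assoc, ← Matrix.mul_assoc W, hWW, Matrix.one_mul, h2]
  · rw [← Matrix.mul_assoc, ← Matrix.mul_assoc, ← Matrix.add_mul]
    generalize s * A = M at *
    generalize s * B + D = N at *
    rw [mul_transpose_comm_iff] at hsym
    simp only [plucker, Matrix.det_fin_two, PluckerVec.mk.injEq] at h3
    obtain ⟨e0, e1, e2, e3, e4⟩ := h3
    ext <;> simp [plucker, Matrix.det_fin_two, hW, Matrix.mul_apply, Fin.sum_univ_two]
    · linear_combination e0
    · linear_combination e3
    · linear_combination hsym - e2
    · linear_combination e1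
    · linear_combination e4

/-- Local solution for `s = diag(1, ϖ κ)` where `b₁` is a unit. -/
theorem isLocalOrbit_diag_one {ϖ κ β t t' a a' c : R} {v : PluckerVec R} (hi : v.IsIsotropic)
    (ht : t * t' = 1) (ha : a * a' = 1) (hc : v.b₁ * c = 1) (hm : v.m = ϖ * (κ * t * a))
    (hβ : ϖ * κ * β = v.b₁ * t' - a') :
    IsLocalOrbit (diagonal ![1, ϖ * κ]) v := by
  rw [PluckerVec.IsIsotropic] at hi
  refine ⟨!![t, t * (v.b₂ * c); 0, a], !![t * v.n * c - t', 0; -(v.b₂ * c) * β, β],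
    !![t', 0; -(v.b₂ * c) * a', a'], ?_, ?_, ?_⟩
  · refine mul_transpose_eq_one_of_entries (d := t' * a') ?_ ?_
    · simp [Matrix.det_fin_two]
      linear_combination a * a' * ht + ha
    · ext i j
      fin_cases i <;> fin_cases j <;> simp
      · linear_combination -t' * ha
      · linear_combination -v.b₂ * c * a' * ht
      · linear_combination -a' * ht
  · rw [mul_transpose_comm_iff]
    simp
    ring
  · ext <;> simp [plucker, Matrix.det_fin_two]
    · rw [hm]; ring
    · linear_combination t * hβ + v.b₁ * ht
    · linear_combination t * v.b₂ * c * hβ + v.b₂ * c * v.b₁ * ht + v.b₂ * hc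
    · have e : v.b₂ * c * (ϖ * κ * β) = v.b₂ * c * (v.b₁ * t' - a') := by rw [hβ]
      linear_combination t * v.b₂ * c * e + c * hi - c * v.n * hm + v.b₃ * hc +
        v.b₂ ^ 2 * c * v.b₁ * c * ht + v.b₂ ^ 2 * c * hc
    · linear_combination (t * v.n * c) * hβ + v.n * c * v.b₁ * ht + v.n * hc

/-- Local solution for `s = diag(ϖ, ϖ a)` with `ϖ ^ 2 = 0`. -/
theorem isLocalOrbit_diag_nilpotent {ϖ a n : R} (hϖ : ϖ ^ 2 = 0) {v : PluckerVec R}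
    (A : Matrix (Fin 2) (Fin 2) R) (hA : n * A.det = 1) (hm : v.m = 0) (hn : v.n = n)
    (h1 : v.b₁ = ϖ * (n * (A 0 0 ^ 2 + a * A 1 0 ^ 2)))
    (h2 : v.b₂ = ϖ * (n * (A 0 0 * A 0 1 + a * (A 1 0 * A 1 1))))
    (h3 : v.b₃ = ϖ * (n * (A 0 1 ^ 2 + a * A 1 1 ^ 2))) :
    IsLocalOrbit (diagonal ![ϖ, ϖ * a]) v := by
  refine ⟨A, 0, _, mul_transpose_eq_one_of_entries hA rfl, by simp, ?_⟩
  rw [Matrix.det_fin_two] at hA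
  ext <;> simp [plucker, Matrix.det_fin_two]
  · rw [hm]; linear_combination a * (A 0 0 * A 1 1 - A 0 1 * A 1 0) * hϖ
  · rw [h1]; ring
  · rw [h2]; ring
  · rw [h3]; ring
  · rw [hn]; linear_combination n * hA

end LocalOrbits

/-- Local orbits modulo coprime moduli glue by the Chinese remainder theorem. -/
theorem isLocalOrbit_mul {a b : ℕ} (hab : a.Coprime b) (s : IntMat) (v : PluckerVec ℤ)
    (ha : IsLocalOrbit (s.map (Int.cast : ℤ → ZMod a)) (v.map (Int.castRingHom (ZMod a))))
    (hb : IsLocalOrbit (s.map (Int.cast : ℤ → ZMod b)) (v.map (Int.castRingHom (ZMod b)))) :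
    IsLocalOrbit (s.map (Int.cast : ℤ → ZMod (a * b)))
      (v.map (Int.castRingHom (ZMod (a * b)))) := by
  set e := ZMod.chineseRemainder hab with he
  set f : ZMod (a * b) →+* ZMod a := (RingHom.fst _ _).comp e.toRingHom with hf
  set g : ZMod (a * b) →+* ZMod b := (RingHom.snd _ _).comp e.toRingHom with hg
  have hinj : ∀ x y : ZMod (a * b), f x = f y → g x = g y → x = y := fun x y h1 h2 =>
    e.injective (Prod.ext h1 h2)
  have hinjM : ∀ X Y : Matrix (Fin 2) (Fin 2) (ZMod (a * b)), X.map f = Y.map f →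
      X.map g = Y.map g → X = Y := fun X Y h1 h2 => by
    ext i j
    exact hinj _ _ (congrFun (congrFun h1 i) j) (congrFun (congrFun h2 i) j)
  have hlift : ∀ (X : Matrix (Fin 2) (Fin 2) (ZMod a)) (Y : Matrix (Fin 2) (Fin 2) (ZMod b)),
      ∃ Z : Matrix (Fin 2) (Fin 2) (ZMod (a * b)), Z.map f = X ∧ Z.map g = Y := fun X Y => by
    refine ⟨Matrix.of fun i j => e.symm (X i j, Y i j), ?_, ?_⟩ <;> ext i j <;> simp [hf, hg]
  obtain ⟨A₁, B₁, D₁, p1, p2, p3⟩ := ha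
  obtain ⟨A₂, B₂, D₂, r1, r2, r3⟩ := hb
  obtain ⟨A, rfl, rfl⟩ := hlift A₁ A₂
  obtain ⟨B, rfl, rfl⟩ := hlift B₁ B₂
  obtain ⟨D, rfl, rfl⟩ := hlift D₁ D₂
  have hsf : (s.map (Int.cast : ℤ → ZMod (a * b))).map f = s.map (Int.cast : ℤ → ZMod a) := by
    ext i j; simp
  have hsg : (s.map (Int.cast : ℤ → ZMod (a * b))).map g = s.map (Int.cast : ℤ → ZMod b) := by
    ext i j; simp
  refine ⟨A, B, D, hinjM _ _ ?_ ?_, hinjM _ _ ?_ ?_, ?_⟩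
  · rw [Matrix.map_mul, Matrix.transpose_map, p1, Matrix.map_one _ (map_zero _) (map_one _)]
  · rw [Matrix.map_mul, Matrix.transpose_map, r1, Matrix.map_one _ (map_zero _) (map_one _)]
  · rw [Matrix.map_mul, Matrix.map_mul, Matrix.transpose_map, p2, Matrix.transpose_map]
  · rw [Matrix.map_mul, Matrix.map_mul, Matrix.transpose_map, r2, Matrix.transpose_map]
  · set P := plucker (s.map (Int.cast : ℤ → ZMod (a * b)) * A)
      (s.map (Int.cast : ℤ → ZMod (a * b)) * B + D) with hP
    have e1 : P.map f = v.map (Int.castRingHom (ZMod a)) := by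
      rw [← p3, hP, ← plucker_map, Matrix.map_add _ (map_add f), Matrix.map_mul, Matrix.map_mul,
        hsf]
    have e2 : P.map g = v.map (Int.castRingHom (ZMod b)) := by
      rw [← r3, hP, ← plucker_map, Matrix.map_add _ (map_add g), Matrix.map_mul, Matrix.map_mul,
        hsg]
    simp only [PluckerVec.map, PluckerVec.mk.injEq] at e1 e2
    obtain ⟨x0, x1, x2, x3, x4⟩ := e1
    obtain ⟨y0, y1, y2, y3, y4⟩ := e2
    have key : ∀ (x : ZMod (a * b)) (z : ℤ), f x = (Int.castRingHom (ZMod a)) z →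
        g x = (Int.castRingHom (ZMod b)) z → x = (Int.castRingHom (ZMod (a * b))) z :=
      fun x z h1 h2 => hinj _ _ (by rw [h1]; exact (map_intCast f z).symm)
        (by rw [h2]; exact (map_intCast g z).symm)
    exact PluckerVec.ext (key _ _ x0 y0) (key _ _ x1 y1) (key _ _ x2 y2) (key _ _ x3 y3)
      (key _ _ x4 y4)

section FiniteField

variable {F : Type*} [Field F] [Fintype F] [DecidableEq F]

theorem exists_sq_add_mul_sq (hF : ringChar F ≠ 2) {a c : F} (ha : a ≠ 0) (hc : c ≠ 0) :
    ∃ x y : F, x ^ 2 + a * y ^ 2 = c := by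
  by_contra! hno
  have h := sum_conic hF ha (fun t => if t = c then 1 else 0)
  have h0 : ∀ x y : F, (if a * x ^ 2 + y ^ 2 = c then (1 : ℤ) else 0) = 0 := fun x y =>
    if_neg fun h => hno y x (by rw [add_comm]; exact h)
  simp only [h0, Finset.sum_const_zero, Finset.sum_ite_eq', Finset.mem_univ, if_true, mul_one,
    if_neg hc.symm, mul_zero, add_zero] at h
  have hcard : (1 : ℤ) < Fintype.card F := by exact_mod_cast Fintype.one_lt_card
  rcases quadraticChar_dichotomy (neg_ne_zero.2 ha) with h1 | h1 <;> rw [h1] at h <;> omega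

/-- Binary quadratic forms over a finite field of odd characteristic: a form of determinant `a` is
`n` times `diag(1, a)`, transformed by a matrix of determinant `1 / n`. -/
theorem exists_congruence_diag (hF : ringChar F ≠ 2) {n a b₁ b₂ b₃ : F} (hn : n ≠ 0) (ha : a ≠ 0)
    (h : b₁ * b₃ - b₂ ^ 2 = a) :
    ∃ p r s t : F, n * (p * t - s * r) = 1 ∧ n * (p ^ 2 + a * r ^ 2) = b₁ ∧
      n * (p * s + a * (r * t)) = b₂ ∧ n * (s ^ 2 + a * t ^ 2) = b₃ := by
  have main : ∀ b₁ b₂ b₃ : F, b₁ * b₃ - b₂ ^ 2 = a → b₁ ≠ 0 →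
      ∃ p r s t : F, n * (p * t - s * r) = 1 ∧ n * (p ^ 2 + a * r ^ 2) = b₁ ∧
      n * (p * s + a * (r * t)) = b₂ ∧ n * (s ^ 2 + a * t ^ 2) = b₃ := by
    intro b₁ b₂ b₃ h h1
    obtain ⟨p, r, hpr⟩ := exists_sq_add_mul_sq hF ha (div_ne_zero h1 hn)
    rw [eq_div_iff hn] at hpr
    refine ⟨p, r, (b₂ * p - a * r) / b₁, (p + b₂ * r) / b₁, ?_, ?_, ?_, ?_⟩
    · field_simp; linear_combination hpr
    · linear_combination hpr
    · field_simp; linear_combination b₂ * hpr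
    · field_simp; linear_combination (b₂ ^ 2 + a) * hpr - b₁ * h
  by_cases h1 : b₁ = 0
  · by_cases h3 : b₃ = 0
    · have h2 : b₂ ≠ 0 := by rintro rfl; apply ha; rw [← h, h1]; ring
      have hb : b₁ + 2 * b₂ + b₃ ≠ 0 := by
        rw [h1, h3, zero_add, add_zero]; exact mul_ne_zero (Ring.two_ne_zero hF) h2
      obtain ⟨p, r, s, t, e0, e1, e2, e3⟩ := main (b₁ + 2 * b₂ + b₃) (b₂ + b₃) b₃
        (by rw [← h]; ring) hb
      exact ⟨p - s, r - t, s, t, by linear_combination e0,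
        by linear_combination e1 - 2 * e2 + e3, by linear_combination e2 - e3, e3⟩
    · obtain ⟨p, r, s, t, e0, e1, e2, e3⟩ := main b₃ (-b₂) b₁ (by rw [← h]; ring) h3
      exact ⟨-s, -t, p, r, by linear_combination e0, by linear_combination e3,
        by linear_combination -e2, e1⟩
  · exact main b₁ b₂ b₃ h h1

end FiniteField

/-! ### The part of the coefficients away from `q` -/

section Types

variable {R : Type*} [CommRing R]

/-- The shape of the Plücker vectors in the local orbit of `(0 I)`; here and in the next two
definitions `d` is the determinant of the block `D`, up to squares. -/
def PluckerVec.RankZero (v : PluckerVec R) (d : R) : Prop :=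
  v.m = 0 ∧ v.b₁ = 0 ∧ v.b₂ = 0 ∧ v.b₃ = 0 ∧ v.n = d

/-- The shape of the Plücker vectors in the local orbit of `(diag(1, 0) I)`. -/
def PluckerVec.RankOne (v : PluckerVec R) (d : R) : Prop :=
  v.m = 0 ∧ ∃ r₁ r₂ x y : R, x * r₁ + y * r₂ = 1 ∧ v.b₁ = d * r₁ ^ 2 ∧ v.b₂ = d * (r₁ * r₂) ∧
    v.b₃ = d * r₂ ^ 2

/-- The shape of the Plücker vectors in the local orbit of `(I I)`. -/
def PluckerVec.RankTwo (v : PluckerVec R) (d : R) : Prop := ∃ e, v.m * e ^ 2 = d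

/-- Multiplication of a Plücker vector by a scalar. -/
def PluckerVec.scale (t : R) (v : PluckerVec R) : PluckerVec R :=
  ⟨t * v.m, t * v.b₁, t * v.b₂, t * v.b₃, t * v.n⟩

/-- The vector `(q² m, q b, n)`. -/
def PluckerVec.dilate (q : R) (v : PluckerVec R) : PluckerVec R :=
  ⟨q ^ 2 * v.m, q * v.b₁, q * v.b₂, q * v.b₃, v.n⟩

namespace PluckerVec

variable {v : PluckerVec R} {d d' : R}

theorem rankZero_plucker {A D : Matrix (Fin 2) (Fin 2) R} (B : Matrix (Fin 2) (Fin 2) R) :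
    (plucker (0 * A) (0 * B + D)).RankZero D.det := by
  simp [RankZero, plucker]

theorem rankOne_plucker {A D : Matrix (Fin 2) (Fin 2) R} (h : A * Dᵀ = 1)
    (B : Matrix (Fin 2) (Fin 2) R) :
    (plucker (diagonal ![1, 0] * A) (diagonal ![1, 0] * B + D)).RankOne D.det := by
  obtain ⟨h0, h1, h2, h3, h4⟩ := entries_of_mul_transpose_eq_one h
  refine ⟨by simp [plucker, Matrix.det_fin_two], A 0 0, A 0 1, A 1 1 * D.det, -A 1 0 * D.det,
    ?_, ?_, ?_, ?_⟩
  · rw [Matrix.det_fin_two A] at h0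
    linear_combination h0
  · simp [plucker]; rw [h4]; ring
  · simp [plucker]; rw [h4]; ring
  · simp [plucker]; rw [h3]; ring

theorem rankTwo_plucker {A D : Matrix (Fin 2) (Fin 2) R} (h : A * Dᵀ = 1)
    (B : Matrix (Fin 2) (Fin 2) R) :
    (plucker (1 * A) (1 * B + D)).RankTwo D.det := by
  obtain ⟨h0, -⟩ := entries_of_mul_transpose_eq_one h
  refine ⟨D.det, ?_⟩
  simp only [plucker, Matrix.one_mul]
  linear_combination D.det * h0

theorem RankZero.isLocalOrbit (h : v.RankZero d) (hd : IsUnit d) : IsLocalOrbit 0 v := by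
  obtain ⟨d', hd'⟩ := hd.exists_right_inv
  obtain ⟨h0, h1, h2, h3, h4⟩ := h
  have : v = ⟨0, 0, 0, 0, d⟩ := PluckerVec.ext h0 h1 h2 h3 h4
  rw [this]
  exact isLocalOrbit_zero hd'

theorem RankOne.isLocalOrbit (h : v.RankOne d) (hd : IsUnit d) :
    IsLocalOrbit (diagonal ![1, 0]) v := by
  obtain ⟨d', hd'⟩ := hd.exists_right_inv
  obtain ⟨h0, r₁, r₂, x, y, hr, h1, h2, h3⟩ := h
  have : v = ⟨0, d * r₁ ^ 2, d * (r₁ * r₂), d * r₂ ^ 2, v.n⟩ := PluckerVec.ext h0 h1 h2 h3 rfl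
  rw [this]
  exact isLocalOrbit_rank_one hr hd'

theorem RankTwo.isLocalOrbit (h : v.RankTwo d) (hd : IsUnit d) (hi : v.IsIsotropic) :
    IsLocalOrbit 1 v := by
  obtain ⟨d', hd'⟩ := hd.exists_right_inv
  obtain ⟨e, he⟩ := h
  exact isLocalOrbit_one hi (m' := e ^ 2 * d') (by linear_combination d' * he + hd')

theorem RankZero.isSquare (h : v.RankZero d) (h' : v.RankZero d') : IsSquare (d * d') :=
  ⟨v.n, by rw [← h.2.2.2.2, ← h'.2.2.2.2]⟩

theorem RankOne.isSquare (h : v.RankOne d) (h' : v.RankOne d') : IsSquare (d * d') := by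
  obtain ⟨-, r₁, r₂, x, y, hr, h1, h2, h3⟩ := h
  obtain ⟨-, r₁', r₂', -, -, -, h1', h2', h3'⟩ := h'
  refine ⟨d' * (x * r₁' + y * r₂'), ?_⟩
  rw [h1] at h1'
  rw [h2] at h2'
  rw [h3] at h3'
  linear_combination d' * x ^ 2 * h1' + 2 * d' * x * y * h2' + d' * y ^ 2 * h3' -
    d * d' * (x * r₁ + y * r₂ + 1) * hr

theorem RankTwo.isSquare (h : v.RankTwo d) (h' : v.RankTwo d') : IsSquare (d * d') := by
  obtain ⟨e, he⟩ := h
  obtain ⟨e', he'⟩ := h'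
  exact ⟨v.m * e * e', by rw [← he, ← he']; ring⟩

theorem RankZero.scale (h : v.RankZero d) (t : R) : (v.scale t).RankZero (t * d) := by
  obtain ⟨h0, h1, h2, h3, h4⟩ := h
  simp [RankZero, PluckerVec.scale, *]

theorem RankOne.scale (h : v.RankOne d) (t : R) : (v.scale t).RankOne (t * d) := by
  obtain ⟨h0, r₁, r₂, x, y, hr, h1, h2, h3⟩ := h
  exact ⟨by simp [PluckerVec.scale, h0], r₁, r₂, x, y, hr, by simp only [PluckerVec.scale]; rw [h1]; ring,
    by simp only [PluckerVec.scale]; rw [h2]; ring, by simp only [PluckerVec.scale]; rw [h3]; ring⟩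

theorem RankTwo.scale (h : v.RankTwo d) (t : R) : (v.scale t).RankTwo (t * d) := by
  obtain ⟨e, he⟩ := h
  exact ⟨e, by simp only [PluckerVec.scale]; rw [← he]; ring⟩

theorem rankZero_dilate_translate {q : R} (hq : IsUnit q) (t₁ t₂ t₃ : R) :
    ((v.translate t₁ t₂ t₃).dilate q).RankZero d ↔ (v.dilate q).RankZero d := by
  simp only [RankZero, dilate, translate, (hq.pow 2).mul_right_eq_zero, hq.mul_right_eq_zero]
  refine and_congr_right fun h0 => ?_
  simp only [h0, zero_mul, add_zero, sub_zero]
  refine and_congr_right fun h1 => and_congr_right fun h2 => and_congr_right fun h3 => ?_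
  simp [h1, h2, h3]

theorem rankOne_dilate_translate {q : R} (hq : IsUnit q) (t₁ t₂ t₃ : R) :
    ((v.translate t₁ t₂ t₃).dilate q).RankOne d ↔ (v.dilate q).RankOne d := by
  simp only [RankOne, dilate, translate, (hq.pow 2).mul_right_eq_zero]
  refine and_congr_right fun h0 => ?_
  simp only [h0, zero_mul, add_zero, sub_zero]

theorem rankTwo_dilate_translate (q t₁ t₂ t₃ : R) :
    ((v.translate t₁ t₂ t₃).dilate q).RankTwo d ↔ (v.dilate q).RankTwo d := Iff.rfl

end PluckerVec

end Types

/-- The Plücker vector `v` is in the orbit of the partition `(N₀, N₁, N₂)` modulo `N₀ N₁ N₂`, and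
`d` is the determinant of the block `D`, up to squares. -/
structure LocalDatum (N₀ N₁ N₂ : ℕ) (v : PluckerVec ℤ) (d : ℤ) : Prop where
  isCoprime : IsCoprime ((N₀ * N₁ * N₂ : ℕ) : ℤ) d
  rankZero : (v.map (Int.castRingHom (ZMod N₀))).RankZero (d : ZMod N₀)
  rankOne : (v.map (Int.castRingHom (ZMod N₁))).RankOne (d : ZMod N₁)
  rankTwo : (v.map (Int.castRingHom (ZMod N₂))).RankTwo (d : ZMod N₂)

section Away

variable {N₀ N₁ N₂ : ℕ} {v : PluckerVec ℤ} {d d' : ℤ}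

theorem isSquare_intCast_mul {a b : ℕ} (hab : a.Coprime b) {x : ℤ} (ha : IsSquare (x : ZMod a))
    (hb : IsSquare (x : ZMod b)) : IsSquare (x : ZMod (a * b)) := by
  obtain ⟨r, hr⟩ := ha
  obtain ⟨s, hs⟩ := hb
  refine ⟨(ZMod.chineseRemainder hab).symm (r, s), ?_⟩
  apply (ZMod.chineseRemainder hab).injective
  rw [map_mul, RingEquiv.apply_symm_apply, map_intCast]
  exact Prod.ext hr hs

/-- The integer `d` of a local datum of `v` is determined by `v` up to squares, so that `χ'(d)` is
determined by `v`. -/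
theorem LocalDatum.apply_eq (h01 : N₀.Coprime N₁) (h012 : (N₀ * N₁).Coprime N₂)
    {χ' : DirichletCharacter ℂ (N₀ * N₁ * N₂)} (hχ' : χ' ^ 2 = 1) (h : LocalDatum N₀ N₁ N₂ v d)
    (h' : LocalDatum N₀ N₁ N₂ v d') : χ' d = χ' d' := by
  have hu : IsUnit (d : ZMod (N₀ * N₁ * N₂)) := (ZMod.coe_int_isUnit_iff_isCoprime _ _).2 h.1
  have hu' : IsUnit (d' : ZMod (N₀ * N₁ * N₂)) := (ZMod.coe_int_isUnit_iff_isCoprime _ _).2 h'.1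
  have hsq : IsSquare ((d * d' : ℤ) : ZMod (N₀ * N₁ * N₂)) := by
    refine isSquare_intCast_mul h012 (isSquare_intCast_mul h01 ?_ ?_) ?_ <;> push_cast
    · exact h.2.isSquare h'.2
    · exact h.3.isSquare h'.3
    · exact h.4.isSquare h'.4
  have one : ∀ u : ZMod (N₀ * N₁ * N₂), IsUnit u → χ' u * χ' u = 1 := fun u hu => by
    rw [← MulChar.mul_apply, ← sq, hχ', MulChar.one_apply hu]
  obtain ⟨z, hz⟩ := hsq
  push_cast at hz
  have hz' : IsUnit z := isUnit_of_mul_isUnit_left (hz ▸ hu.mul hu')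
  have h1 : χ' d * χ' d' = 1 := by rw [← map_mul, hz, map_mul, one z hz']
  calc χ' d = χ' d * (χ' d' * χ' d') := by rw [one _ hu', mul_one]
    _ = χ' d' := by rw [← mul_assoc, h1, one_mul]

theorem LocalDatum.scale (h : LocalDatum N₀ N₁ N₂ v d) {t : ℤ}
    (ht : IsCoprime ((N₀ * N₁ * N₂ : ℕ) : ℤ) t) : LocalDatum N₀ N₁ N₂ (v.scale t) (t * d) := by
  have e : ∀ N : ℕ, (v.scale t).map (Int.castRingHom (ZMod N)) =
      (v.map (Int.castRingHom (ZMod N))).scale (t : ZMod N) := fun N => by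
    simp [PluckerVec.map, PluckerVec.scale]
  refine ⟨ht.mul_right h.1, ?_, ?_, ?_⟩ <;> rw [e, Int.cast_mul]
  · exact h.2.scale _
  · exact h.3.scale _
  · exact h.4.scale _

theorem LocalDatum.of_scale {t : ℤ} (h : LocalDatum N₀ N₁ N₂ (v.scale t) d)
    (ht : IsCoprime ((N₀ * N₁ * N₂ : ℕ) : ℤ) t) : ∃ d', LocalDatum N₀ N₁ N₂ v d' := by
  obtain ⟨x, t', hx⟩ := id ht
  have ht' : IsCoprime ((N₀ * N₁ * N₂ : ℕ) : ℤ) t' := ⟨x, t, by rw [← hx]; ring⟩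
  have h2 := h.scale ht'
  have e : ∀ N : ℕ, N ∣ N₀ * N₁ * N₂ → ((v.scale t).scale t').map (Int.castRingHom (ZMod N)) =
      v.map (Int.castRingHom (ZMod N)) := fun N hN => by
    have h0 : ((N₀ * N₁ * N₂ : ℕ) : ZMod N) = 0 := (ZMod.natCast_eq_zero_iff _ _).2 hN
    have h1 : (t' : ZMod N) * t = 1 := by
      have := congrArg (Int.cast : ℤ → ZMod N) hx
      rw [Int.cast_add, Int.cast_mul, Int.cast_natCast, h0, mul_zero, zero_add, Int.cast_mul,
        Int.cast_one] at this
      exact this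
    simp [PluckerVec.map, PluckerVec.scale, ← mul_assoc, h1]
  refine ⟨t' * d, h2.1, ?_, ?_, ?_⟩
  · rw [← e N₀ ⟨N₁ * N₂, by ring⟩]; exact h2.2
  · rw [← e N₁ ⟨N₀ * N₂, by ring⟩]; exact h2.3
  · rw [← e N₂ ⟨N₀ * N₁, by ring⟩]; exact h2.4

theorem localDatum_dilate_translate {q : ℤ} (hq : IsCoprime ((N₀ * N₁ * N₂ : ℕ) : ℤ) q)
    (t₁ t₂ t₃ : ℤ) : LocalDatum N₀ N₁ N₂ ((v.translate t₁ t₂ t₃).dilate q) d ↔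
      LocalDatum N₀ N₁ N₂ (v.dilate q) d := by
  have e : ∀ N : ℕ, ((v.translate t₁ t₂ t₃).dilate q).map (Int.castRingHom (ZMod N)) =
      ((v.map (Int.castRingHom (ZMod N))).translate (t₁ : ZMod N) (t₂ : ZMod N) (t₃ : ZMod N)).dilate
        (q : ZMod N) := fun N => by
    simp [PluckerVec.map, PluckerVec.dilate, PluckerVec.translate]
  have e' : ∀ N : ℕ, (v.dilate q).map (Int.castRingHom (ZMod N)) =
      (v.map (Int.castRingHom (ZMod N))).dilate (q : ZMod N) := fun N => by
    simp [PluckerVec.map, PluckerVec.dilate]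
  have hu : ∀ N : ℕ, N ∣ N₀ * N₁ * N₂ → IsUnit (q : ZMod N) := fun N hN =>
    (ZMod.coe_int_isUnit_iff_isCoprime _ _).2
      (hq.of_isCoprime_of_dvd_left (Int.natCast_dvd_natCast.2 hN))
  have r0 := fun d : ZMod N₀ => PluckerVec.rankZero_dilate_translate
    (v := v.map (Int.castRingHom (ZMod N₀))) (d := d) (hu N₀ ⟨N₁ * N₂, by ring⟩) t₁ t₂ t₃
  have r1 := fun d : ZMod N₁ => PluckerVec.rankOne_dilate_translate
    (v := v.map (Int.castRingHom (ZMod N₁))) (d := d) (hu N₁ ⟨N₀ * N₂, by ring⟩) t₁ t₂ t₃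
  have r2 := fun d : ZMod N₂ => PluckerVec.rankTwo_dilate_translate
    (v := v.map (Int.castRingHom (ZMod N₂))) (d := d) (q : ZMod N₂) t₁ t₂ t₃
  constructor
  · rintro ⟨h1, h2, h3, h4⟩
    rw [e] at h2 h3 h4
    refine ⟨h1, ?_, ?_, ?_⟩ <;> rw [e']
    · exact (r0 _).1 h2
    · exact (r1 _).1 h3
    · exact (r2 _).1 h4
  · rintro ⟨h1, h2, h3, h4⟩
    rw [e'] at h2 h3 h4
    refine ⟨h1, ?_, ?_, ?_⟩ <;> rw [e]
    · exact (r0 _).2 h2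
    · exact (r1 _).2 h3
    · exact (r2 _).2 h4

open Classical in
/-- The prime-to-`q` part of the coefficients of the Eisenstein series: `χ'(det D)` on the vectors
in the orbit of the partition modulo `N₀ N₁ N₂`, and `0` elsewhere. -/
def awayCoeff (χ' : DirichletCharacter ℂ (N₀ * N₁ * N₂)) (v : PluckerVec ℤ) : ℂ :=
  if h : ∃ d, LocalDatum N₀ N₁ N₂ v d then χ' (h.choose : ℤ) else 0

variable {χ' : DirichletCharacter ℂ (N₀ * N₁ * N₂)}

theorem awayCoeff_eq (h01 : N₀.Coprime N₁) (h012 : (N₀ * N₁).Coprime N₂) (hχ' : χ' ^ 2 = 1)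
    (h : LocalDatum N₀ N₁ N₂ v d) : awayCoeff χ' v = χ' d := by
  have hex : ∃ d, LocalDatum N₀ N₁ N₂ v d := ⟨d, h⟩
  rw [awayCoeff, dif_pos hex]
  exact hex.choose_spec.apply_eq h01 h012 hχ' h

theorem exists_localDatum_of_awayCoeff_ne_zero (h : awayCoeff χ' v ≠ 0) :
    ∃ d, LocalDatum N₀ N₁ N₂ v d := by
  by_contra hne
  exact h (dif_neg hne)

theorem norm_awayCoeff_le_one : ‖awayCoeff χ' v‖ ≤ 1 := by
  rw [awayCoeff]
  split
  · exact DirichletCharacter.norm_le_one _ _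
  · simp

theorem awayCoeff_scale (h01 : N₀.Coprime N₁) (h012 : (N₀ * N₁).Coprime N₂) (hχ' : χ' ^ 2 = 1)
    {t : ℤ} (ht : IsCoprime ((N₀ * N₁ * N₂ : ℕ) : ℤ) t) :
    awayCoeff χ' (v.scale t) = χ' t * awayCoeff χ' v := by
  by_cases hex : ∃ d, LocalDatum N₀ N₁ N₂ v d
  · obtain ⟨d, hd⟩ := hex
    rw [awayCoeff_eq h01 h012 hχ' hd, awayCoeff_eq h01 h012 hχ' (hd.scale ht), Int.cast_mul,
      map_mul]
  · have hex' : ¬∃ d, LocalDatum N₀ N₁ N₂ (v.scale t) d := fun ⟨d, hd⟩ => hex (hd.of_scale ht)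
    rw [awayCoeff, awayCoeff, dif_neg hex, dif_neg hex', mul_zero]

/-- As `q` is invertible modulo `N₀ N₁ N₂`, integral translations of `(m, b, n)` act on
`(q² m, q b, n)` modulo `N₀ N₁ N₂` as translations do, and do not change the local orbit. -/
theorem awayCoeff_dilate_translate {q : ℤ} (hq : IsCoprime ((N₀ * N₁ * N₂ : ℕ) : ℤ) q)
    (t₁ t₂ t₃ : ℤ) :
    awayCoeff χ' ((v.translate t₁ t₂ t₃).dilate q) = awayCoeff χ' (v.dilate q) := by
  have h : LocalDatum N₀ N₁ N₂ ((v.translate t₁ t₂ t₃).dilate q) =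
      LocalDatum N₀ N₁ N₂ (v.dilate q) :=
    funext fun d => propext (localDatum_dilate_translate hq t₁ t₂ t₃)
  unfold awayCoeff
  rw [h]

end Away

/-! ### The orbits of the partition matrices -/

section Reduction

/-- The orbit of `(M₀ I)` under `Γ₀(L)`, reduced modulo a divisor `N` of `L`. -/
theorem plucker_pairMul_map {L N : ℕ} (hN : N ∣ L) (M₀ : IntMat) {γ : symplecticGroup (Fin 2) ℤ}
    (hγ : γ ∈ Gamma0 L) :
    let g : Matrix (Fin 2 ⊕ Fin 2) (Fin 2 ⊕ Fin 2) ℤ := γ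
    let A := g.toBlocks₁₁.map (Int.cast : ℤ → ZMod N)
    let B := g.toBlocks₁₂.map (Int.cast : ℤ → ZMod N)
    let D := g.toBlocks₂₂.map (Int.cast : ℤ → ZMod N)
    let s := M₀.map (Int.cast : ℤ → ZMod N)
    A * Dᵀ = 1 ∧ D.det = (g.toBlocks₂₂.det : ℤ) ∧ A.det = (g.toBlocks₁₁.det : ℤ) ∧
      (pairMul (M₀, 1) γ).1.map (Int.cast : ℤ → ZMod N) = s * A ∧
      (pairMul (M₀, 1) γ).2.map (Int.cast : ℤ → ZMod N) = s * B + D ∧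
      (plucker (pairMul (M₀, 1) γ).1 (pairMul (M₀, 1) γ).2).map (Int.castRingHom (ZMod N)) =
        plucker (s * A) (s * B + D) := by
  intro g A B D s
  obtain ⟨h1, h2, h3⟩ := toBlocks_of_mem_symplecticGroup γ.2
  have hC : g.toBlocks₂₁.map (Int.cast : ℤ → ZMod N) = 0 := by
    ext i j
    rw [Matrix.map_apply, Matrix.zero_apply, ZMod.intCast_zmod_eq_zero_iff_dvd]
    exact (Int.natCast_dvd_natCast.2 hN).trans (hγ i j)
  have hdet : ∀ X : IntMat, (X.map (Int.cast : ℤ → ZMod N)).det = ((X.det : ℤ) : ZMod N) :=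
    fun X => (Int.cast_det X).symm
  have hM : (pairMul (M₀, 1) γ).1.map (Int.cast : ℤ → ZMod N) = s * A := by
    change (M₀ * g.toBlocks₁₁ + 1 * g.toBlocks₂₁).map (Int.cast : ℤ → ZMod N) = _
    rw [map_intCast_add, Matrix.one_mul, hC, add_zero, map_intCast_mul]
  have hN : (pairMul (M₀, 1) γ).2.map (Int.cast : ℤ → ZMod N) = s * B + D := by
    change (M₀ * g.toBlocks₁₂ + 1 * g.toBlocks₂₂).map (Int.cast : ℤ → ZMod N) = _
    rw [map_intCast_add, Matrix.one_mul, map_intCast_mul]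
  refine ⟨?_, hdet _, hdet _, hM, hN, ?_⟩
  · have h4 : (g.toBlocks₁₁ * g.toBlocks₂₂ᵀ).map (Int.cast : ℤ → ZMod N) =
        (1 + g.toBlocks₁₂ * g.toBlocks₂₁ᵀ).map (Int.cast : ℤ → ZMod N) := by
      congr 1
      rw [← h3]; exact (sub_add_cancel _ _).symm
    rw [map_intCast_mul, map_intCast_add, map_intCast_mul, Matrix.transpose_map,
      Matrix.transpose_map, hC, transpose_zero, Matrix.mul_zero, add_zero] at h4
    rw [h4]
    exact Matrix.map_one _ Int.cast_zero Int.cast_one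
  · rw [← plucker_map, ← hM, ← hN]; rfl

theorem map_eq_of_matCong {N : ℕ} {M S : IntMat} (h : MatCong N M S) :
    M.map (Int.cast : ℤ → ZMod N) = S.map (Int.cast : ℤ → ZMod N) := by
  ext i j
  exact (ZMod.intCast_eq_intCast_iff _ _ _).2 (h i j)

theorem matCong_of_prime {N : ℕ} (hN : Squarefree N) {M S : IntMat}
    (h : ∀ p : ℕ, p.Prime → p ∣ N → MatCong p M S) : MatCong N M S := by
  intro i j
  rw [Int.modEq_iff_dvd, Int.natCast_dvd, ← Nat.prod_primeFactors_of_squarefree hN]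
  refine Finset.prod_primes_dvd _ (fun p hp => (Nat.prime_of_mem_primeFactors hp).prime)
    fun p hp => ?_
  rw [← Int.natCast_dvd, ← Int.modEq_iff_dvd]
  exact h p (Nat.prime_of_mem_primeFactors hp) (Nat.dvd_of_mem_primeFactors hp) i j

theorem IsPartitionMatrix.transpose_eq {N₀ N₁ N₂ : ℕ} {M : IntMat}
    (h : IsPartitionMatrix N₀ N₁ N₂ M) : Mᵀ = M := by
  ext i j
  by_cases hij : i = j
  · rw [hij]; rfl
  · rw [transpose_apply, h.1 hij, h.1 (Ne.symm hij)]

variable {N₀ N₁ N₂ : ℕ} {M₀ : IntMat}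

theorem IsPartitionMatrix.map_eq (hsf : Squarefree (N₀ * N₁ * N₂))
    (h : IsPartitionMatrix N₀ N₁ N₂ M₀) :
    M₀.map (Int.cast : ℤ → ZMod N₀) = 0 ∧ M₀.map (Int.cast : ℤ → ZMod N₁) = diagonal ![1, 0] ∧
      M₀.map (Int.cast : ℤ → ZMod N₂) = 1 := by
  obtain ⟨-, hs01, hs2⟩ := Nat.squarefree_mul_iff.1 hsf
  obtain ⟨-, hs0, hs1⟩ := Nat.squarefree_mul_iff.1 hs01
  refine ⟨?_, ?_, ?_⟩
  · rw [map_eq_of_matCong (matCong_of_prime hs0 h.2.1)]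
    ext i j; simp
  · rw [map_eq_of_matCong (matCong_of_prime hs1 h.2.2.1)]
    ext i j; fin_cases i <;> fin_cases j <;> simp
  · rw [map_eq_of_matCong (matCong_of_prime hs2 h.2.2.2)]
    exact Matrix.map_one _ Int.cast_zero Int.cast_one

theorem isCoprime_det_of_mem_Gamma0 {L : ℕ} {γ : symplecticGroup (Fin 2) ℤ} (hγ : γ ∈ Gamma0 L) :
    IsCoprime (L : ℤ)
      (γ : Matrix (Fin 2 ⊕ Fin 2) (Fin 2 ⊕ Fin 2) ℤ).toBlocks₂₂.det := by
  obtain ⟨h1, h2, -⟩ := plucker_pairMul_map dvd_rfl 1 hγ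
  rw [← ZMod.coe_int_isUnit_iff_isCoprime, ← h2]
  exact isUnit_of_mul_isUnit_right ((entries_of_mul_transpose_eq_one h1).1 ▸ isUnit_one)

theorem localDatum_pairMul {L : ℕ} (hL : N₀ * N₁ * N₂ ∣ L) (hsf : Squarefree (N₀ * N₁ * N₂))
    (h : IsPartitionMatrix N₀ N₁ N₂ M₀) {γ : symplecticGroup (Fin 2) ℤ} (hγ : γ ∈ Gamma0 L) :
    LocalDatum N₀ N₁ N₂ (plucker (pairMul (M₀, 1) γ).1 (pairMul (M₀, 1) γ).2)
      (γ : Matrix (Fin 2 ⊕ Fin 2) (Fin 2 ⊕ Fin 2) ℤ).toBlocks₂₂.det := by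
  obtain ⟨e0, e1, e2⟩ := h.map_eq hsf
  refine ⟨(isCoprime_det_of_mem_Gamma0 hγ).of_isCoprime_of_dvd_left
    (Int.natCast_dvd_natCast.2 hL), ?_, ?_, ?_⟩
  · obtain ⟨h1, h2, -, -, -, h4⟩ := plucker_pairMul_map (N := N₀)
      (dvd_trans ⟨N₁ * N₂, by ring⟩ hL) M₀ hγ
    rw [h4, ← h2, e0]
    exact PluckerVec.rankZero_plucker _
  · obtain ⟨h1, h2, -, -, -, h4⟩ := plucker_pairMul_map (N := N₁)
      (dvd_trans ⟨N₀ * N₂, by ring⟩ hL) M₀ hγ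
    rw [h4, ← h2, e1]
    exact PluckerVec.rankOne_plucker h1 _
  · obtain ⟨h1, h2, -, -, -, h4⟩ := plucker_pairMul_map (N := N₂)
      (dvd_trans ⟨N₀ * N₁, by ring⟩ hL) M₀ hγ
    rw [h4, ← h2, e2]
    exact PluckerVec.rankTwo_plucker h1 _

theorem PluckerVec.IsIsotropic.map {R S : Type*} [CommRing R] [CommRing S] {v : PluckerVec R}
    (hv : v.IsIsotropic) (f : R →+* S) : (v.map f).IsIsotropic := by
  rw [PluckerVec.IsIsotropic] at hv
  simp only [PluckerVec.IsIsotropic, PluckerVec.map, ← map_mul, ← map_pow, ← map_sub, hv]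

theorem LocalDatum.isLocalOrbit (hsf : Squarefree (N₀ * N₁ * N₂))
    (h : IsPartitionMatrix N₀ N₁ N₂ M₀) {v : PluckerVec ℤ} {d : ℤ}
    (hd : LocalDatum N₀ N₁ N₂ v d) (hi : v.IsIsotropic) :
    IsLocalOrbit (M₀.map (Int.cast : ℤ → ZMod (N₀ * N₁ * N₂)))
      (v.map (Int.castRingHom (ZMod (N₀ * N₁ * N₂)))) := by
  obtain ⟨e0, e1, e2⟩ := h.map_eq hsf
  obtain ⟨h012, hs01, -⟩ := Nat.squarefree_mul_iff.1 hsf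
  obtain ⟨h01, -, -⟩ := Nat.squarefree_mul_iff.1 hs01
  have hu : ∀ N : ℕ, N ∣ N₀ * N₁ * N₂ → IsUnit (d : ZMod N) := fun N hN =>
    (ZMod.coe_int_isUnit_iff_isCoprime _ _).2
      (hd.1.of_isCoprime_of_dvd_left (Int.natCast_dvd_natCast.2 hN))
  refine isLocalOrbit_mul h012 _ _ (isLocalOrbit_mul h01 _ _ ?_ ?_) ?_
  · rw [e0]; exact hd.2.isLocalOrbit (hu _ ⟨N₁ * N₂, by ring⟩)
  · rw [e1]; exact hd.3.isLocalOrbit (hu _ ⟨N₀ * N₂, by ring⟩)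
  · rw [e2]; exact hd.4.isLocalOrbit (hu _ ⟨N₀ * N₁, by ring⟩) (hi.map _)

end Reduction

section Residues

theorem quadraticChar_eq_of_mul_eq_one {F : Type*} [Field F] [Fintype F] [DecidableEq F] {a b : F}
    (h : a * b = 1) : quadraticChar F a = quadraticChar F b := by
  have hb : b ≠ 0 := right_ne_zero_of_mul_eq_one h
  calc quadraticChar F a = quadraticChar F a * quadraticChar F b ^ 2 := by
        rw [quadraticChar_sq_one hb, mul_one]
    _ = quadraticChar F (a * b) * quadraticChar F b := by rw [map_mul]; ring
    _ = quadraticChar F b := by rw [h, map_one, one_mul]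

variable {q : ℕ} [Fact q.Prime]

theorem exists_mul_eq_one_of_not_dvd {x : ℤ} (hx : ¬(q : ℤ) ∣ x) :
    ∃ y : ZMod (q ^ 2), (x : ZMod (q ^ 2)) * y = 1 := by
  have hp := Nat.prime_iff_prime_int.1 (Fact.out : q.Prime)
  have hc : IsCoprime ((q ^ 2 : ℕ) : ℤ) x := by
    push_cast
    exact IsCoprime.pow_left ((hp.coprime_iff_not_dvd).2 hx)
  exact ((ZMod.coe_int_isUnit_iff_isCoprime _ _).2 hc).exists_right_inv

/-- A congruence modulo `q` becomes one modulo `q²` after multiplication by `q`. -/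
theorem natCast_mul_intCast_eq {x y : ℤ} (h : (x : ZMod q) = y) :
    (q : ZMod (q ^ 2)) * x = q * y := by
  have h1 : (q : ℤ) ∣ y - x := (ZMod.intCast_eq_intCast_iff_dvd_sub _ _ _).1 h
  have h2 : ((q ^ 2 : ℕ) : ℤ) ∣ q * y - q * x := by
    rw [← mul_sub, Nat.cast_pow, sq]; exact mul_dvd_mul_left _ h1
  have h3 := (ZMod.intCast_eq_intCast_iff_dvd_sub _ _ _).2 h2
  push_cast at h3
  exact h3

theorem exists_eq_mul_of_intCast_eq {z x : ℤ} (h : (z : ZMod (q ^ 2)) = q * x) :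
    ∃ y : ℤ, z = q * y ∧ (y : ZMod q) = x := by
  have h1 : ((z : ℤ) : ZMod (q ^ 2)) = ((q * x : ℤ) : ZMod (q ^ 2)) := by rw [h]; push_cast; rfl
  obtain ⟨c, hc⟩ := (ZMod.intCast_eq_intCast_iff_dvd_sub _ _ _).1 h1
  refine ⟨x - q * c, ?_, by simp⟩
  push_cast at hc
  linear_combination -hc

/-- The local orbit of `diag(1, q κ)` modulo `q²`. -/
theorem isLocalOrbit_diag_one_of_legendreSym {v : PluckerVec ℤ} (hi : v.IsIsotropic) {κ m₁ : ℤ}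
    (hm : v.m = q * m₁) (h : legendreSym q (v.b₁ * m₁ * κ) = 1) :
    IsLocalOrbit (diagonal ![1, (q : ZMod (q ^ 2)) * κ])
      (v.map (Int.castRingHom (ZMod (q ^ 2)))) := by
  have hne : ((v.b₁ * m₁ * κ : ℤ) : ZMod q) ≠ 0 := fun h0 => by
    rw [(legendreSym.eq_zero_iff q _).2 h0] at h; exact zero_ne_one h
  obtain ⟨s, hs⟩ := (legendreSym.eq_one_iff q hne).1 h
  obtain ⟨s, rfl⟩ := ZMod.intCast_surjective s
  have hs0 : ¬(q : ℤ) ∣ s := fun hd => hne (by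
    rw [hs, (ZMod.intCast_zmod_eq_zero_iff_dvd _ _).2 hd, mul_zero])
  have hd0 : ¬(q : ℤ) ∣ v.b₁ * m₁ * κ := fun hd =>
    hne ((ZMod.intCast_zmod_eq_zero_iff_dvd _ _).2 hd)
  obtain ⟨b', hb'⟩ := exists_mul_eq_one_of_not_dvd (q := q) (x := v.b₁)
    fun hd => hd0 ((hd.mul_right _).mul_right _)
  obtain ⟨m', hm'⟩ := exists_mul_eq_one_of_not_dvd (q := q) (x := m₁)
    fun hd => hd0 ((hd.mul_left _).mul_right _)
  obtain ⟨κ', hκ'⟩ := exists_mul_eq_one_of_not_dvd (q := q) (x := κ) fun hd => hd0 (hd.mul_left _)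
  obtain ⟨s', hs'⟩ := exists_mul_eq_one_of_not_dvd hs0
  rw [← Int.cast_mul] at hs
  obtain ⟨w, hw⟩ := (ZMod.intCast_eq_intCast_iff_dvd_sub _ _ _).1 hs
  have hw' := congrArg (Int.cast : ℤ → ZMod (q ^ 2)) hw
  push_cast at hw'
  -- with `s² = b₁ m₁ κ` modulo `q`, the choice `t = s / κ` makes `b₁ / t - 1 / a` divisible by `q`
  refine isLocalOrbit_diag_one (hi.map _) (β := -(κ' * m' * s' * w)) (t := s * κ') (t' := κ * s')
    (a := m₁ * s') (a' := m' * s) (c := b') ?_ ?_ hb' ?_ ?_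
  · linear_combination s * s' * hκ' + hs'
  · linear_combination s * s' * hm' + hs'
  · simp only [PluckerVec.map, eq_intCast, hm]
    push_cast
    linear_combination (-(q : ZMod (q ^ 2)) * m₁ * s * s') * hκ' - (q : ZMod (q ^ 2)) * m₁ * hs'
  · simp only [PluckerVec.map, eq_intCast]
    linear_combination (κ * κ' * m' * s') * hw' + (v.b₁ * κ * s' * m₁ * m' - m' * s * s * s') * hκ' +
      v.b₁ * κ * s' * hm' - m' * s * hs'

/-- The local orbit of `diag(q, q a)` modulo `q²`. -/
theorem isLocalOrbit_diag_q {v : PluckerVec ℤ} (hq2 : q ≠ 2) (hi : v.IsIsotropic)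
    (hm : (q : ℤ) ^ 2 ∣ v.m) (h1 : (q : ℤ) ∣ v.b₁) (h2 : (q : ℤ) ∣ v.b₂) (h3 : (q : ℤ) ∣ v.b₃) {a : ℤ}
    (ha : (a : ZMod q) ≠ 0) (h : ((v.n * (v.m / q ^ 2) : ℤ) : ZMod q) = a) :
    IsLocalOrbit (diagonal ![(q : ZMod (q ^ 2)), (q : ZMod (q ^ 2)) * a])
      (v.map (Int.castRingHom (ZMod (q ^ 2)))) := by
  have hq0 : (q : ℤ) ≠ 0 := Int.natCast_ne_zero.2 (Fact.out : q.Prime).ne_zero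
  obtain ⟨m', hm'⟩ := hm
  obtain ⟨b₁, h1⟩ := h1
  obtain ⟨b₂, h2⟩ := h2
  obtain ⟨b₃, h3⟩ := h3
  rw [hm', Int.mul_ediv_cancel_left _ (pow_ne_zero 2 hq0)] at h
  have hdet : b₁ * b₃ - b₂ ^ 2 = v.n * m' := by
    rw [PluckerVec.IsIsotropic, hm', h1, h2, h3] at hi
    refine mul_left_cancel₀ (pow_ne_zero 2 hq0) ?_
    linear_combination -hi
  have hn : (v.n : ZMod q) ≠ 0 := fun h0 => ha (by rw [← h, Int.cast_mul, h0, zero_mul])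
  have hdet' : (b₁ : ZMod q) * b₃ - (b₂ : ZMod q) ^ 2 = a := by
    rw [← h, ← hdet]; push_cast; rfl
  have hchar : ringChar (ZMod q) ≠ 2 := by rwa [ZMod.ringChar_zmod_n]
  -- `b / q` and `n diag(1, a)` have the same determinant modulo `q`, up to squares
  obtain ⟨p, r, s, t, e0, e1, e2, e3⟩ := exists_congruence_diag hchar hn ha hdet'
  obtain ⟨p, rfl⟩ := ZMod.intCast_surjective p
  obtain ⟨r, rfl⟩ := ZMod.intCast_surjective r
  obtain ⟨s, rfl⟩ := ZMod.intCast_surjective s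
  obtain ⟨t, rfl⟩ := ZMod.intCast_surjective t
  have hu0 : ¬(q : ℤ) ∣ v.n * (p * t - s * r) := fun hd => by
    rw [← ZMod.intCast_zmod_eq_zero_iff_dvd] at hd
    push_cast at hd
    rw [e0] at hd
    exact one_ne_zero hd
  obtain ⟨u', hu'⟩ := exists_mul_eq_one_of_not_dvd hu0
  obtain ⟨u', rfl⟩ := ZMod.intCast_surjective u'
  -- the correction factor `u'` is congruent to `1` modulo `q`
  have hu1 : (u' : ZMod q) = 1 := by
    have h5 := congrArg (ZMod.castHom (Dvd.intro_left q (sq q).symm : q ∣ q ^ 2) (ZMod q)) hu'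
    simp only [map_mul, map_intCast, map_one] at h5
    push_cast at h5
    rw [e0, one_mul] at h5
    exact h5
  push_cast at hu'
  refine isLocalOrbit_diag_nilpotent (n := (v.n : ZMod (q ^ 2))) ?_ !![(p : ZMod (q ^ 2)), s * u'; r, t * u'] ?_ ?_
    rfl ?_ ?_ ?_
  · exact_mod_cast ZMod.natCast_self (q ^ 2)
  · simp only [Matrix.det_fin_two_of]
    linear_combination hu'
  · simp only [PluckerVec.map, eq_intCast, hm']
    have : ((q ^ 2 : ℕ) : ZMod (q ^ 2)) = 0 := ZMod.natCast_self _
    push_cast at this ⊢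
    rw [this, zero_mul]
  · have := natCast_mul_intCast_eq (q := q) (x := b₁) (y := v.n * (p ^ 2 + a * r ^ 2))
      (by push_cast; exact e1.symm)
    simp only [PluckerVec.map, eq_intCast, h1]
    push_cast at this ⊢
    simpa using this
  · have := natCast_mul_intCast_eq (q := q) (x := b₂)
      (y := v.n * (p * (s * u') + a * (r * (t * u'))))
      (by push_cast; rw [hu1, mul_one, mul_one]; exact e2.symm)
    simp only [PluckerVec.map, eq_intCast, h2]
    push_cast at this ⊢
    simpa using this
  · have := natCast_mul_intCast_eq (q := q) (x := b₃)
      (y := v.n * ((s * u') ^ 2 + a * (t * u') ^ 2))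
      (by push_cast; rw [hu1, mul_one, mul_one]; exact e3.symm)
    simp only [PluckerVec.map, eq_intCast, h3]
    push_cast at this ⊢
    simpa using this

end Residues

/-! ### The coefficients of the three kinds of Eisenstein series -/

section Coefficients

variable {N₀ N₁ N₂ : ℕ} (q : ℕ) [Fact q.Prime] (χ' : DirichletCharacter ℂ (N₀ * N₁ * N₂))

open Classical in
/-- The coefficients of `𝔼₂`. -/
def coeff₂ (v : PluckerVec ℤ) : ℂ :=
  if v.IsIsotropic ∧ v.IsPrimitive then (legendreSym q v.m : ℂ) * awayCoeff χ' v else 0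

open Classical in
/-- The coefficients of `𝔼_{1,2,μ}`. Modulo `q` the matrix `(b₁ b₂; b₂ b₃)` has rank one; `b₁`, or
`b₃` if `q ∣ b₁`, represents its class modulo squares. The
quotient `m / q` is exact where it matters. -/
def coeff₁₂ (μ : ℤˣ) (v : PluckerVec ℤ) : ℂ :=
  if v.IsIsotropic ∧ v.IsPrimitive ∧ (q : ℤ) ∣ v.m ∧
      legendreSym q (v.m / q) * legendreSym q (if (q : ℤ) ∣ v.b₁ then v.b₃ else v.b₁) = μ then
    ((μ : ℤ) : ℂ) * (legendreSym q (v.m / q) : ℂ) * awayCoeff χ' v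
  else 0

open Classical in
/-- The coefficients of `𝔼_{0,2,α}`; the quotient `m / q²` is exact where it matters. -/
def coeff₀₂ (α : (ZMod q)ˣ) (v : PluckerVec ℤ) : ℂ :=
  if v.IsIsotropic ∧ v.IsPrimitive ∧ (q : ℤ) ^ 2 ∣ v.m ∧ (q : ℤ) ∣ v.b₁ ∧ (q : ℤ) ∣ v.b₂ ∧
      (q : ℤ) ∣ v.b₃ ∧ ((v.n * (v.m / q ^ 2) : ℤ) : ZMod q) = α then
    (legendreSym q v.n : ℂ) * awayCoeff χ' v
  else 0

variable {q} {χ'} {𝒩 : ℕ} {χ : DirichletCharacter ℂ 𝒩} {M₀ : IntMat}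

theorem isCoefficient_coeff₂ (hsf : Squarefree (q * (N₀ * N₁ * N₂))) (hχ' : χ' ^ 2 = 1)
    (hχ : ∀ d : ℤ, IsCoprime ((q * (N₀ * N₁ * N₂) : ℕ) : ℤ) d →
      conj (χ d) = (legendreSym q d : ℂ) * χ' d)
    {L : ℕ} (hL : L = q * (N₀ * N₁ * N₂))
    (hM : IsPartitionMatrix N₀ N₁ N₂ M₀) (hMq : MatCong q M₀ 1) :
    IsCoefficient χ L M₀ (coeff₂ q χ') := by
  subst hL
  obtain ⟨hq, -, hsf'⟩ := Nat.squarefree_mul_iff.1 hsf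
  obtain ⟨h012, hs01, -⟩ := Nat.squarefree_mul_iff.1 hsf'
  obtain ⟨h01, -, -⟩ := Nat.squarefree_mul_iff.1 hs01
  have hMq' : M₀.map (Int.cast : ℤ → ZMod q) = 1 := by
    rw [map_eq_of_matCong hMq]; exact Matrix.map_one _ Int.cast_zero Int.cast_one
  refine ⟨fun γ hγ => ?_, fun v hv => ?_, fun v hv => ?_, fun v hv => ?_⟩
  · obtain ⟨h1, h2⟩ := pairMul_symm_and_isPrimitive hM.transpose_eq γ
    rw [coeff₂, if_pos ⟨plucker_isIsotropic h1, h2⟩, hχ _ (isCoprime_det_of_mem_Gamma0 hγ),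
      awayCoeff_eq h01 h012 hχ' (localDatum_pairMul ⟨q, mul_comm _ _⟩ hsf' hM hγ)]
    congr 2
    obtain ⟨k1, k2, -, -, -, k4⟩ := plucker_pairMul_map (N := q) ⟨_, rfl⟩ M₀ hγ
    obtain ⟨k0, -⟩ := entries_of_mul_transpose_eq_one k1
    have k5 := congrArg PluckerVec.m k4
    rw [hMq', Matrix.one_mul] at k5
    have k6 : ((plucker (pairMul (M₀, 1) γ).1 (pairMul (M₀, 1) γ).2).m : ZMod q) = _ := k5
    rw [legendreSym, legendreSym, k6, ← k2]
    exact quadraticChar_eq_of_mul_eq_one k0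
  · by_contra h; exact hv (if_neg fun h' => h h'.1)
  · by_contra h; exact hv (if_neg fun h' => h h'.2)
  · have hi : v.IsIsotropic := by by_contra h; exact hv (if_neg fun h' => h h'.1)
    have hp : v.IsPrimitive := by by_contra h; exact hv (if_neg fun h' => h h'.2)
    have hv' := hv
    rw [coeff₂, if_pos ⟨hi, hp⟩] at hv'
    obtain ⟨d, hd⟩ := exists_localDatum_of_awayCoeff_ne_zero (right_ne_zero_of_mul hv')
    refine isLocalOrbit_mul hq _ _ ?_ (hd.isLocalOrbit hsf' hM hi)
    have hm : (v.m : ZMod q) ≠ 0 := fun h => by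
      apply left_ne_zero_of_mul hv'
      rw [(legendreSym.eq_zero_iff q v.m).2 h, Int.cast_zero]
    rw [hMq']
    exact isLocalOrbit_one (hi.map _) (m' := (v.m : ZMod q)⁻¹) (mul_inv_cancel₀ hm)

/-- If `b = d r rᵀ` modulo `q` with `r` nonzero, a nonzero diagonal entry of `b` is in the class of `d`
modulo squares. -/
theorem legendreSym_eq_of_rankOne {v : PluckerVec ℤ} {d : ℤ}
    (h : (v.map (Int.castRingHom (ZMod q))).RankOne (d : ZMod q)) :
    legendreSym q (if (q : ℤ) ∣ v.b₁ then v.b₃ else v.b₁) = legendreSym q d := by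
  obtain ⟨-, r₁, r₂, x, y, hr, h1, h2, h3⟩ := h
  replace h1 : (v.b₁ : ZMod q) = d * r₁ ^ 2 := h1
  replace h3 : (v.b₃ : ZMod q) = d * r₂ ^ 2 := h3
  have key : ∀ r : ZMod q, r ≠ 0 → quadraticChar (ZMod q) (d * r ^ 2) = quadraticChar (ZMod q) d :=
    fun r hr => by rw [map_mul, map_pow, quadraticChar_sq_one hr, mul_one]
  rw [legendreSym, legendreSym]
  split_ifs with hb
  · rw [h3]
    rw [← ZMod.intCast_zmod_eq_zero_iff_dvd, h1, mul_eq_zero, sq_eq_zero_iff] at hb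
    rcases hb with hb | hb
    · rw [hb, zero_mul]
    · refine key _ fun h0 => ?_
      rw [hb, h0, mul_zero, mul_zero, add_zero] at hr
      exact zero_ne_one hr
  · rw [h1]
    refine key _ fun h0 => hb ?_
    rw [← ZMod.intCast_zmod_eq_zero_iff_dvd, h1, h0]
    ring

theorem isCoefficient_coeff₁₂ (hsf : Squarefree (q * (N₀ * N₁ * N₂))) (hχ' : χ' ^ 2 = 1)
    (hχ : ∀ d : ℤ, IsCoprime ((q * (N₀ * N₁ * N₂) : ℕ) : ℤ) d →
      conj (χ d) = (legendreSym q d : ℂ) * χ' d)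
    {L : ℕ} (hL : L = q ^ 2 * (N₀ * N₁ * N₂)) {μ : ℤˣ} {κ : ℤ} (hκ : legendreSym q κ = μ)
    (hM : IsPartitionMatrix N₀ N₁ N₂ M₀) (hMq : MatCong (q ^ 2) M₀ (diagonal ![1, (q : ℤ) * κ])) :
    IsCoefficient χ L M₀ (coeff₁₂ q χ' μ) := by
  subst hL
  obtain ⟨hq, -, hsf'⟩ := Nat.squarefree_mul_iff.1 hsf
  obtain ⟨h012, hs01, -⟩ := Nat.squarefree_mul_iff.1 hsf'
  obtain ⟨h01, -, -⟩ := Nat.squarefree_mul_iff.1 hs01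
  have hq0 : (q : ℤ) ≠ 0 := Int.natCast_ne_zero.2 (Fact.out : q.Prime).ne_zero
  have hqL : q * (N₀ * N₁ * N₂) ∣ q ^ 2 * (N₀ * N₁ * N₂) := ⟨q, by ring⟩
  have hMq' : M₀.map (Int.cast : ℤ → ZMod (q ^ 2)) = diagonal ![1, (q : ZMod (q ^ 2)) * κ] := by
    rw [map_eq_of_matCong hMq]
    ext i j; fin_cases i <;> fin_cases j <;> simp
  have hMq1 : M₀.map (Int.cast : ℤ → ZMod q) = diagonal ![1, 0] := by
    rw [map_eq_of_matCong (N := q) (S := diagonal ![1, (q : ℤ) * κ]) fun i j =>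
      (hMq i j).of_dvd (by push_cast; exact dvd_pow_self _ two_ne_zero)]
    ext i j; fin_cases i <;> fin_cases j <;> simp
  have hμ : ((μ : ℤ) : ℂ) * ((μ : ℤ) : ℂ) = 1 := by
    rw [← Int.cast_mul, ← Units.val_mul, Int.units_mul_self]; simp
  refine ⟨fun γ hγ => ?_, fun v hv => ?_, fun v hv => ?_, fun v hv => ?_⟩
  · obtain ⟨h1, h2⟩ := pairMul_symm_and_isPrimitive hM.transpose_eq γ
    set v := plucker (pairMul (M₀, 1) γ).1 (pairMul (M₀, 1) γ).2 with hv
    set d := (γ : Matrix (Fin 2 ⊕ Fin 2) (Fin 2 ⊕ Fin 2) ℤ).toBlocks₂₂.det with hd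
    set a := (γ : Matrix (Fin 2 ⊕ Fin 2) (Fin 2 ⊕ Fin 2) ℤ).toBlocks₁₁.det with ha
    obtain ⟨k1, k2, k3, -, -, k4⟩ := plucker_pairMul_map (N := q) ⟨q * (N₀ * N₁ * N₂), by ring⟩ M₀ hγ
    obtain ⟨k0, -⟩ := entries_of_mul_transpose_eq_one k1
    have hrank : (v.map (Int.castRingHom (ZMod q))).RankOne (d : ZMod q) := by
      rw [hv, k4, hMq1, ← k2]
      exact PluckerVec.rankOne_plucker k1 _
    obtain ⟨-, -, l3, -, -, l4⟩ := plucker_pairMul_map (N := q ^ 2) ⟨_, rfl⟩ M₀ hγ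
    have l5 := congrArg PluckerVec.m l4
    have l6 : (v.m : ZMod (q ^ 2)) = q * (κ * a : ℤ) := by
      refine Eq.trans l5 ?_
      simp only [plucker]
      rw [hMq', Matrix.det_mul, l3, Matrix.det_diagonal, Fin.prod_univ_two, Int.cast_mul,
        ← mul_assoc]
      simp only [Matrix.cons_val_zero, Matrix.cons_val_one, one_mul]
      rfl
    obtain ⟨m₁, hm, hm₁⟩ := exists_eq_mul_of_intCast_eq l6
    have hdiv : v.m / q = m₁ := by rw [hm, Int.mul_ediv_cancel_left _ hq0]
    have had : legendreSym q a = legendreSym q d := by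
      rw [k2, k3] at k0
      exact quadraticChar_eq_of_mul_eq_one k0
    have hleg : legendreSym q m₁ = μ * legendreSym q d := by
      have : legendreSym q m₁ = legendreSym q (κ * a) := by rw [legendreSym, legendreSym, hm₁]
      rw [this, legendreSym.mul, hκ, had]
    have hd0 : ((d : ℤ) : ZMod q) ≠ 0 := by
      rw [← k2]; exact right_ne_zero_of_mul_eq_one k0
    have hcond : legendreSym q (v.m / q) *
        legendreSym q (if (q : ℤ) ∣ v.b₁ then v.b₃ else v.b₁) = μ := by
      rw [hdiv, legendreSym_eq_of_rankOne hrank, hleg, mul_assoc, ← sq, legendreSym.sq_one q hd0,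
        mul_one]
    rw [coeff₁₂, if_pos ⟨plucker_isIsotropic h1, h2, ⟨m₁, hm⟩, hcond⟩,
      hχ _ ((isCoprime_det_of_mem_Gamma0 hγ).of_isCoprime_of_dvd_left
        (Int.natCast_dvd_natCast.2 hqL)),
      awayCoeff_eq h01 h012 hχ' (localDatum_pairMul ⟨q ^ 2, mul_comm _ _⟩ hsf' hM hγ), hdiv, hleg]
    push_cast
    rw [← mul_assoc ((μ : ℤ) : ℂ), hμ, one_mul]
  · by_contra h; exact hv (if_neg fun h' => h h'.1)
  · by_contra h; exact hv (if_neg fun h' => h h'.2.1)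
  · by_cases hc : v.IsIsotropic ∧ v.IsPrimitive ∧ (q : ℤ) ∣ v.m ∧
      legendreSym q (v.m / q) * legendreSym q (if (q : ℤ) ∣ v.b₁ then v.b₃ else v.b₁) = μ
    swap
    · exact absurd (if_neg hc) hv
    have hv' := hv
    rw [coeff₁₂, if_pos hc] at hv'
    obtain ⟨hi, -, ⟨m₁, hm⟩, hcond⟩ := hc
    obtain ⟨d, hd⟩ := exists_localDatum_of_awayCoeff_ne_zero (right_ne_zero_of_mul hv')
    refine isLocalOrbit_mul (hq.pow_left 2) _ _ ?_ (hd.isLocalOrbit hsf' hM hi)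
    rw [hm, Int.mul_ediv_cancel_left _ hq0] at hcond
    have hκ2 : (μ : ℤ) * μ = 1 := by rw [← Units.val_mul, Int.units_mul_self]; rfl
    rw [hMq']
    split_ifs at hcond with hb
    · refine IsLocalOrbit.of_swap ?_ (by simp)
      have := isLocalOrbit_diag_one_of_legendreSym (q := q) (v := ⟨v.m, v.b₃, -v.b₂, v.b₁, v.n⟩)
        (κ := κ) (m₁ := m₁) (by rw [PluckerVec.IsIsotropic] at hi ⊢; linear_combination hi) hm
        (by rw [legendreSym.mul, legendreSym.mul, hκ, mul_comm (legendreSym q _), hcond, hκ2])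
      simpa [PluckerVec.map] using this
    · exact isLocalOrbit_diag_one_of_legendreSym hi hm
        (by rw [legendreSym.mul, legendreSym.mul, hκ, mul_comm (legendreSym q _), hcond, hκ2])

theorem isCoefficient_coeff₀₂ (hq2 : q ≠ 2) (hsf : Squarefree (q * (N₀ * N₁ * N₂)))
    (hχ' : χ' ^ 2 = 1)
    (hχ : ∀ d : ℤ, IsCoprime ((q * (N₀ * N₁ * N₂) : ℕ) : ℤ) d →
      conj (χ d) = (legendreSym q d : ℂ) * χ' d)
    {L : ℕ} (hL : L = q ^ 2 * (N₀ * N₁ * N₂)) {α : (ZMod q)ˣ} {c : ℤ} (hc : (c : ZMod q) = α)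
    (hM : IsPartitionMatrix N₀ N₁ N₂ M₀)
    (hMq : MatCong (q ^ 2) M₀ (diagonal ![(q : ℤ), (q : ℤ) * c])) :
    IsCoefficient χ L M₀ (coeff₀₂ q χ' α) := by
  subst hL
  obtain ⟨hq, -, hsf'⟩ := Nat.squarefree_mul_iff.1 hsf
  obtain ⟨h012, hs01, -⟩ := Nat.squarefree_mul_iff.1 hsf'
  obtain ⟨h01, -, -⟩ := Nat.squarefree_mul_iff.1 hs01
  have hq0 : (q : ℤ) ≠ 0 := Int.natCast_ne_zero.2 (Fact.out : q.Prime).ne_zero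
  have hqL : q * (N₀ * N₁ * N₂) ∣ q ^ 2 * (N₀ * N₁ * N₂) := ⟨q, by ring⟩
  have hMq' : M₀.map (Int.cast : ℤ → ZMod (q ^ 2)) =
      diagonal ![(q : ZMod (q ^ 2)), (q : ZMod (q ^ 2)) * c] := by
    rw [map_eq_of_matCong hMq]
    ext i j; fin_cases i <;> fin_cases j <;> simp
  have hMq1 : M₀.map (Int.cast : ℤ → ZMod q) = 0 := by
    rw [map_eq_of_matCong (N := q) (S := diagonal ![(q : ℤ), (q : ℤ) * c]) fun i j =>
      (hMq i j).of_dvd (by push_cast; exact dvd_pow_self _ two_ne_zero)]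
    ext i j; fin_cases i <;> fin_cases j <;> simp
  refine ⟨fun γ hγ => ?_, fun v hv => ?_, fun v hv => ?_, fun v hv => ?_⟩
  · obtain ⟨h1, h2⟩ := pairMul_symm_and_isPrimitive hM.transpose_eq γ
    set d := (γ : Matrix (Fin 2 ⊕ Fin 2) (Fin 2 ⊕ Fin 2) ℤ).toBlocks₂₂.det with hd
    set X := (γ : Matrix (Fin 2 ⊕ Fin 2) (Fin 2 ⊕ Fin 2) ℤ).toBlocks₁₁ with hX
    obtain ⟨k1, k2, k3, -, k5, -⟩ := plucker_pairMul_map (N := q) ⟨q * (N₀ * N₁ * N₂), by ring⟩ M₀ hγ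
    obtain ⟨k0, -⟩ := entries_of_mul_transpose_eq_one k1
    obtain ⟨-, -, -, l4, -, -⟩ := plucker_pairMul_map (N := q ^ 2) ⟨_, rfl⟩ M₀ hγ
    generalize hMN : pairMul (M₀, 1) γ = P at *
    obtain ⟨M, N⟩ := P
    simp only at h1 h2 k5 l4 ⊢
    -- `M = q M'` with `M'` congruent to `diag(1, c) A` modulo `q`
    have hM' : ∀ i j, ∃ y : ℤ, M i j = q * y ∧
        (y : ZMod q) = ((diagonal ![1, c] * X : IntMat) i j : ℤ) := fun i j => by
      refine exists_eq_mul_of_intCast_eq ?_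
      have := congrFun (congrFun l4 i) j
      rw [hMq'] at this
      refine Eq.trans this ?_
      rw [Matrix.diagonal_mul, Matrix.diagonal_mul]
      fin_cases i <;> simp [hX, mul_assoc]
    choose Y hY hYq using hM'
    have hdetY : ((Y 0 0 * Y 1 1 - Y 0 1 * Y 1 0 : ℤ) : ZMod q) = c * X.det := by
      push_cast
      rw [hYq, hYq, hYq, hYq, Matrix.det_fin_two]
      simp only [Matrix.diagonal_mul]
      push_cast
      simp
      ring
    have hm : (plucker M N).m = q ^ 2 * (Y 0 0 * Y 1 1 - Y 0 1 * Y 1 0) := by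
      simp only [plucker, Matrix.det_fin_two, hY]; ring
    have hn : ((plucker M N).n : ZMod q) = d := by
      rw [hMq1, Matrix.zero_mul, zero_add] at k5
      rw [← k2, ← k5]
      exact Int.cast_det N
    have hdiv : (plucker M N).m / q ^ 2 = Y 0 0 * Y 1 1 - Y 0 1 * Y 1 0 := by
      rw [hm, Int.mul_ediv_cancel_left _ (pow_ne_zero 2 hq0)]
    have hcond : (((plucker M N).n * ((plucker M N).m / q ^ 2) : ℤ) : ZMod q) = α := by
      rw [hdiv, Int.cast_mul, hn, hdetY, ← hc]
      rw [k2, k3] at k0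
      linear_combination (c : ZMod q) * k0
    have d1 : (q : ℤ) ∣ (plucker M N).b₁ :=
      ⟨Y 0 0 * N 1 1 - Y 1 0 * N 0 1, by simp only [plucker, hY]; ring⟩
    have d2 : (q : ℤ) ∣ (plucker M N).b₂ :=
      ⟨Y 0 1 * N 1 1 - Y 1 1 * N 0 1, by simp only [plucker, hY]; ring⟩
    have d3 : (q : ℤ) ∣ (plucker M N).b₃ :=
      ⟨N 0 0 * Y 1 1 - N 1 0 * Y 0 1, by simp only [plucker, hY]; ring⟩
    rw [coeff₀₂, if_pos ⟨plucker_isIsotropic h1, h2, ⟨_, hm⟩, d1, d2, d3, hcond⟩,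
      hχ _ ((isCoprime_det_of_mem_Gamma0 hγ).of_isCoprime_of_dvd_left
        (Int.natCast_dvd_natCast.2 hqL))]
    have hloc := localDatum_pairMul ⟨q ^ 2, mul_comm _ _⟩ hsf' hM hγ
    rw [hMN] at hloc
    rw [awayCoeff_eq h01 h012 hχ' hloc, legendreSym, legendreSym, hn]
  · by_contra h; exact hv (if_neg fun h' => h h'.1)
  · by_contra h; exact hv (if_neg fun h' => h h'.2.1)
  · by_cases hcd : v.IsIsotropic ∧ v.IsPrimitive ∧ (q : ℤ) ^ 2 ∣ v.m ∧ (q : ℤ) ∣ v.b₁ ∧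
      (q : ℤ) ∣ v.b₂ ∧ (q : ℤ) ∣ v.b₃ ∧ ((v.n * (v.m / q ^ 2) : ℤ) : ZMod q) = α
    swap
    · exact absurd (if_neg hcd) hv
    have hv' := hv
    rw [coeff₀₂, if_pos hcd] at hv'
    obtain ⟨hi, -, hm, h1, h2, h3, h⟩ := hcd
    obtain ⟨d, hd⟩ := exists_localDatum_of_awayCoeff_ne_zero (right_ne_zero_of_mul hv')
    refine isLocalOrbit_mul (hq.pow_left 2) _ _ ?_ (hd.isLocalOrbit hsf' hM hi)
    rw [hMq']
    exact isLocalOrbit_diag_q hq2 hi hm h1 h2 h3 (hc ▸ α.ne_zero) (h.trans hc.symm)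

end Coefficients

/-! ### Rescaled Plücker vectors -/

namespace PluckerVec

theorem isIsotropic_translate {R : Type*} [CommRing R] {v : PluckerVec R} (t₁ t₂ t₃ : R) :
    (v.translate t₁ t₂ t₃).IsIsotropic ↔ v.IsIsotropic := by
  simp only [IsIsotropic, translate]
  constructor <;> intro h <;> linear_combination h

theorem translate_translate_neg {R : Type*} [CommRing R] (v : PluckerVec R) (t₁ t₂ t₃ : R) :
    (v.translate (-t₁) (-t₂) (-t₃)).translate t₁ t₂ t₃ = v := by
  ext <;> simp only [translate] <;> ring

theorem IsPrimitive.translate {v : PluckerVec ℤ} (hv : v.IsPrimitive) (t₁ t₂ t₃ : ℤ) :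
    (v.translate t₁ t₂ t₃).IsPrimitive := by
  rw [isPrimitive_iff_not_prime_dvd] at hv ⊢
  rintro p hp ⟨h0, h1, h2, h3, h4⟩
  simp only [PluckerVec.translate] at h0 h1 h2 h3 h4
  rw [dvd_add_left (h0.mul_right _)] at h1
  rw [dvd_sub_left (h0.mul_right _)] at h2
  rw [dvd_add_left (h0.mul_right _)] at h3
  rw [dvd_add_left (h0.mul_right _), dvd_add_left (h3.mul_right _),
    dvd_add_left ((h2.mul_left _).mul_right _), dvd_add_left (h1.mul_right _)] at h4
  exact hv p hp ⟨h0, h1, h2, h3, h4⟩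

theorem isPrimitive_translate {v : PluckerVec ℤ} (t₁ t₂ t₃ : ℤ) :
    (v.translate t₁ t₂ t₃).IsPrimitive ↔ v.IsPrimitive := by
  refine ⟨fun h => ?_, fun h => h.translate _ _ _⟩
  have := h.translate (-t₁) (-t₂) (-t₃)
  have e := translate_translate_neg v (-t₁) (-t₂) (-t₃)
  rw [neg_neg, neg_neg, neg_neg] at e
  rwa [e] at this

/-- Translation as a permutation of the Plücker vectors. -/
def translateEquiv {R : Type*} [CommRing R] (t₁ t₂ t₃ : R) : PluckerVec R ≃ PluckerVec R where
  toFun := translate t₁ t₂ t₃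
  invFun := translate (-t₁) (-t₂) (-t₃)
  left_inv v := by
    have := translate_translate_neg v (-t₁) (-t₂) (-t₃)
    rwa [neg_neg, neg_neg, neg_neg] at this
  right_inv v := translate_translate_neg v t₁ t₂ t₃

variable {q : ℕ} [Fact q.Prime] {v : PluckerVec ℤ}

theorem isIsotropic_dilate : (v.dilate (q : ℤ)).IsIsotropic ↔ v.IsIsotropic := by
  have hq0 : (q : ℤ) ^ 2 ≠ 0 := pow_ne_zero 2 (Int.natCast_ne_zero.2 (Fact.out : q.Prime).ne_zero)
  simp only [IsIsotropic, dilate]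
  rw [← mul_right_inj' (b := v.m * v.n) hq0]
  constructor <;> intro h <;> linear_combination h

theorem natCast_prime_dvd_mul_iff {p : ℕ} (hp : p.Prime) (hpq : p ≠ q) {x : ℤ} :
    (p : ℤ) ∣ q * x ↔ (p : ℤ) ∣ x := by
  refine ⟨fun h => ((Nat.prime_iff_prime_int.1 hp).dvd_or_dvd h).resolve_left fun h' => hpq ?_,
    fun h => h.mul_left _⟩
  exact (Nat.prime_dvd_prime_iff_eq hp Fact.out).1 (Int.natCast_dvd_natCast.1 h')

theorem isPrimitive_dilate :
    (v.dilate (q : ℤ)).IsPrimitive ↔ v.IsPrimitive ∧ ¬(q : ℤ) ∣ v.n := by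
  simp only [isPrimitive_iff_not_prime_dvd, dilate]
  refine ⟨fun h => ⟨fun p hp h' => h p hp ⟨h'.1.mul_left _, h'.2.1.mul_left _, h'.2.2.1.mul_left _,
    h'.2.2.2.1.mul_left _, h'.2.2.2.2⟩, fun hn => h q Fact.out ⟨(dvd_pow_self _ two_ne_zero).mul_right _,
      dvd_mul_right _ _, dvd_mul_right _ _, dvd_mul_right _ _, hn⟩⟩, fun ⟨h, hn⟩ p hp h' => ?_⟩
  by_cases hpq : p = q
  · rw [hpq] at h'
    exact hn h'.2.2.2.2
  · rw [sq, mul_assoc] at h'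
    simp only [natCast_prime_dvd_mul_iff hp hpq] at h'
    exact h p hp h'

theorem dilate_injective : Function.Injective (dilate (q : ℤ)) := by
  have hq0 : (q : ℤ) ≠ 0 := Int.natCast_ne_zero.2 (Fact.out : q.Prime).ne_zero
  intro v w h
  simp only [dilate, mk.injEq] at h
  exact PluckerVec.ext (mul_left_cancel₀ (pow_ne_zero 2 hq0) h.1) (mul_left_cancel₀ hq0 h.2.1)
    (mul_left_cancel₀ hq0 h.2.2.1) (mul_left_cancel₀ hq0 h.2.2.2.1) h.2.2.2.2

/-- The vector `(m, b, q n)`. -/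
def scaleLast (q : ℤ) (v : PluckerVec ℤ) : PluckerVec ℤ := ⟨v.m, v.b₁, v.b₂, v.b₃, q * v.n⟩

/-- The vector `(q m, b, n)`. -/
def scaleFirst (q : ℤ) (v : PluckerVec ℤ) : PluckerVec ℤ := ⟨q * v.m, v.b₁, v.b₂, v.b₃, v.n⟩

/-- The vector `(m, q b, q² n)`. -/
def codilate (q : ℤ) (v : PluckerVec ℤ) : PluckerVec ℤ :=
  ⟨v.m, q * v.b₁, q * v.b₂, q * v.b₃, q ^ 2 * v.n⟩

theorem scaleLast_injective : Function.Injective (scaleLast (q : ℤ)) := by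
  have hq0 : (q : ℤ) ≠ 0 := Int.natCast_ne_zero.2 (Fact.out : q.Prime).ne_zero
  intro v w h
  simp only [scaleLast, mk.injEq] at h
  exact PluckerVec.ext h.1 h.2.1 h.2.2.1 h.2.2.2.1 (mul_left_cancel₀ hq0 h.2.2.2.2)

theorem scaleFirst_injective : Function.Injective (scaleFirst (q : ℤ)) := by
  have hq0 : (q : ℤ) ≠ 0 := Int.natCast_ne_zero.2 (Fact.out : q.Prime).ne_zero
  intro v w h
  simp only [scaleFirst, mk.injEq] at h
  exact PluckerVec.ext (mul_left_cancel₀ hq0 h.1) h.2.1 h.2.2.1 h.2.2.2.1 h.2.2.2.2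

theorem codilate_injective : Function.Injective (codilate (q : ℤ)) := by
  have hq0 : (q : ℤ) ≠ 0 := Int.natCast_ne_zero.2 (Fact.out : q.Prime).ne_zero
  intro v w h
  simp only [codilate, mk.injEq] at h
  exact PluckerVec.ext h.1 (mul_left_cancel₀ hq0 h.2.1) (mul_left_cancel₀ hq0 h.2.2.1)
    (mul_left_cancel₀ hq0 h.2.2.2.1) (mul_left_cancel₀ (pow_ne_zero 2 hq0) h.2.2.2.2)

theorem dilate_scaleLast (q : ℤ) (v : PluckerVec ℤ) :
    (v.scaleLast q).dilate q = (v.scaleFirst q).scale q := by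
  ext <;> simp only [dilate, scaleLast, scaleFirst, scale]
  ring

theorem dilate_codilate (q : ℤ) (v : PluckerVec ℤ) :
    (v.codilate q).dilate q = v.scale (q ^ 2) := by
  ext <;> simp only [dilate, codilate, scale] <;> ring

theorem isIsotropic_scaleLast (q : ℤ) :
    (v.scaleLast q).IsIsotropic ↔ (v.scaleFirst q).IsIsotropic := by
  simp only [IsIsotropic, scaleLast, scaleFirst]
  constructor <;> intro h <;> linear_combination h

theorem isIsotropic_codilate : (v.codilate (q : ℤ)).IsIsotropic ↔ v.IsIsotropic := by
  have hq0 : (q : ℤ) ^ 2 ≠ 0 := pow_ne_zero 2 (Int.natCast_ne_zero.2 (Fact.out : q.Prime).ne_zero)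
  simp only [IsIsotropic, codilate]
  rw [← mul_right_inj' (b := v.m * v.n) hq0]
  constructor <;> intro h <;> linear_combination h

theorem isPrimitive_codilate (hm : ¬(q : ℤ) ∣ v.m) :
    (v.codilate (q : ℤ)).IsPrimitive ↔ v.IsPrimitive := by
  simp only [isPrimitive_iff_not_prime_dvd, codilate]
  refine forall₂_congr fun p hp => ?_
  by_cases hpq : p = q
  · rw [hpq]
    exact ⟨fun _ h => hm h.1, fun _ h => hm h.1⟩
  · rw [sq, mul_assoc]
    simp only [natCast_prime_dvd_mul_iff hp hpq]

theorem dvd_of_dvd_b (hi : v.IsIsotropic) (hm : ¬(q : ℤ) ∣ v.m) (h1 : (q : ℤ) ∣ v.b₁)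
    (h2 : (q : ℤ) ∣ v.b₂) (h3 : (q : ℤ) ∣ v.b₃) : (q : ℤ) ^ 2 ∣ v.n := by
  have hp := Nat.prime_iff_prime_int.1 (Fact.out : q.Prime)
  have h : (q : ℤ) ^ 2 ∣ v.m * v.n := by
    rw [hi]
    refine dvd_sub ?_ (pow_dvd_pow_of_dvd h2 2)
    rw [sq]
    exact mul_dvd_mul h1 h3
  exact ((hp.coprime_iff_not_dvd.2 hm).pow_left (m := 2)).dvd_of_dvd_mul_left h

/-- If `b = 0` modulo `q` then `q² ∣ b₁ b₃ - b₂²`, which is `q m n` here, so that `q ∣ n`: at the prime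
`q`, primitivity of `(q m, b, n)` means that `b` is nonzero modulo `q`. -/
theorem isPrimitive_scaleLast_iff (hm : ¬(q : ℤ) ∣ v.m) (hi : (v.scaleLast (q : ℤ)).IsIsotropic) :
    ((v.scaleLast (q : ℤ)).IsPrimitive ∧ ¬((q : ℤ) ∣ v.b₁ ∧ (q : ℤ) ∣ v.b₂ ∧ (q : ℤ) ∣ v.b₃)) ↔
      (v.scaleFirst (q : ℤ)).IsPrimitive := by
  have hq0 : (q : ℤ) ≠ 0 := Int.natCast_ne_zero.2 (Fact.out : q.Prime).ne_zero
  have hn : (q : ℤ) ∣ v.b₁ ∧ (q : ℤ) ∣ v.b₂ ∧ (q : ℤ) ∣ v.b₃ → (q : ℤ) ∣ v.n := fun h => by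
    have := dvd_of_dvd_b hi hm h.1 h.2.1 h.2.2
    simp only [scaleLast, sq] at this
    exact (mul_dvd_mul_iff_left hq0).1 this
  simp only [isPrimitive_iff_not_prime_dvd, scaleLast, scaleFirst]
  constructor
  · rintro ⟨h, hb⟩ p hp hd
    by_cases hpq : p = q
    · rw [hpq] at hd
      exact hb ⟨hd.2.1, hd.2.2.1, hd.2.2.2.1⟩
    · rw [natCast_prime_dvd_mul_iff hp hpq] at hd
      exact h p hp ⟨hd.1, hd.2.1, hd.2.2.1, hd.2.2.2.1, hd.2.2.2.2.mul_left _⟩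
  · refine fun h => ⟨fun p hp hd => ?_, fun hb => h q Fact.out ⟨dvd_mul_right _ _, hb.1, hb.2.1,
      hb.2.2, hn hb⟩⟩
    by_cases hpq : p = q
    · rw [hpq] at hd
      exact hm hd.1
    · rw [natCast_prime_dvd_mul_iff hp hpq] at hd
      exact h p hp ⟨hd.1.mul_left _, hd.2⟩

end PluckerVec

theorem ell_scale (τ : Matrix (Fin 2) (Fin 2) ℂ) (t : ℤ) (v : PluckerVec ℤ) :
    ell τ (v.scale t) = t * ell τ v := by
  simp only [ell, PluckerVec.scale]
  push_cast
  ring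

/-- On the vectors `(q² m, q b, n)` the translation `τ ↦ τ + Y/q` is the integral translation of
`(m, b, n)` by `Y`. -/
theorem ell_dilate_translate {τ : Matrix (Fin 2) (Fin 2) ℂ} (hτ : τᵀ = τ) {q : ℕ} (hq : q ≠ 0)
    (y₁ y₂ y₄ : ℤ) (v : PluckerVec ℤ) :
    ell (τ + (q : ℂ)⁻¹ • (!![y₁, y₂; y₂, y₄] : IntMat).map (Int.cast : ℤ → ℂ))
      (v.dilate (q : ℤ)) = ell τ ((v.translate y₁ y₂ y₄).dilate (q : ℤ)) := by
  have h10 : τ 1 0 = τ 0 1 := congrFun (congrFun hτ 0) 1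
  have hq' : (q : ℂ) ≠ 0 := Nat.cast_ne_zero.2 hq
  simp only [ell, PluckerVec.dilate, PluckerVec.translate, Matrix.det_fin_two, Matrix.add_apply,
    Matrix.smul_apply, Matrix.map_apply, Matrix.of_apply, Matrix.cons_val', Matrix.cons_val_zero,
    Matrix.cons_val_one, Matrix.cons_val_fin_one, smul_eq_mul, h10]
  push_cast
  field_simp
  ring

theorem add_mem_siegelUpperHalfSpace {τ : Matrix (Fin 2) (Fin 2) ℂ}
    (hτ : τ ∈ siegelUpperHalfSpace) (q : ℕ) (y₁ y₂ y₄ : ℤ) :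
    τ + (q : ℂ)⁻¹ • (!![y₁, y₂; y₂, y₄] : IntMat).map (Int.cast : ℤ → ℂ) ∈
      siegelUpperHalfSpace := by
  refine ⟨?_, ?_⟩
  · rw [transpose_add, hτ.1, transpose_smul]
    congr 2
    ext i j; fin_cases i <;> fin_cases j <;> rfl
  · convert hτ.2 using 1
    ext i j
    simp only [Matrix.map_apply, Matrix.add_apply, Matrix.smul_apply, smul_eq_mul, Complex.add_im]
    rw [← Complex.ofReal_natCast, ← Complex.ofReal_inv, ← Complex.ofReal_intCast,
      ← Complex.ofReal_mul, Complex.ofReal_im, add_zero]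

theorem slash_unipotent (k : ℕ) (f : Matrix (Fin 2) (Fin 2) ℂ → ℂ) (q : ℕ) (Y : IntMat)
    (τ : Matrix (Fin 2) (Fin 2) ℂ) :
    slash k f (fromBlocks 1 ((q : ℚ)⁻¹ • Y.map (Int.cast : ℤ → ℚ)) 0 1) τ =
      f (τ + (q : ℂ)⁻¹ • Y.map (Int.cast : ℤ → ℂ)) := by
  have h : (fromBlocks 1 ((q : ℚ)⁻¹ • Y.map (Int.cast : ℤ → ℚ)) 0 1 :
      Matrix (Fin 2 ⊕ Fin 2) (Fin 2 ⊕ Fin 2) ℚ).map (Rat.cast : ℚ → ℂ) =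
      fromBlocks 1 ((q : ℂ)⁻¹ • Y.map (Int.cast : ℤ → ℂ)) 0 1 := by
    rw [fromBlocks_map, Matrix.map_one _ Rat.cast_zero Rat.cast_one,
      Matrix.map_zero _ Rat.cast_zero]
    congr 1
    ext i j
    simp
  simp only [slash, h, toBlocks_fromBlocks₁₁, toBlocks_fromBlocks₁₂, toBlocks_fromBlocks₂₁,
    toBlocks_fromBlocks₂₂, Matrix.det_fromBlocks_zero₂₁, Matrix.det_one, Matrix.zero_mul, zero_add,
    mul_one, _root_.one_mul, inv_one, Complex.one_cpow, _root_.one_zpow]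

/-! ### Twisting the coefficients -/

section Twist

variable {N₀ N₁ N₂ q : ℕ} [Fact q.Prime] {χ' : DirichletCharacter ℂ (N₀ * N₁ * N₂)}

theorem norm_legendreSym_le_one (a : ℤ) : ‖(legendreSym q a : ℂ)‖ ≤ 1 := by
  by_cases h : (a : ZMod q) = 0
  · rw [(legendreSym.eq_zero_iff q a).2 h]; simp
  · rcases legendreSym.eq_one_or_neg_one q h with h | h <;> rw [h] <;> simp

theorem norm_ite_zero_le_one {p : Prop} {_ : Decidable p} {z : ℂ} (hz : ‖z‖ ≤ 1) :
    ‖if p then z else 0‖ ≤ 1 := by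
  split
  · exact hz
  · simp

theorem norm_coeff₂_le_one (v : PluckerVec ℤ) : ‖coeff₂ q χ' v‖ ≤ 1 := by
  refine norm_ite_zero_le_one ?_
  rw [norm_mul]
  exact mul_le_one₀ (norm_legendreSym_le_one _) (norm_nonneg _) norm_awayCoeff_le_one

theorem norm_coeff₁₂_le_one (μ : ℤˣ) (v : PluckerVec ℤ) : ‖coeff₁₂ q χ' μ v‖ ≤ 1 := by
  have hμ : ‖((μ : ℤ) : ℂ)‖ = 1 := by
    rcases Int.units_eq_one_or μ with rfl | rfl <;> simp
  refine norm_ite_zero_le_one ?_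
  rw [norm_mul, norm_mul, hμ, _root_.one_mul]
  exact mul_le_one₀ (norm_legendreSym_le_one _) (norm_nonneg _) norm_awayCoeff_le_one

theorem norm_coeff₀₂_le_one (α : (ZMod q)ˣ) (v : PluckerVec ℤ) : ‖coeff₀₂ q χ' α v‖ ≤ 1 := by
  refine norm_ite_zero_le_one ?_
  rw [norm_mul]
  exact mul_le_one₀ (norm_legendreSym_le_one _) (norm_nonneg _) norm_awayCoeff_le_one

variable (q χ')

open Classical in
/-- The coefficient of `𝔼_{0,2,ν}` at the vector `(q² m, q b, n)`, as a function of
`v = (m, b, n)`. -/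
def dilatedCoeff (ν : ℤˣ) (v : PluckerVec ℤ) : ℂ :=
  if v.IsIsotropic ∧ v.IsPrimitive then
    (((ν : ℤ) * legendreSym q v.m * charInd ν ((v.n * v.m : ℤ) : ZMod q) : ℤ) : ℂ) *
      awayCoeff χ' (v.dilate (q : ℤ))
  else 0

open Classical in
/-- The coefficient of `𝔼_{0,2,ν} | A₂*(q)` at the vector `(q² m, q b, n)`, as a function of
`v = (m, b, n)`. -/
def twistedCoeff (ν : ℤˣ) (v : PluckerVec ℤ) : ℂ :=
  if v.IsIsotropic ∧ v.IsPrimitive then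
    (((ν : ℤ) * legendreSym q v.m * twistSum (charInd ν) ((v.b₁ : ZMod q) / v.m)
      ((v.b₂ : ZMod q) / v.m) ((v.b₃ : ZMod q) / v.m) : ℤ) : ℂ) * awayCoeff χ' (v.dilate (q : ℤ))
  else 0

open Classical in
/-- The contribution to `2 twistedCoeff` of the vectors with `q ∣ n` and `b` nonzero modulo `q`. -/
def twistedCoeff₁ (ν : ℤˣ) (v : PluckerVec ℤ) : ℂ :=
  if v.IsIsotropic ∧ v.IsPrimitive ∧ (q : ℤ) ∣ v.n ∧
      ¬((q : ℤ) ∣ v.b₁ ∧ (q : ℤ) ∣ v.b₂ ∧ (q : ℤ) ∣ v.b₃) then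
    (((ν : ℤ) * legendreSym q v.m * (legendreSym q (-1) * q * (q - 1)) : ℤ) : ℂ) *
      awayCoeff χ' (v.dilate (q : ℤ))
  else 0

open Classical in
/-- The contribution to `2 twistedCoeff` of the vectors with `q ∣ n` and `b` zero modulo `q`. -/
def twistedCoeff₂ (ν : ℤˣ) (v : PluckerVec ℤ) : ℂ :=
  if v.IsIsotropic ∧ v.IsPrimitive ∧ (q : ℤ) ∣ v.n ∧
      ((q : ℤ) ∣ v.b₁ ∧ (q : ℤ) ∣ v.b₂ ∧ (q : ℤ) ∣ v.b₃) then
    (((ν : ℤ) * legendreSym q v.m * (q * (q - 1) * (ν * q + legendreSym q (-1))) : ℤ) : ℂ) *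
      awayCoeff χ' (v.dilate (q : ℤ))
  else 0

variable {q χ'}

/-- At `(q² m, q b, n)` at most one `α` contributes, namely `α = n m` modulo `q`; if its class is `ν`,
then `(n / q) = ν (m / q)`. -/
theorem sum_coeff₀₂_dilate (ν : ℤˣ) (v : PluckerVec ℤ) :
    ∑ α : (ZMod q)ˣ with quadraticChar (ZMod q) α.val = (ν : ℤ),
      coeff₀₂ q χ' α (v.dilate (q : ℤ)) = dilatedCoeff q χ' ν v := by
  have hq0 : (q : ℤ) ≠ 0 := Int.natCast_ne_zero.2 (Fact.out : q.Prime).ne_zero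
  have hdiv : (v.dilate (q : ℤ)).m / (q : ℤ) ^ 2 = v.m :=
    Int.mul_ediv_cancel_left _ (pow_ne_zero 2 hq0)
  rw [dilatedCoeff]
  by_cases hc : v.IsIsotropic ∧ v.IsPrimitive ∧ ¬(q : ℤ) ∣ v.n
  · rw [if_pos ⟨hc.1, hc.2.1⟩]
    have hterm : ∀ α : (ZMod q)ˣ, coeff₀₂ q χ' α (v.dilate (q : ℤ)) =
        if ((v.n * v.m : ℤ) : ZMod q) = α then
          (legendreSym q v.n : ℂ) * awayCoeff χ' (v.dilate (q : ℤ)) else 0 := fun α => by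
      by_cases h : ((v.n * v.m : ℤ) : ZMod q) = α
      · rw [if_pos h, coeff₀₂, if_pos]
        · rfl
        · exact ⟨PluckerVec.isIsotropic_dilate.2 hc.1, PluckerVec.isPrimitive_dilate.2 hc.2,
            dvd_mul_right _ _, dvd_mul_right _ _, dvd_mul_right _ _, dvd_mul_right _ _,
            by rw [hdiv]; exact h⟩
      · rw [if_neg h, coeff₀₂, if_neg]
        rintro ⟨-, -, -, -, -, -, h'⟩
        rw [hdiv] at h'
        exact h h'
    simp only [hterm]
    by_cases hν : quadraticChar (ZMod q) ((v.n * v.m : ℤ) : ZMod q) = (ν : ℤ)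
    · have hne : ((v.n * v.m : ℤ) : ZMod q) ≠ 0 := fun h0 => by
        rw [h0, quadraticChar_zero] at hν
        exact ν.ne_zero hν.symm
      rw [Finset.sum_eq_single (Units.mk0 _ hne)]
      · rw [if_pos (Units.val_mk0 hne).symm, charInd, if_pos hν, mul_one]
        congr 2
        have h1 : legendreSym q v.n * legendreSym q v.m = ν := by
          rw [← legendreSym.mul]; exact hν
        have h2 : legendreSym q v.m ^ 2 = 1 := legendreSym.sq_one q (fun h0 => hne (by
          rw [Int.cast_mul, h0, mul_zero]))
        rw [← h1, mul_assoc, ← sq, h2, mul_one]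
      · intro α _ hα
        rw [if_neg]
        intro h
        exact hα (Units.ext h.symm)
      · intro h
        exact absurd (Finset.mem_filter.2 ⟨Finset.mem_univ _, by rw [Units.val_mk0]; exact hν⟩) h
    · rw [charInd, if_neg hν, mul_zero, Int.cast_zero, zero_mul]
      refine Finset.sum_eq_zero fun α hα => if_neg fun h => hν ?_
      rw [h]
      exact (Finset.mem_filter.1 hα).2
  · rw [Finset.sum_eq_zero]
    · by_cases hc' : v.IsIsotropic ∧ v.IsPrimitive
      · rw [if_pos hc']
        have hn : (q : ℤ) ∣ v.n := by
          by_contra h; exact hc ⟨hc'.1, hc'.2, h⟩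
        have h0 : ((v.n * v.m : ℤ) : ZMod q) = 0 :=
          (ZMod.intCast_zmod_eq_zero_iff_dvd _ _).2 (hn.mul_right _)
        rw [charInd, h0, quadraticChar_zero, if_neg ν.ne_zero.symm, mul_zero, Int.cast_zero, zero_mul]
      · rw [if_neg hc']
    · intro α _
      rw [coeff₀₂, if_neg]
      rintro ⟨h1, h2, -⟩
      exact hc ⟨PluckerVec.isIsotropic_dilate.1 h1, PluckerVec.isPrimitive_dilate.1 h2⟩

theorem sum_coeff₀₂_eq_zero (ν : ℤˣ) {v : PluckerVec ℤ}
    (hv : v ∉ Set.range (PluckerVec.dilate (q : ℤ))) :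
    ∑ α : (ZMod q)ˣ with quadraticChar (ZMod q) α.val = (ν : ℤ), coeff₀₂ q χ' α v = 0 := by
  refine Finset.sum_eq_zero fun α _ => ?_
  rw [coeff₀₂, if_neg]
  rintro ⟨-, -, ⟨m, hm⟩, ⟨b₁, h1⟩, ⟨b₂, h2⟩, ⟨b₃, h3⟩, -⟩
  exact hv ⟨⟨m, b₁, b₂, b₃, v.n⟩, PluckerVec.ext hm.symm h1.symm h2.symm h3.symm rfl⟩

theorem sum_range_natCast (f : ZMod q → ℂ) : ∑ y ∈ range q, f (y : ZMod q) = ∑ z, f z := by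
  refine Finset.sum_nbij' (fun y : ℕ => (y : ZMod q)) ZMod.val (fun _ _ => Finset.mem_univ _)
    (fun z _ => Finset.mem_range.2 (ZMod.val_lt z)) (fun y hy => ?_) (fun z _ => ?_)
    fun _ _ => rfl
  · exact ZMod.val_cast_of_lt (Finset.mem_range.1 hy)
  · exact ZMod.natCast_zmod_val z

theorem sum_range_natCast₃ (F : ZMod q → ZMod q → ZMod q → ℂ) :
    ∑ x ∈ range q, ∑ y ∈ range q, ∑ z ∈ range q, F x y z = ∑ x, ∑ y, ∑ z, F x y z := by
  have h1 : ∀ x y : ℕ, ∑ z ∈ range q, F x y z = ∑ z, F x y z := fun x y => sum_range_natCast _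
  simp only [h1]
  have h2 : ∀ x : ℕ, ∑ y ∈ range q, ∑ z, F x y z = ∑ y, ∑ z, F x y z :=
    fun x => sum_range_natCast fun y => ∑ z, F x y z
  simp only [h2]
  exact sum_range_natCast fun x => ∑ y, ∑ z, F x y z

theorem charInd_sq_mul (ν : ℤˣ) {m : ZMod q} (hm : m ≠ 0) (z : ZMod q) :
    charInd ν (m ^ 2 * z) = charInd ν z := by
  rw [charInd, charInd, map_mul, map_pow, quadraticChar_sq_one hm, one_mul]

/-- Isotropy turns `n m` into `b₁ b₃ - b₂²`, so that the translates of `(m, b, n)` by `-Y` contribute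
according to the class of `det (b / m - Y)` modulo `q`. -/
theorem sum_legendreSym_mul_dilatedCoeff (hq : IsCoprime ((N₀ * N₁ * N₂ : ℕ) : ℤ) (q : ℤ)) (ν : ℤˣ)
    (v : PluckerVec ℤ) :
    ∑ y₁ ∈ range q, ∑ y₂ ∈ range q, ∑ y₄ ∈ range q,
      (legendreSym q (!![(y₁ : ℤ), (y₂ : ℤ); (y₂ : ℤ), (y₄ : ℤ)] : IntMat).det : ℂ) *
        dilatedCoeff q χ' ν (v.translate (-(y₁ : ℤ)) (-(y₂ : ℤ)) (-(y₄ : ℤ))) =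
    twistedCoeff q χ' ν v := by
  by_cases hc : v.IsIsotropic ∧ v.IsPrimitive
  swap
  · rw [twistedCoeff, if_neg hc]
    refine Finset.sum_eq_zero fun y₁ _ => Finset.sum_eq_zero fun y₂ _ =>
      Finset.sum_eq_zero fun y₄ _ => ?_
    rw [dilatedCoeff, if_neg, mul_zero]
    rwa [PluckerVec.isIsotropic_translate, PluckerVec.isPrimitive_translate]
  rw [twistedCoeff, if_pos hc]
  have hi := hc.1
  rw [PluckerVec.IsIsotropic] at hi
  by_cases hm : (v.m : ZMod q) = 0
  · have hm' : legendreSym q v.m = 0 := (legendreSym.eq_zero_iff q _).2 hm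
    rw [hm', mul_zero, zero_mul, Int.cast_zero, zero_mul]
    refine Finset.sum_eq_zero fun y₁ _ => Finset.sum_eq_zero fun y₂ _ =>
      Finset.sum_eq_zero fun y₄ _ => ?_
    rw [dilatedCoeff]
    split
    · have : (v.translate (-(y₁ : ℤ)) (-(y₂ : ℤ)) (-(y₄ : ℤ))).m = v.m := rfl
      rw [this, hm', mul_zero, zero_mul, Int.cast_zero, zero_mul, mul_zero]
    · rw [mul_zero]
  set F : ZMod q → ZMod q → ZMod q → ℤ := fun y₁ y₂ y₄ =>
    quadraticChar (ZMod q) (y₁ * y₄ - y₂ ^ 2) *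
      charInd ν (((v.b₁ : ZMod q) / v.m - y₄) * ((v.b₃ : ZMod q) / v.m - y₁) -
        ((v.b₂ : ZMod q) / v.m + y₂) ^ 2) with hF
  set c : ℂ := (((ν : ℤ) * legendreSym q v.m : ℤ) : ℂ) * awayCoeff χ' (v.dilate (q : ℤ)) with hcdef
  have hterm : ∀ y₁ y₂ y₄ : ℕ,
      (legendreSym q (!![(y₁ : ℤ), (y₂ : ℤ); (y₂ : ℤ), (y₄ : ℤ)] : IntMat).det : ℂ) *
        dilatedCoeff q χ' ν (v.translate (-(y₁ : ℤ)) (-(y₂ : ℤ)) (-(y₄ : ℤ))) =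
      c * (F y₁ y₂ y₄ : ℂ) := fun y₁ y₂ y₄ => by
    rw [dilatedCoeff, if_pos (by
      rwa [PluckerVec.isIsotropic_translate, PluckerVec.isPrimitive_translate]),
      awayCoeff_dilate_translate hq]
    have h1 : legendreSym q (!![(y₁ : ℤ), (y₂ : ℤ); (y₂ : ℤ), (y₄ : ℤ)] : IntMat).det =
        quadraticChar (ZMod q) ((y₁ : ZMod q) * y₄ - (y₂ : ZMod q) ^ 2) := by
      rw [legendreSym, Matrix.det_fin_two_of]
      congr 1
      push_cast
      ring
    have h2 : charInd ν (((v.translate (-(y₁ : ℤ)) (-(y₂ : ℤ)) (-(y₄ : ℤ))).n *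
        (v.translate (-(y₁ : ℤ)) (-(y₂ : ℤ)) (-(y₄ : ℤ))).m : ℤ) : ZMod q) =
        charInd ν (((v.b₁ : ZMod q) / v.m - y₄) * ((v.b₃ : ZMod q) / v.m - y₁) -
        ((v.b₂ : ZMod q) / v.m + y₂) ^ 2) := by
      refine Eq.trans ?_ (charInd_sq_mul ν hm _)
      congr 1
      have h3 : (v.m : ZMod q) * v.n = v.b₁ * v.b₃ - (v.b₂ : ZMod q) ^ 2 := by
        exact_mod_cast congrArg (Int.cast : ℤ → ZMod q) hi
      simp only [PluckerVec.translate]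
      push_cast
      field_simp
      linear_combination h3
    rw [h1, h2, hcdef, hF]
    have : (v.translate (-(y₁ : ℤ)) (-(y₂ : ℤ)) (-(y₄ : ℤ))).m = v.m := rfl
    rw [this]
    push_cast
    ring
  simp only [hterm]
  rw [sum_range_natCast₃ fun y₁ y₂ y₄ => c * (F y₁ y₂ y₄ : ℂ)]
  have hsum : twistSum (charInd ν) ((v.b₁ : ZMod q) / v.m) ((v.b₂ : ZMod q) / v.m)
      ((v.b₃ : ZMod q) / v.m) = ∑ y₁, ∑ y₂, ∑ y₄, F y₁ y₂ y₄ := by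
    simp only [twistSum, ← Fintype.sum_prod_type']
    refine Fintype.sum_equiv ⟨fun z => (z.2.2, -z.2.1, z.1), fun z => (z.2.2, -z.2.1, z.1),
      fun z => by simp, fun z => by simp⟩ _ _ fun z => ?_
    simp only [hF, Equiv.coe_fn_mk]
    congr 2 <;> ring
  rw [hsum, hcdef]
  simp only [← Finset.mul_sum]
  push_cast
  ring

/-- The evaluation of the character sum: `q ∤ n`, or `q ∣ n` with `b` nonzero or zero modulo `q`,
correspond to rank two, one and zero of `b` modulo `q`. -/
theorem two_mul_twistedCoeff (hq2 : q ≠ 2) (ν : ℤˣ) (v : PluckerVec ℤ) :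
    2 * twistedCoeff q χ' ν v =
      2 * ((legendreSym q (-1) : ℂ) * q * (q - 2)) * dilatedCoeff q χ' ν v +
        twistedCoeff₁ q χ' ν v + twistedCoeff₂ q χ' ν v := by
  have hchar : ringChar (ZMod q) ≠ 2 := by rwa [ZMod.ringChar_zmod_n]
  have hψ : quadraticChar (ZMod q) (-1) = legendreSym q (-1) := by
    rw [legendreSym]; push_cast; rfl
  have hcard : (Fintype.card (ZMod q) : ℤ) = q := by rw [ZMod.card]
  by_cases hc : v.IsIsotropic ∧ v.IsPrimitive
  swap
  · rw [twistedCoeff, dilatedCoeff, twistedCoeff₁, twistedCoeff₂, if_neg hc, if_neg hc,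
      if_neg fun h => hc ⟨h.1, h.2.1⟩, if_neg fun h => hc ⟨h.1, h.2.1⟩]
    ring
  rw [twistedCoeff, dilatedCoeff, if_pos hc, if_pos hc]
  have hi := hc.1
  rw [PluckerVec.IsIsotropic] at hi
  have hi' : (v.m : ZMod q) * v.n = v.b₁ * v.b₃ - (v.b₂ : ZMod q) ^ 2 := by
    exact_mod_cast congrArg (Int.cast : ℤ → ZMod q) hi
  by_cases hm : (v.m : ZMod q) = 0
  · have hm' : legendreSym q v.m = 0 := (legendreSym.eq_zero_iff q _).2 hm
    have e1 : twistedCoeff₁ q χ' ν v = 0 := by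
      rw [twistedCoeff₁]; split <;> simp [hm']
    have e2 : twistedCoeff₂ q χ' ν v = 0 := by
      rw [twistedCoeff₂]; split <;> simp [hm']
    rw [e1, e2, hm']
    simp
  have hdet : (v.b₁ : ZMod q) / v.m * (v.b₃ / v.m) - ((v.b₂ : ZMod q) / v.m) ^ 2 = v.n / v.m := by
    field_simp
    linear_combination -hi'
  have hdvd : ∀ x : ℤ, (q : ℤ) ∣ x ↔ (x : ZMod q) = 0 := fun x =>
    (ZMod.intCast_zmod_eq_zero_iff_dvd _ _).symm
  by_cases hn : (q : ℤ) ∣ v.n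
  swap
  · have e1 : twistedCoeff₁ q χ' ν v = 0 := if_neg fun h => hn h.2.2.1
    have e2 : twistedCoeff₂ q χ' ν v = 0 := if_neg fun h => hn h.2.2.1
    have hn0 : (v.n : ZMod q) ≠ 0 := fun h => hn ((hdvd _).2 h)
    rw [e1, e2, twistSum_charInd_of_det_ne_zero ν hchar (by rw [hdet]; exact div_ne_zero hn0 hm),
      hdet, ← charInd_sq_mul ν hm,
      show (v.m : ZMod q) ^ 2 * (v.n / v.m) = ((v.n * v.m : ℤ) : ZMod q) by
        push_cast; field_simp, hψ, hcard]
    push_cast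
    ring
  have hn0 : (v.n : ZMod q) = 0 := (hdvd _).1 hn
  have hind : charInd ν ((v.n * v.m : ℤ) : ZMod q) = 0 := by
    rw [charInd, Int.cast_mul, hn0, zero_mul, quadraticChar_zero, if_neg ν.ne_zero.symm]
  rw [hind]
  by_cases hb : (q : ℤ) ∣ v.b₁ ∧ (q : ℤ) ∣ v.b₂ ∧ (q : ℤ) ∣ v.b₃
  · have e1 : twistedCoeff₁ q χ' ν v = 0 := if_neg fun h => h.2.2.2 hb
    rw [e1, twistedCoeff₂, if_pos ⟨hc.1, hc.2, hn, hb⟩, (hdvd _).1 hb.1, (hdvd _).1 hb.2.1,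
      (hdvd _).1 hb.2.2, zero_div]
    have h := two_mul_twistSum_charInd_zero (F := ZMod q) ν hchar
    rw [hψ, hcard] at h
    rw [← h]
    push_cast
    ring
  · have e2 : twistedCoeff₂ q χ' ν v = 0 := if_neg fun h => hb h.2.2.2
    rw [e2, twistedCoeff₁, if_pos ⟨hc.1, hc.2, hn, hb⟩]
    have h := two_mul_twistSum_charInd_of_det_eq_zero ν hchar
      (x₁ := (v.b₁ : ZMod q) / v.m) (x₂ := (v.b₂ : ZMod q) / v.m) (x₃ := (v.b₃ : ZMod q) / v.m)
      (fun h => hb (by simpa [hdvd, hm] using h)) (by rw [hdet, hn0, zero_div])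
    rw [hψ, hcard] at h
    rw [← h]
    push_cast
    ring

end Twist

/-! ### Comparison of the twisted coefficients with the three Eisenstein series -/

section Comparison

variable {N₀ N₁ N₂ q : ℕ} [Fact q.Prime] {χ' : DirichletCharacter ℂ (N₀ * N₁ * N₂)}

/-- Primitivity of `(q m, b, n)` with `q ∤ m` forces `b` to have a nonzero diagonal entry modulo `q`. -/
theorem legendreSym_ne_zero_of_isPrimitive {v : PluckerVec ℤ} (hm : ¬(q : ℤ) ∣ v.m)
    (hi : (v.scaleFirst (q : ℤ)).IsIsotropic) (hp : (v.scaleFirst (q : ℤ)).IsPrimitive) :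
    legendreSym q (if (q : ℤ) ∣ v.b₁ then v.b₃ else v.b₁) ≠ 0 := by
  have hq0 : (q : ℤ) ≠ 0 := Int.natCast_ne_zero.2 (Fact.out : q.Prime).ne_zero
  have hqp := Nat.prime_iff_prime_int.1 (Fact.out : q.Prime)
  rw [Ne, legendreSym.eq_zero_iff, ZMod.intCast_zmod_eq_zero_iff_dvd]
  split_ifs with h1
  swap
  · exact h1
  intro h3
  have hi' : (q : ℤ) * v.m * v.n = v.b₁ * v.b₃ - v.b₂ ^ 2 := hi
  have h2 : (q : ℤ) ∣ v.b₂ := by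
    refine hqp.dvd_of_dvd_pow (n := 2) ?_
    rw [show v.b₂ ^ 2 = v.b₁ * v.b₃ - q * (v.m * v.n) by linear_combination hi']
    exact dvd_sub (h1.mul_right _) (dvd_mul_right _ _)
  have h4 : (q : ℤ) * q ∣ q * (v.m * v.n) := by
    rw [← mul_assoc, hi', sq]
    exact dvd_sub (mul_dvd_mul h1 h3) (mul_dvd_mul h2 h2)
  have hn := (hqp.dvd_or_dvd ((mul_dvd_mul_iff_left hq0).1 h4)).resolve_left hm
  exact (PluckerVec.isPrimitive_iff_not_prime_dvd _).1 hp q Fact.out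
    ⟨dvd_mul_right _ _, h1, h2, h3, hn⟩

open Classical in
/-- The difference of the two coefficients forgets the condition on the class of `b`. -/
theorem coeff₁₂_sub_scaleFirst (v : PluckerVec ℤ) :
    coeff₁₂ q χ' 1 (v.scaleFirst (q : ℤ)) - coeff₁₂ q χ' (-1) (v.scaleFirst (q : ℤ)) =
      if (v.scaleFirst (q : ℤ)).IsIsotropic ∧ (v.scaleFirst (q : ℤ)).IsPrimitive then
        (legendreSym q v.m : ℂ) * awayCoeff χ' (v.scaleFirst (q : ℤ)) else 0 := by
  have hq0 : (q : ℤ) ≠ 0 := Int.natCast_ne_zero.2 (Fact.out : q.Prime).ne_zero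
  have hdiv : (v.scaleFirst (q : ℤ)).m / (q : ℤ) = v.m := Int.mul_ediv_cancel_left _ hq0
  by_cases hc : (v.scaleFirst (q : ℤ)).IsIsotropic ∧ (v.scaleFirst (q : ℤ)).IsPrimitive
  swap
  · rw [if_neg hc, coeff₁₂, coeff₁₂, if_neg fun h => hc ⟨h.1, h.2.1⟩,
      if_neg fun h => hc ⟨h.1, h.2.1⟩, sub_zero]
  rw [if_pos hc]
  have hdvd : (q : ℤ) ∣ (v.scaleFirst (q : ℤ)).m := dvd_mul_right _ _
  by_cases hm : (v.m : ZMod q) = 0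
  · have hm' : legendreSym q v.m = 0 := (legendreSym.eq_zero_iff q _).2 hm
    have h : ∀ μ : ℤˣ, coeff₁₂ q χ' μ (v.scaleFirst (q : ℤ)) = 0 := fun μ => by
      rw [coeff₁₂, if_neg]
      rintro ⟨-, -, -, h⟩
      rw [hdiv, hm', zero_mul] at h
      exact μ.ne_zero h.symm
    rw [h, h, hm', sub_zero, Int.cast_zero, zero_mul]
  · have hl := legendreSym_ne_zero_of_isPrimitive
      (fun h => hm ((ZMod.intCast_zmod_eq_zero_iff_dvd _ _).2 h)) hc.1 hc.2
    have h1 := legendreSym.eq_one_or_neg_one q hm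
    have h2 := legendreSym.eq_one_or_neg_one q (mt (legendreSym.eq_zero_iff q _).2 hl)
    have h3 : legendreSym q v.m * legendreSym q (if (q : ℤ) ∣ v.b₁ then v.b₃ else v.b₁) = 1 ∨
        legendreSym q v.m * legendreSym q (if (q : ℤ) ∣ v.b₁ then v.b₃ else v.b₁) = -1 := by
      rcases h1 with h1 | h1 <;> rcases h2 with h2 | h2 <;> rw [h1, h2] <;> simp
    have hval : ∀ μ : ℤˣ, coeff₁₂ q χ' μ (v.scaleFirst (q : ℤ)) =
        if legendreSym q v.m * legendreSym q (if (q : ℤ) ∣ v.b₁ then v.b₃ else v.b₁) = μ then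
          ((μ : ℤ) : ℂ) * (legendreSym q v.m : ℂ) * awayCoeff χ' (v.scaleFirst (q : ℤ))
        else 0 := fun μ => by
      by_cases h : legendreSym q v.m * legendreSym q (if (q : ℤ) ∣ v.b₁ then v.b₃ else v.b₁) = μ
      · rw [if_pos h, coeff₁₂, if_pos ⟨hc.1, hc.2, hdvd, by rw [hdiv]; exact h⟩, hdiv]
      · rw [if_neg h, coeff₁₂, if_neg]
        rintro ⟨-, -, -, h'⟩
        rw [hdiv] at h'
        exact h h'
    rw [hval, hval]
    rcases h3 with h3 | h3 <;> rw [h3] <;> norm_num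

theorem hasSum_congr {β : Type*} {f g : β → ℂ} {a : ℂ} (h : ∀ b, f b = g b) :
    HasSum f a ↔ HasSum g a := by
  rw [funext h]

variable {f : PluckerVec ℤ → ℂ} {S : ℂ}

theorem hasSum_dilatedCoeff (ν : ℤˣ)
    (h : HasSum (fun v => (∑ α : (ZMod q)ˣ with quadraticChar (ZMod q) α.val = (ν : ℤ),
      coeff₀₂ q χ' α v) * f v) S) :
    HasSum (fun v => dilatedCoeff q χ' ν v * f (v.dilate (q : ℤ))) S := by
  rw [← (PluckerVec.dilate_injective (q := q)).hasSum_iff fun v hv => by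
    rw [sum_coeff₀₂_eq_zero ν hv, zero_mul]] at h
  simpa only [Function.comp_def, sum_coeff₀₂_dilate] using h

/-- The vectors with `q ∣ n` and `b` nonzero modulo `q` are `q (q m, b, n / q)` after dilation, and the
vectors `(q m, b, n / q)` are those of `𝔼_{1,2,+} - 𝔼_{1,2,-}`. -/
theorem hasSum_twistedCoeff₁ (hsf : Squarefree (q * (N₀ * N₁ * N₂))) (hχ' : χ' ^ 2 = 1) (ν : ℤˣ)
    {w : ℂ} (hf : ∀ v, f (v.scale (q : ℤ)) = w * f v)
    (h : HasSum (fun v => (coeff₁₂ q χ' 1 v - coeff₁₂ q χ' (-1) v) * f v) S) :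
    HasSum (fun v => twistedCoeff₁ q χ' ν v * f (v.dilate (q : ℤ)))
      ((((ν : ℤ) * (legendreSym q (-1) * q * (q - 1)) : ℤ) : ℂ) * χ' (q : ℤ) * w * S) := by
  obtain ⟨hq, -, hsf'⟩ := Nat.squarefree_mul_iff.1 hsf
  obtain ⟨h012, hs01, -⟩ := Nat.squarefree_mul_iff.1 hsf'
  obtain ⟨h01, -, -⟩ := Nat.squarefree_mul_iff.1 hs01
  have hqc : IsCoprime ((N₀ * N₁ * N₂ : ℕ) : ℤ) (q : ℤ) := Nat.isCoprime_iff_coprime.2 hq.symm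
  have hq0 : (q : ℤ) ≠ 0 := Int.natCast_ne_zero.2 (Fact.out : q.Prime).ne_zero
  rw [← (PluckerVec.scaleFirst_injective (q := q)).hasSum_iff fun v hv => by
    have h0 : ∀ μ : ℤˣ, coeff₁₂ q χ' μ v = 0 := fun μ => by
      rw [coeff₁₂, if_neg]
      rintro ⟨-, -, ⟨m, hm⟩, -⟩
      exact hv ⟨⟨m, v.b₁, v.b₂, v.b₃, v.n⟩, PluckerVec.ext hm.symm rfl rfl rfl rfl⟩
    rw [h0, h0, sub_zero, zero_mul]] at h
  rw [← (PluckerVec.scaleLast_injective (q := q)).hasSum_iff fun v hv => by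
    rw [twistedCoeff₁, if_neg, zero_mul]
    rintro ⟨-, -, ⟨n, hn⟩, -⟩
    exact hv ⟨⟨v.m, v.b₁, v.b₂, v.b₃, n⟩, PluckerVec.ext rfl rfl rfl rfl hn.symm⟩]
  refine (hasSum_congr fun v => ?_).1 (h.mul_left ((((ν : ℤ) * (legendreSym q (-1) * q * (q - 1)) : ℤ) : ℂ) * χ' (q : ℤ) * w))
  symm
  simp only [Function.comp_apply]
  rw [coeff₁₂_sub_scaleFirst, twistedCoeff₁, PluckerVec.dilate_scaleLast,
    awayCoeff_scale h01 h012 hχ' hqc, hf]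
  have hvm : (v.scaleLast (q : ℤ)).m = v.m := rfl
  by_cases hm : (q : ℤ) ∣ v.m
  · have hm' : legendreSym q v.m = 0 :=
      (legendreSym.eq_zero_iff q _).2 ((ZMod.intCast_zmod_eq_zero_iff_dvd _ _).2 hm)
    rw [hvm, hm']
    simp
  by_cases hi : (v.scaleLast (q : ℤ)).IsIsotropic
  swap
  · rw [if_neg fun h => hi h.1, if_neg fun h => hi ((PluckerVec.isIsotropic_scaleLast _).2 h.1)]
    simp
  have key := PluckerVec.isPrimitive_scaleLast_iff hm hi
  by_cases hp : (v.scaleFirst (q : ℤ)).IsPrimitive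
  · rw [if_pos ⟨hi, (key.2 hp).1, dvd_mul_right _ _, (key.2 hp).2⟩,
      if_pos ⟨(PluckerVec.isIsotropic_scaleLast _).1 hi, hp⟩, hvm]
    push_cast
    ring
  · rw [if_neg fun h => hp (key.1 ⟨h.2.1, h.2.2.2⟩), if_neg fun h => hp h.2]
    simp

/-- The vectors with `b = 0` modulo `q` are `q² (m, b / q, n / q²)` after dilation, and the vectors
`(m, b / q, n / q²)` are those of `𝔼₂`. -/
theorem hasSum_twistedCoeff₂ (hsf : Squarefree (q * (N₀ * N₁ * N₂))) (hχ' : χ' ^ 2 = 1) (ν : ℤˣ)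
    {w : ℂ} (hf : ∀ v, f (v.scale ((q : ℤ) ^ 2)) = w * f v)
    (h : HasSum (fun v => coeff₂ q χ' v * f v) S) :
    HasSum (fun v => twistedCoeff₂ q χ' ν v * f (v.dilate (q : ℤ)))
      ((((ν : ℤ) * (q * (q - 1) * (ν * q + legendreSym q (-1))) : ℤ) : ℂ) * w * S) := by
  obtain ⟨hq, -, hsf'⟩ := Nat.squarefree_mul_iff.1 hsf
  obtain ⟨h012, hs01, -⟩ := Nat.squarefree_mul_iff.1 hsf'
  obtain ⟨h01, -, -⟩ := Nat.squarefree_mul_iff.1 hs01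
  have hqc : IsCoprime ((N₀ * N₁ * N₂ : ℕ) : ℤ) ((q : ℤ) ^ 2) :=
    (Nat.isCoprime_iff_coprime.2 hq.symm).pow_right
  have hone : χ' (((q : ℤ) ^ 2 : ℤ) : ZMod (N₀ * N₁ * N₂)) = 1 := by
    have hu : IsUnit ((q : ℤ) : ZMod (N₀ * N₁ * N₂)) :=
      (ZMod.coe_int_isUnit_iff_isCoprime _ _).2 (Nat.isCoprime_iff_coprime.2 hq.symm)
    rw [Int.cast_pow, map_pow, ← MulChar.pow_apply' _ two_ne_zero, hχ', MulChar.one_apply hu]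
  rw [← (PluckerVec.codilate_injective (q := q)).hasSum_iff fun v hv => by
    by_cases hm : (q : ℤ) ∣ v.m
    · have hm' : legendreSym q v.m = 0 :=
        (legendreSym.eq_zero_iff q _).2 ((ZMod.intCast_zmod_eq_zero_iff_dvd _ _).2 hm)
      rw [twistedCoeff₂, hm']
      split <;> simp
    rw [twistedCoeff₂, if_neg, zero_mul]
    rintro ⟨hi, -, -, h1, h2, h3⟩
    obtain ⟨n, hn⟩ := PluckerVec.dvd_of_dvd_b hi hm h1 h2 h3
    obtain ⟨b₁, h1⟩ := h1
    obtain ⟨b₂, h2⟩ := h2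
    obtain ⟨b₃, h3⟩ := h3
    exact hv ⟨⟨v.m, b₁, b₂, b₃, n⟩, PluckerVec.ext rfl h1.symm h2.symm h3.symm hn.symm⟩]
  refine (hasSum_congr fun v => ?_).1 (h.mul_left ((((ν : ℤ) * (q * (q - 1) * (ν * q + legendreSym q (-1))) : ℤ) : ℂ) * w))
  symm
  simp only [Function.comp_apply]
  rw [coeff₂, twistedCoeff₂, PluckerVec.dilate_codilate, awayCoeff_scale h01 h012 hχ' hqc, hf, hone]
  have hvm : (v.codilate (q : ℤ)).m = v.m := rfl
  by_cases hm : (q : ℤ) ∣ v.m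
  · have hm' : legendreSym q v.m = 0 :=
      (legendreSym.eq_zero_iff q _).2 ((ZMod.intCast_zmod_eq_zero_iff_dvd _ _).2 hm)
    rw [hvm, hm']
    simp
  by_cases hc : v.IsIsotropic ∧ v.IsPrimitive
  · rw [if_pos hc, if_pos ⟨PluckerVec.isIsotropic_codilate.2 hc.1,
      (PluckerVec.isPrimitive_codilate hm).2 hc.2, (dvd_pow_self _ two_ne_zero).mul_right _,
      dvd_mul_right _ _, dvd_mul_right _ _, dvd_mul_right _ _⟩, hvm]
    push_cast
    ring
  · rw [if_neg hc, if_neg fun h => hc ⟨PluckerVec.isIsotropic_codilate.1 h.1,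
      (PluckerVec.isPrimitive_codilate hm).1 h.2.1⟩]
    simp

end Comparison

/-! ### The quadratic character -/

section Character

/-- A nontrivial quadratic character modulo the prime `q` is the Legendre symbol. -/
theorem apply_eq_legendreSym {q : ℕ} [Fact q.Prime] {χq : DirichletCharacter ℂ q}
    (h : ∀ u : ZMod q, u ≠ 0 → χq u ^ 2 = 1) (h1 : χq ≠ 1) {d : ℤ} (hd : (d : ZMod q) ≠ 0) :
    χq (d : ZMod q) = (legendreSym q d : ℂ) := by
  have hsq : ∀ u : ZMod q, u ≠ 0 → quadraticChar (ZMod q) u = 1 → χq u = 1 := fun u hu hu1 => by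
    obtain ⟨r, rfl⟩ := (quadraticChar_one_iff_isSquare hu).1 hu1
    rw [map_mul, ← sq]
    exact h r (left_ne_zero_of_mul hu)
  rw [legendreSym]
  rcases quadraticChar_dichotomy hd with hd1 | hd1
  · rw [hd1, hsq _ hd hd1, Int.cast_one]
  · obtain ⟨u, hu⟩ : ∃ u : (ZMod q)ˣ, χq u ≠ 1 := by
      by_contra! hall
      exact h1 (MulChar.ext fun u => by rw [hall u, MulChar.one_apply_coe])
    have hu1 : quadraticChar (ZMod q) (u : ZMod q) = -1 :=
      (quadraticChar_dichotomy u.ne_zero).resolve_left fun h' => hu (hsq _ u.ne_zero h')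
    have huval : χq u = -1 := (mul_self_eq_one_iff.1
      ((sq _).symm.trans (h _ u.ne_zero))).resolve_left hu
    have hprod : χq ((d : ZMod q) * u) = 1 :=
      hsq _ (mul_ne_zero hd u.ne_zero) (by rw [map_mul, hd1, hu1]; norm_num)
    rw [map_mul, huval] at hprod
    rw [hd1]
    push_cast
    linear_combination -hprod

variable {𝒩 q N' : ℕ} [Fact q.Prime] {χ : DirichletCharacter ℂ 𝒩} {χq : DirichletCharacter ℂ q}
  {χ' : DirichletCharacter ℂ N'}

/-- A quadratic character of squarefree modulus `q N'` that is nontrivial at the prime `q` is the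
product of the Legendre symbol modulo `q` and a quadratic character modulo `N'`. -/
theorem sq_eq_one_and_conj_apply (hcop : q.Coprime N') (h𝒩 : 𝒩 = q * N') (hq : q ∣ 𝒩)
    (hN' : N' ∣ 𝒩) (hχ : χ ^ 2 = 1)
    (hfac : χ = DirichletCharacter.changeLevel hq χq * DirichletCharacter.changeLevel hN' χ')
    (hχq : χq ≠ 1) :
    χ' ^ 2 = 1 ∧ ∀ d : ℤ, IsCoprime (𝒩 : ℤ) d → conj (χ d) = (legendreSym q d : ℂ) * χ' d := by
  have hval : ∀ d : ℤ, IsCoprime (𝒩 : ℤ) d → χ d = χq d * χ' d := fun d hd => by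
    rw [hfac, MulChar.mul_apply, DirichletCharacter.changeLevel_eq_cast_of_dvd' _ _ hd.symm,
      DirichletCharacter.changeLevel_eq_cast_of_dvd' _ _ hd.symm]
  have hsq : ∀ d : ℤ, IsCoprime (𝒩 : ℤ) d → (χq d * χ' d) ^ 2 = 1 := fun d hd => by
    rw [← hval d hd, ← MulChar.pow_apply' _ two_ne_zero, hχ,
      MulChar.one_apply ((ZMod.coe_int_isUnit_iff_isCoprime _ _).2 hd)]
  -- an integer with prescribed unit residues modulo `q` and `N'`
  have hcrt : ∀ (x : ZMod q) (y : ZMod N'), IsUnit x → IsUnit y →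
      ∃ d : ℤ, IsCoprime (𝒩 : ℤ) d ∧ (d : ZMod q) = x ∧ (d : ZMod N') = y := fun x y hx hy => by
    obtain ⟨d, hd⟩ := ZMod.intCast_surjective ((ZMod.chineseRemainder hcop).symm (x, y))
    have hd' := congrArg (ZMod.chineseRemainder hcop) hd
    rw [map_intCast, RingEquiv.apply_symm_apply] at hd'
    have e1 : (d : ZMod q) = x := congrArg Prod.fst hd'
    have e2 : (d : ZMod N') = y := congrArg Prod.snd hd'
    refine ⟨d, ?_, e1, e2⟩
    rw [h𝒩, Nat.cast_mul]
    exact IsCoprime.mul_left ((ZMod.coe_int_isUnit_iff_isCoprime _ _).1 (e1 ▸ hx))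
      ((ZMod.coe_int_isUnit_iff_isCoprime _ _).1 (e2 ▸ hy))
  have hχ' : χ' ^ 2 = 1 := MulChar.ext fun u => by
    obtain ⟨d, hd, h1, h2⟩ := hcrt 1 u isUnit_one u.isUnit
    have := hsq d hd
    rw [h1, h2, map_one, one_mul] at this
    rw [MulChar.pow_apply' _ two_ne_zero, this, MulChar.one_apply_coe]
  refine ⟨hχ', fun d hd => ?_⟩
  have hq2 : ∀ u : ZMod q, u ≠ 0 → χq u ^ 2 = 1 := fun u hu => by
    obtain ⟨d, hd, h1, h2⟩ := hcrt u 1 (isUnit_iff_ne_zero.2 hu) isUnit_one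
    have := hsq d hd
    rwa [h1, h2, map_one, mul_one] at this
  have hdq : (d : ZMod q) ≠ 0 := isUnit_iff_ne_zero.1 ((ZMod.coe_int_isUnit_iff_isCoprime _ _).2
    (hd.of_isCoprime_of_dvd_left (Int.natCast_dvd_natCast.2 hq)))
  rw [← apply_eq_legendreSym hq2 hχq hdq, ← hval d hd]
  have h := hsq d hd
  rw [← hval d hd] at h
  rcases mul_self_eq_one_iff.1 ((sq _).symm.trans h) with h | h <;> rw [h] <;> simp

end Character

/-! ### The twisted Eisenstein series -/

section Main

theorem IsCoefficient.hasSum {𝒩 : ℕ} {χ : DirichletCharacter ℂ 𝒩} {L : ℕ} {M₀ : IntMat}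
    {C : PluckerVec ℤ → ℂ} (hC : IsCoefficient χ L M₀ C) (hM₀ : M₀ᵀ = M₀) (hL : 0 < L) {k : ℕ}
    (hk : 4 ≤ k) (hle : ∀ v, ‖C v‖ ≤ 1) {τ : Matrix (Fin 2) (Fin 2) ℂ}
    (hτ : τ ∈ siegelUpperHalfSpace) :
    HasSum (fun v => C v * ell τ v ^ (-(k : ℤ))) (2 * eisenstein k χ L M₀ τ) := by
  have hs := summable_mul_ell_zpow hτ hk hle hC.isIsotropic hC.isPrimitive
  rw [hC.eisenstein_eq_tsum hM₀ hL k hτ.1, ← mul_assoc, mul_one_div_cancel two_ne_zero, one_mul]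
  exact hs.hasSum

theorem IsCoefficient.summable {𝒩 : ℕ} {χ : DirichletCharacter ℂ 𝒩} {L : ℕ} {M₀ : IntMat}
    {C : PluckerVec ℤ → ℂ} (hC : IsCoefficient χ L M₀ C) (hM₀ : M₀ᵀ = M₀) {k : ℕ}
    (hk : 4 ≤ k) (hle : ∀ v, ‖C v‖ ≤ 1) {τ : Matrix (Fin 2) (Fin 2) ℂ}
    (hτ : τ ∈ siegelUpperHalfSpace) : Summable (eisensteinTerm k χ L M₀ τ) :=
  hC.summable_eisensteinTerm hM₀ hτ.1
    (summable_mul_ell_zpow hτ hk hle hC.isIsotropic hC.isPrimitive)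

variable {N₀ N₁ N₂ q : ℕ} [Fact q.Prime] {χ' : DirichletCharacter ℂ (N₀ * N₁ * N₂)}

/-- The twist operator on a series with the coefficients of `𝔼_{0,2,ν}`. -/
theorem hasSum_twistA2 (hsf : Squarefree (q * (N₀ * N₁ * N₂))) (k : ℕ) (ν : ℤˣ)
    {E : Matrix (Fin 2) (Fin 2) ℂ → ℂ}
    (hE : ∀ τ ∈ siegelUpperHalfSpace,
      HasSum (fun v => (∑ α : (ZMod q)ˣ with quadraticChar (ZMod q) α.val = (ν : ℤ),
        coeff₀₂ q χ' α v) * ell τ v ^ (-(k : ℤ))) (2 * E τ))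
    {τ : Matrix (Fin 2) (Fin 2) ℂ} (hτ : τ ∈ siegelUpperHalfSpace) :
    HasSum (fun v => twistedCoeff q χ' ν v * ell τ (v.dilate (q : ℤ)) ^ (-(k : ℤ)))
      (2 * twistA2 k q E τ) := by
  have hq0 : q ≠ 0 := (Fact.out : q.Prime).ne_zero
  have hqc : IsCoprime ((N₀ * N₁ * N₂ : ℕ) : ℤ) (q : ℤ) :=
    Nat.isCoprime_iff_coprime.2 (Nat.squarefree_mul_iff.1 hsf).1.symm
  have hY : ∀ y₁ y₂ y₄ : ℕ, HasSum (fun v : PluckerVec ℤ =>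
      dilatedCoeff q χ' ν (v.translate (-(y₁ : ℤ)) (-(y₂ : ℤ)) (-(y₄ : ℤ))) *
        ell τ (v.dilate (q : ℤ)) ^ (-(k : ℤ)))
      (2 * E (τ + (q : ℂ)⁻¹ • (!![(y₁ : ℤ), (y₂ : ℤ); (y₂ : ℤ), (y₄ : ℤ)] : IntMat).map
        (Int.cast : ℤ → ℂ))) := fun y₁ y₂ y₄ => by
    have h := hasSum_dilatedCoeff ν (hE _ (add_mem_siegelUpperHalfSpace hτ q y₁ y₂ y₄))
    rw [← (PluckerVec.translateEquiv (y₁ : ℤ) (y₂ : ℤ) (y₄ : ℤ)).hasSum_iff]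
    refine (hasSum_congr fun v => ?_).1 h
    rw [ell_dilate_translate hτ.1 hq0, Function.comp_apply]
    congr 2
    exact ((PluckerVec.translateEquiv (y₁ : ℤ) (y₂ : ℤ) (y₄ : ℤ)).left_inv v).symm
  have hsum := hasSum_sum (s := range q) fun y₁ _ => hasSum_sum (s := range q) fun y₂ _ =>
    hasSum_sum (s := range q) fun y₄ _ => (hY y₁ y₂ y₄).mul_left
      (legendreSym q (!![(y₁ : ℤ), (y₂ : ℤ); (y₂ : ℤ), (y₄ : ℤ)] : IntMat).det : ℂ)
  have hval : 2 * twistA2 k q E τ = ∑ y₁ ∈ range q, ∑ y₂ ∈ range q, ∑ y₄ ∈ range q,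
      (legendreSym q (!![(y₁ : ℤ), (y₂ : ℤ); (y₂ : ℤ), (y₄ : ℤ)] : IntMat).det : ℂ) *
      (2 * E (τ + (q : ℂ)⁻¹ • (!![(y₁ : ℤ), (y₂ : ℤ); (y₂ : ℤ), (y₄ : ℤ)] : IntMat).map
        (Int.cast : ℤ → ℂ))) := by
    simp only [twistA2, slash_unipotent, Finset.mul_sum]
    refine Finset.sum_congr rfl fun y₁ _ => Finset.sum_congr rfl fun y₂ _ =>
      Finset.sum_congr rfl fun y₄ _ => ?_
    ring
  rw [hval]
  refine (hasSum_congr fun v => ?_).1 hsum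
  rw [← sum_legendreSym_mul_dilatedCoeff hqc]
  simp only [Finset.sum_mul, mul_assoc]

theorem twistA2_eisenstein02 {k : ℕ} (hk : 4 ≤ k) (hq2 : q ≠ 2)
    (hsf : Squarefree (q * (N₀ * N₁ * N₂))) {𝒩 : ℕ} (h𝒩 : 𝒩 = q * (N₀ * N₁ * N₂))
    {χ : DirichletCharacter ℂ 𝒩} (hχ' : χ' ^ 2 = 1)
    (hχ : ∀ d : ℤ, IsCoprime (𝒩 : ℤ) d → conj (χ d) = (legendreSym q d : ℂ) * χ' d)
    {ω : ℤ} (hω : legendreSym q ω = -1)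
    {M₂ : IntMat} (hM₂ : IsPartitionMatrix N₀ N₁ (q * N₂) M₂)
    {M₁₂ : ℤˣ → IntMat} (hM₁₂ : ∀ μ, IsPartitionMatrix N₀ N₁ N₂ (M₁₂ μ))
    (hM₁₂pos : MatCong (q ^ 2) (M₁₂ 1) (diagonal ![1, (q : ℤ)]))
    (hM₁₂neg : MatCong (q ^ 2) (M₁₂ (-1)) (diagonal ![1, (q : ℤ) * ω]))
    {M₀₂ : (ZMod q)ˣ → IntMat} (hM₀₂ : ∀ α, IsPartitionMatrix N₀ N₁ N₂ (M₀₂ α))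
    (hM₀₂q : ∀ (α : (ZMod q)ˣ) (a : ℤ), (a : ZMod q) = α →
      MatCong (q ^ 2) (M₀₂ α) (diagonal ![(q : ℤ), (q : ℤ) * a]))
    (ν : ℤˣ) {τ : Matrix (Fin 2) (Fin 2) ℂ} (hτ : τ ∈ siegelUpperHalfSpace) :
    (∀ α, Summable (eisensteinTerm k χ (q * 𝒩) (M₀₂ α) τ)) ∧
    (∀ μ, Summable (eisensteinTerm k χ (q * 𝒩) (M₁₂ μ) τ)) ∧
    Summable (eisensteinTerm k χ 𝒩 M₂ τ) ∧
    twistA2 k q (eisenstein02 k q χ M₀₂ ν) τ =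
      (legendreSym q (-1) : ℂ) * q * (q - 2) * eisenstein02 k q χ M₀₂ ν τ
      + (legendreSym q (-1) : ℂ) * ((ν : ℤ) : ℂ) * χ' (q : ZMod (N₀ * N₁ * N₂)) *
          (q : ℂ) ^ (1 - (k : ℤ)) * (q - 1) / 2 *
          (eisenstein k χ (q * 𝒩) (M₁₂ 1) τ - eisenstein k χ (q * 𝒩) (M₁₂ (-1)) τ)
      + (q : ℂ) ^ (1 - 2 * (k : ℤ)) * (q - 1) *
          (q + (legendreSym q (-1) : ℂ) * ((ν : ℤ) : ℂ)) / 2 * eisenstein k χ 𝒩 M₂ τ := by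
  have hqpos : 0 < q := (Fact.out : q.Prime).pos
  have hqC : (q : ℂ) ≠ 0 := Nat.cast_ne_zero.2 hqpos.ne'
  have hN : 0 < 𝒩 := h𝒩 ▸ Nat.pos_of_ne_zero hsf.ne_zero
  have hχ0 : ∀ d : ℤ, IsCoprime ((q * (N₀ * N₁ * N₂) : ℕ) : ℤ) d →
      conj (χ d) = (legendreSym q d : ℂ) * χ' d := fun d hd => hχ d (by rw [h𝒩]; exact hd)
  have hL : q * 𝒩 = q ^ 2 * (N₀ * N₁ * N₂) := by rw [h𝒩]; ring
  have hM₂' : IsPartitionMatrix N₀ N₁ N₂ M₂ :=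
    ⟨hM₂.1, hM₂.2.1, hM₂.2.2.1, fun p hp h => hM₂.2.2.2 p hp (h.mul_left _)⟩
  have hC₂ : IsCoefficient χ 𝒩 M₂ (coeff₂ q χ') :=
    isCoefficient_coeff₂ hsf hχ' hχ0 h𝒩 hM₂' (hM₂.2.2.2 q Fact.out (dvd_mul_right _ _))
  have hC₁₂ : ∀ μ, IsCoefficient χ (q * 𝒩) (M₁₂ μ) (coeff₁₂ q χ' μ) := fun μ => by
    rcases Int.units_eq_one_or μ with rfl | rfl
    · exact isCoefficient_coeff₁₂ hsf hχ' hχ0 hL (κ := 1) (by simp) (hM₁₂ 1)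
        (by rw [mul_one]; exact hM₁₂pos)
    · exact isCoefficient_coeff₁₂ hsf hχ' hχ0 hL (κ := ω) (by rw [hω]; simp) (hM₁₂ (-1)) hM₁₂neg
  have hC₀₂ : ∀ α, IsCoefficient χ (q * 𝒩) (M₀₂ α) (coeff₀₂ q χ' α) := fun α => by
    obtain ⟨a, ha⟩ := ZMod.intCast_surjective (α : ZMod q)
    exact isCoefficient_coeff₀₂ hq2 hsf hχ' hχ0 hL ha (hM₀₂ α) (hM₀₂q α a ha)
  refine ⟨fun α => (hC₀₂ α).summable (hM₀₂ α).transpose_eq hk (norm_coeff₀₂_le_one α) hτ,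
    fun μ => (hC₁₂ μ).summable (hM₁₂ μ).transpose_eq hk (norm_coeff₁₂_le_one μ) hτ,
    hC₂.summable hM₂.transpose_eq hk norm_coeff₂_le_one hτ, ?_⟩
  have hqN : 0 < q * 𝒩 := Nat.mul_pos hqpos hN
  have hE : ∀ τ ∈ siegelUpperHalfSpace,
      HasSum (fun v => (∑ α : (ZMod q)ˣ with quadraticChar (ZMod q) α.val = (ν : ℤ),
        coeff₀₂ q χ' α v) * ell τ v ^ (-(k : ℤ))) (2 * eisenstein02 k q χ M₀₂ ν τ) := by
    intro τ hτ
    simp only [eisenstein02, Finset.mul_sum, Finset.sum_mul]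
    exact hasSum_sum fun α _ =>
      (hC₀₂ α).hasSum (hM₀₂ α).transpose_eq hqN hk (norm_coeff₀₂_le_one α) hτ
  have h₁₂ : ∀ μ, HasSum (fun v => coeff₁₂ q χ' μ v * ell τ v ^ (-(k : ℤ)))
      (2 * eisenstein k χ (q * 𝒩) (M₁₂ μ) τ) := fun μ =>
    (hC₁₂ μ).hasSum (hM₁₂ μ).transpose_eq hqN hk (norm_coeff₁₂_le_one μ) hτ
  have h₂ := hC₂.hasSum hM₂.transpose_eq hN hk norm_coeff₂_le_one hτ
  have hdiff := (h₁₂ 1).sub (h₁₂ (-1))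
  simp only [← sub_mul] at hdiff
  have hs : ∀ (t : ℤ) (v : PluckerVec ℤ), ell τ (v.scale t) ^ (-(k : ℤ)) =
      (t : ℂ) ^ (-(k : ℤ)) * ell τ v ^ (-(k : ℤ)) := fun t v => by rw [ell_scale, mul_zpow]
  have s0 := (hasSum_dilatedCoeff ν (hE τ hτ)).mul_left
    (2 * ((legendreSym q (-1) : ℂ) * q * (q - 2)))
  have s1 := hasSum_twistedCoeff₁ hsf hχ' ν (hs q) hdiff
  have s2 := hasSum_twistedCoeff₂ hsf hχ' ν (hs ((q : ℤ) ^ 2)) h₂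
  have hrhs := (s0.add s1).add s2
  have hlhs := (hasSum_twistA2 hsf k ν hE hτ).mul_left 2
  have key := hlhs.unique ((hasSum_congr fun v => by
    rw [← mul_assoc 2 (twistedCoeff q χ' ν v), two_mul_twistedCoeff hq2]
    ring).1 hrhs)
  have e1 : (q : ℂ) ^ (1 - (k : ℤ)) = q * (q : ℂ) ^ (-(k : ℤ)) := by
    rw [sub_eq_add_neg, zpow_add₀ hqC, zpow_one]
  have e2 : (q : ℂ) ^ (1 - 2 * (k : ℤ)) = q * ((q : ℂ) ^ 2) ^ (-(k : ℤ)) := by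
    rw [sub_eq_add_neg, zpow_add₀ hqC, zpow_one, ← zpow_natCast, ← _root_.zpow_mul]
    congr 2
    push_cast
    ring
  have hν : ((ν : ℤ) : ℂ) * ((ν : ℤ) : ℂ) = 1 := by
    rw [← Int.cast_mul, ← Units.val_mul, Int.units_mul_self]; simp
  rw [e1, e2]
  push_cast at key
  linear_combination (1 / 4) * key + (q : ℂ) ^ 2 * (q - 1) / 2 * ((q : ℂ) ^ 2) ^ (-(k : ℤ)) *
    eisenstein k χ 𝒩 M₂ τ * hν

end Main

end SiegelDegreeTwo

end

theorem proposition5p33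
    (k : ℕ) (hk : 4 ≤ k)
    (𝒩 : ℕ) (h𝒩 : Squarefree 𝒩) (hodd : Odd 𝒩)
    (q : ℕ) [Fact q.Prime] (hq : q ∣ 𝒩)
    -- the quadratic character `χ = χ_q χ_{𝒩/q}`, with `χ_q ≠ 1`
    (χ : DirichletCharacter ℂ 𝒩) (hχ : χ ^ 2 = 1)
    (χq : DirichletCharacter ℂ q) (χ' : DirichletCharacter ℂ (𝒩 / q))
    (hfac : χ = DirichletCharacter.changeLevel hq χq *
      DirichletCharacter.changeLevel (Nat.div_dvd_of_dvd hq) χ')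
    (hχq : χq ≠ 1)
    -- the partition `σ` of `𝒩 / q`
    (N₀ N₁ N₂ : ℕ) (hσ : N₀ * N₁ * N₂ = 𝒩 / q)
    (ω : ℤ) (hω : legendreSym q ω = -1)
    -- `M_2`, `M_{1,2,±}` and `M_{0,2,α}`
    (M₂ : SiegelDegreeTwo.IntMat) (hM₂ : SiegelDegreeTwo.IsPartitionMatrix N₀ N₁ (q * N₂) M₂)
    (M₁₂ : ℤˣ → SiegelDegreeTwo.IntMat)
    (hM₁₂ : ∀ μ, SiegelDegreeTwo.IsPartitionMatrix N₀ N₁ N₂ (M₁₂ μ))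
    (hM₁₂pos : SiegelDegreeTwo.MatCong (q ^ 2) (M₁₂ 1) (Matrix.diagonal ![1, (q : ℤ)]))
    (hM₁₂neg : SiegelDegreeTwo.MatCong (q ^ 2) (M₁₂ (-1)) (Matrix.diagonal ![1, (q : ℤ) * ω]))
    (M₀₂ : (ZMod q)ˣ → SiegelDegreeTwo.IntMat)
    (hM₀₂ : ∀ α, SiegelDegreeTwo.IsPartitionMatrix N₀ N₁ N₂ (M₀₂ α))
    (hM₀₂q : ∀ (α : (ZMod q)ˣ) (a : ℤ), (a : ZMod q) = α →
      SiegelDegreeTwo.MatCong (q ^ 2) (M₀₂ α) (Matrix.diagonal ![(q : ℤ), (q : ℤ) * a]))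
    (ν : ℤˣ)
    (τ : Matrix (Fin 2) (Fin 2) ℂ) (hτ : τ ∈ SiegelDegreeTwo.siegelUpperHalfSpace) :
    -- the series involved converge absolutely
    (∀ α, Summable (SiegelDegreeTwo.eisensteinTerm k χ (q * 𝒩) (M₀₂ α) τ)) ∧
    (∀ μ, Summable (SiegelDegreeTwo.eisensteinTerm k χ (q * 𝒩) (M₁₂ μ) τ)) ∧
    Summable (SiegelDegreeTwo.eisensteinTerm k χ 𝒩 M₂ τ) ∧
    SiegelDegreeTwo.twistA2 k q (SiegelDegreeTwo.eisenstein02 k q χ M₀₂ ν) τ =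
      (legendreSym q (-1) : ℂ) * q * (q - 2) * SiegelDegreeTwo.eisenstein02 k q χ M₀₂ ν τ
      + (legendreSym q (-1) : ℂ) * ((ν : ℤ) : ℂ) * χ' (q : ZMod (𝒩 / q)) *
          (q : ℂ) ^ (1 - (k : ℤ)) * (q - 1) / 2 *
          (SiegelDegreeTwo.eisenstein k χ (q * 𝒩) (M₁₂ 1) τ -
            SiegelDegreeTwo.eisenstein k χ (q * 𝒩) (M₁₂ (-1)) τ)
      + (q : ℂ) ^ (1 - 2 * (k : ℤ)) * (q - 1) *
          (q + (legendreSym q (-1) : ℂ) * ((ν : ℤ) : ℂ)) / 2 *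
          SiegelDegreeTwo.eisenstein k χ 𝒩 M₂ τ := by
  have h : 𝒩 = q * (𝒩 / q) := (Nat.mul_div_cancel' hq).symm
  have hq2 : q ≠ 2 := fun h2 => (Nat.not_even_iff_odd.2 hodd) (even_iff_two_dvd.2 (h2 ▸ hq))
  have hsf : Squarefree (q * (𝒩 / q)) := h ▸ h𝒩
  obtain ⟨hχ', hconj⟩ := SiegelDegreeTwo.sq_eq_one_and_conj_apply
    (Nat.squarefree_mul_iff.1 hsf).1 h hq (Nat.div_dvd_of_dvd hq) hχ hfac hχq
  clear hfac hχ hχq χq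
  generalize 𝒩 / q = N' at *
  subst hσ
  exact SiegelDegreeTwo.twistA2_eisenstein02 hk hq2 hsf h hχ' hconj hω hM₂ hM₁₂ hM₁₂pos hM₁₂neg
    hM₀₂ hM₀₂q ν hτ
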